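/- Let $\mathbf C$ be the Carleman operator $(\mathbf Cf)(t)=\int_0^\infty (t+s)^{-1}f(s)\,ds$ on the complex Hilbert space $L^2(\mathbb R_+)$, and let $Q$ be multiplication by $\langle \ln t\rangle=(1+|\ln t|^2)^{1/2}$. Let $V\ge 0$ be a Hilbert–Schmidt operator on $L^2(\mathbb R_+)$ with Hilbert–Schmidt norm $\|V\|_2$, and suppose that for some $\alpha>3/2$ the operator $Q^{\alpha}VQ^{\alpha}$ (defined on the domain of $Q^\alpha$) extends to a compact operator on $L^2(\mathbb R_+)$, denoted by the same symbol. Put $H=\mathbf C+V$. (i) The total number $N$ of eigenvalues of $H$ strictly larger than $\pi$, counted with multiplicity, is finite and $$N\le \pi^{-2}\bigl(\|V\|_2+\gamma_\alpha\|Q^\alpha VQ^\alpha\|\bigr)^2+1 ,$$ where $\gamma_\alpha\ge 0$ is the finite constant given by $$\gamma_\alpha^2=\pi^{-4}\int_0^\infty\!\!\int_0^\infty \langle\ln t\rangle^{-2\alpha}(ts)^{-1}\sigma_1(t/s)^2\langle\ln s\rangle^{-2\alpha}\,dt\,ds,\qquad \sigma_1(u)=\frac{1+u^2}{1-u^2}\ln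 u .$$ (ii) Let $\psi_0(t)=t^{-1/2}$ and define $(V\psi_0,\psi_0):=\bigl((Q^\alpha VQ^\alpha)Q^{-\alpha}\psi_0,\,Q^{-\alpha}\psi_0\bigr)$, where $Q^{-\alpha}\psi_0\in L^2(\mathbb R_+)$. Suppose in addition that at least one of the following holds: (a) $(V\psi_0,\psi_0)\ne0$; (b) $\int_0^\infty\!\int_0^\infty \mathbf v(t,s)(ts)^{-1/2}\,dt\,ds$ converges absolutely and is not zero, where $\mathbf v\in L^2(\mathbb R_+\times\mathbb R_+)$ is the integral kernel of $V$; (c) $V\neq0$ is a Hankel operator, that is, its kernel is $\mathbf v(t,s)=v(t+s)$ for some function $v$ on $\mathbb R_+$. Then $H$ has at least one eigenvalue strictly larger than $\pi$. -/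

import Mathlib

namespace CarlemanPerturbation

open MeasureTheory Set Filter Topology
open scoped ENNReal InnerProductSpace

noncomputable section

/-- Lebesgue measure on the half-line `(0, ∞)`. -/
abbrev halfLine : Measure ℝ := volume.restrict (Ioi (0 : ℝ))

/-- The complex Hilbert space `L²(ℝ₊)`. -/
abbrev L2 : Type := Lp ℂ 2 halfLine

theorem schur_weight_hasDerivAt {t s : ℝ} (ht : 0 < t) (hs : 0 < s) :
    HasDerivAt (fun x : ℝ => 2 * (√t)⁻¹ * Real.arctan (√x / √t))
      ((t + s)⁻¹ * (√s)⁻¹) s := by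
  have h1 := (((Real.hasDerivAt_sqrt hs.ne').div_const (√t)).arctan).const_mul (2 * (√t)⁻¹)
  refine h1.congr_deriv ?_
  have a := Real.sqrt_pos.2 ht
  have b := Real.sqrt_pos.2 hs
  have h2 : t = √t ^ 2 := (Real.sq_sqrt ht.le).symm
  have h3 : s = √s ^ 2 := (Real.sq_sqrt hs.le).symm
  have h4 : (t + s)⁻¹ = (√t ^ 2 + √s ^ 2)⁻¹ := by rw [← h2, ← h3]
  rw [h4]
  generalize √t = x at *
  generalize √s = y at *
  have h5 : x ^ 2 + y ^ 2 ≠ 0 := by positivity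
  field_simp

theorem lintegral_schur_weight {t : ℝ} (ht : 0 < t) :
    ∫⁻ s, ENNReal.ofReal ((t + s)⁻¹ * (√s)⁻¹) ∂halfLine
      = ENNReal.ofReal Real.pi * ENNReal.ofReal (√t)⁻¹ := by
  have hst := Real.sqrt_pos.2 ht
  have hcont : ContinuousWithinAt (fun x : ℝ => 2 * (√t)⁻¹ * Real.arctan (√x / √t))
      (Ici 0) 0 := by
    apply Continuous.continuousWithinAt
    fun_prop
  have hd : ∀ x ∈ Ioi (0 : ℝ), HasDerivAt (fun x : ℝ => 2 * (√t)⁻¹ * Real.arctan (√x / √t))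
      ((t + x)⁻¹ * (√x)⁻¹) x := fun x hx => schur_weight_hasDerivAt ht hx
  have hp : ∀ x ∈ Ioi (0 : ℝ), 0 ≤ (t + x)⁻¹ * (√x)⁻¹ := fun x hx => by
    have : 0 < x := hx
    positivity
  have hl : Tendsto (fun x : ℝ => 2 * (√t)⁻¹ * Real.arctan (√x / √t)) atTop
      (𝓝 (2 * (√t)⁻¹ * (Real.pi / 2))) := by
    apply Tendsto.const_mul
    have := (Real.tendsto_arctan_atTop).mono_right (nhdsWithin_le_nhds)
    exact this.comp (Real.tendsto_sqrt_atTop.atTop_div_const hst)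
  have hi := integrableOn_Ioi_deriv_of_nonneg hcont hd hp hl
  have he := integral_Ioi_of_hasDerivAt_of_nonneg hcont hd hp hl
  rw [← ofReal_integral_eq_lintegral_ofReal hi (ae_restrict_of_forall_mem measurableSet_Ioi hp),
    he, ← ENNReal.ofReal_mul Real.pi_pos.le]
  congr 1
  simp
  ring

theorem ofReal_sq_rpow_half (x : ℝ) (hx : 0 ≤ x) :
    ENNReal.ofReal (√x) ^ (2 : ℝ) = ENNReal.ofReal x := by
  rw [ENNReal.rpow_two, ← ENNReal.ofReal_pow (Real.sqrt_nonneg x), Real.sq_sqrt hx]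

/-- Schur's test for the kernel `(t + s)⁻¹`. -/
theorem lintegral_carleman_sq_le (F : ℝ → ℝ≥0∞) (hF : AEMeasurable F halfLine) :
    ∫⁻ t, (∫⁻ s, ENNReal.ofReal (t + s)⁻¹ * F s ∂halfLine) ^ (2 : ℝ) ∂halfLine
      ≤ ENNReal.ofReal Real.pi ^ 2 * ∫⁻ s, F s ^ (2 : ℝ) ∂halfLine := by
  set p := ENNReal.ofReal Real.pi with hpdef
  have hpos : ∀ᵐ t ∂halfLine, 0 < t := ae_restrict_mem measurableSet_Ioi
  have hpt : ∀ᵐ t ∂halfLine, (∫⁻ s, ENNReal.ofReal (t + s)⁻¹ * F s ∂halfLine) ^ (2 : ℝ)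
      ≤ p * ENNReal.ofReal (√t)⁻¹ *
        ∫⁻ s, ENNReal.ofReal (t + s)⁻¹ * (ENNReal.ofReal (√s) * F s ^ (2 : ℝ)) ∂halfLine := by
    filter_upwards [hpos] with t ht
    have hcs := ENNReal.lintegral_mul_le_Lp_mul_Lq halfLine Real.HolderConjugate.two_two
      (f := fun s => ENNReal.ofReal (√((t + s)⁻¹ * (√s)⁻¹)))
      (g := fun s => ENNReal.ofReal (√((t + s)⁻¹ * √s)) * F s)
      (by fun_prop) (by fun_prop)
    have e0 : ∫⁻ s, ENNReal.ofReal (t + s)⁻¹ * F s ∂halfLine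
        = ∫⁻ s, ((fun s => ENNReal.ofReal (√((t + s)⁻¹ * (√s)⁻¹))) *
          (fun s => ENNReal.ofReal (√((t + s)⁻¹ * √s)) * F s)) s ∂halfLine := by
      apply lintegral_congr_ae
      filter_upwards [hpos] with s hs
      simp only [Pi.mul_apply]
      rw [← mul_assoc, ← ENNReal.ofReal_mul (Real.sqrt_nonneg _), ← Real.sqrt_mul (by positivity)]
      have h3 := Real.sqrt_pos.2 hs
      have : (t + s)⁻¹ * (√s)⁻¹ * ((t + s)⁻¹ * √s) = (t + s)⁻¹ ^ 2 := by
        field_simp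
      rw [this, Real.sqrt_sq (by positivity)]
    have e1 : ∫⁻ s, ENNReal.ofReal (√((t + s)⁻¹ * (√s)⁻¹)) ^ (2 : ℝ) ∂halfLine
        = p * ENNReal.ofReal (√t)⁻¹ := by
      rw [hpdef, ← lintegral_schur_weight ht]
      apply lintegral_congr_ae
      filter_upwards [hpos] with s hs
      rw [ofReal_sq_rpow_half _ (by positivity)]
    have e2 : ∫⁻ s, (ENNReal.ofReal (√((t + s)⁻¹ * √s)) * F s) ^ (2 : ℝ) ∂halfLine
        = ∫⁻ s, ENNReal.ofReal (t + s)⁻¹ * (ENNReal.ofReal (√s) * F s ^ (2 : ℝ)) ∂halfLine := by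
      apply lintegral_congr_ae
      filter_upwards [hpos] with s hs
      rw [ENNReal.mul_rpow_of_nonneg _ _ (by norm_num), ofReal_sq_rpow_half _ (by positivity),
        ENNReal.ofReal_mul (by positivity), mul_assoc]
    rw [e1, e2, ← e0] at hcs
    calc _ ≤ _ := ENNReal.rpow_le_rpow hcs (by norm_num)
      _ = _ := by
        rw [ENNReal.mul_rpow_of_nonneg _ _ (by norm_num), ← ENNReal.rpow_mul, ← ENNReal.rpow_mul]
        norm_num
  calc _ ≤ _ := lintegral_mono_ae hpt
    _ = ∫⁻ t, ∫⁻ s, p * ENNReal.ofReal (√t)⁻¹ *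
        (ENNReal.ofReal (t + s)⁻¹ * (ENNReal.ofReal (√s) * F s ^ (2 : ℝ))) ∂halfLine
          ∂halfLine := by
        congr 1; ext t
        rw [lintegral_const_mul' _ _ (by simp [hpdef, ENNReal.mul_eq_top])]
    _ = ∫⁻ s, ∫⁻ t, p * ENNReal.ofReal (√t)⁻¹ *
        (ENNReal.ofReal (t + s)⁻¹ * (ENNReal.ofReal (√s) * F s ^ (2 : ℝ))) ∂halfLine
          ∂halfLine := by
        apply lintegral_lintegral_swap
        have : AEMeasurable (fun z : ℝ × ℝ => F z.2) (halfLine.prod halfLine) :=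
          hF.comp_snd
        simp only [Function.uncurry_def]
        fun_prop
    _ = ∫⁻ s, p ^ 2 * F s ^ (2 : ℝ) ∂halfLine := by
        apply lintegral_congr_ae
        filter_upwards [hpos] with s hs
        have e3 : ∫⁻ t, p * ENNReal.ofReal (√t)⁻¹ *
            (ENNReal.ofReal (t + s)⁻¹ * (ENNReal.ofReal (√s) * F s ^ (2 : ℝ))) ∂halfLine
            = ∫⁻ t, ENNReal.ofReal ((s + t)⁻¹ * (√t)⁻¹) *
              (p * (ENNReal.ofReal (√s) * F s ^ (2 : ℝ))) ∂halfLine := by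
          apply lintegral_congr_ae
          filter_upwards [hpos] with t ht
          rw [ENNReal.ofReal_mul (by positivity), add_comm s t]
          ring
        rw [e3, lintegral_mul_const _ (by fun_prop), lintegral_schur_weight hs]
        have h3 := Real.sqrt_pos.2 hs
        have : ENNReal.ofReal (√s)⁻¹ * ENNReal.ofReal (√s) = 1 := by
          rw [← ENNReal.ofReal_mul (by positivity), inv_mul_cancel₀ h3.ne', ENNReal.ofReal_one]
        calc _ = p ^ 2 * F s ^ (2 : ℝ) * (ENNReal.ofReal (√s)⁻¹ * ENNReal.ofReal (√s)) := by
              simp only [← hpdef]; ring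
          _ = _ := by rw [this, mul_one]
    _ = _ := by rw [lintegral_const_mul' _ _ (by simp [hpdef])]

/-- The function `t ↦ ∫₀^∞ (t + s)⁻¹ f(s) ds`. -/
def carlemanFun (f : ℝ → ℂ) (t : ℝ) : ℂ :=
  ∫ s in Ioi (0 : ℝ), ((t + s)⁻¹ : ℝ) * f s

theorem lintegral_enorm_sq (f : L2) :
    ∫⁻ s, ‖f s‖ₑ ^ (2 : ℝ) ∂halfLine = ‖f‖ₑ ^ (2 : ℝ) := by
  rw [Lp.enorm_def, eLpNorm_eq_lintegral_rpow_enorm_toReal (by norm_num) (by norm_num),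
    ← ENNReal.rpow_mul]
  norm_num

theorem enorm_carlemanFun_le (f : L2) (t : ℝ) (ht : 0 < t) :
    ‖carlemanFun f t‖ₑ ≤ ∫⁻ s, ENNReal.ofReal (t + s)⁻¹ * ‖f s‖ₑ ∂halfLine := by
  refine (enorm_integral_le_lintegral_enorm _).trans (le_of_eq ?_)
  apply lintegral_congr_ae
  filter_upwards [ae_restrict_mem measurableSet_Ioi] with s hs
  have : 0 < s := hs
  rw [enorm_mul, ← ofReal_norm, Complex.norm_real, Real.norm_of_nonneg (by positivity)]

theorem eLpNorm_carlemanFun_le (f : L2) :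
    eLpNorm (carlemanFun f) 2 halfLine ≤ ENNReal.ofReal Real.pi * ‖f‖ₑ := by
  rw [eLpNorm_eq_lintegral_rpow_enorm_toReal (by norm_num) (by norm_num)]
  have h1 : ∫⁻ t, ‖carlemanFun f t‖ₑ ^ (2 : ℝ) ∂halfLine
      ≤ (ENNReal.ofReal Real.pi * ‖f‖ₑ) ^ (2 : ℝ) := by
    calc _ ≤ ∫⁻ t, (∫⁻ s, ENNReal.ofReal (t + s)⁻¹ * ‖f s‖ₑ ∂halfLine) ^ (2 : ℝ) ∂halfLine := by
          apply lintegral_mono_ae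
          filter_upwards [ae_restrict_mem measurableSet_Ioi] with t ht
          exact ENNReal.rpow_le_rpow (enorm_carlemanFun_le f t ht) (by norm_num)
      _ ≤ _ := lintegral_carleman_sq_le _ (Lp.aestronglyMeasurable f).enorm
      _ = _ := by
          rw [lintegral_enorm_sq, ENNReal.mul_rpow_of_nonneg _ _ (by norm_num),
            ENNReal.rpow_two (ENNReal.ofReal Real.pi)]
  calc _ ≤ ((ENNReal.ofReal Real.pi * ‖f‖ₑ) ^ (2 : ℝ)) ^ (1 / (2 : ℝ)) := by
        simpa using ENNReal.rpow_le_rpow h1 (z := 1 / 2) (by norm_num)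
    _ = _ := by rw [← ENNReal.rpow_mul]; norm_num

theorem aestronglyMeasurable_carlemanFun (f : L2) :
    AEStronglyMeasurable (carlemanFun f) halfLine := by
  apply AEStronglyMeasurable.integral_prod_right' (f := fun z : ℝ × ℝ =>
    (((z.1 + z.2)⁻¹ : ℝ) : ℂ) * f z.2)
  have h : AEStronglyMeasurable (fun z : ℝ × ℝ => f z.2) (halfLine.prod halfLine) :=
    (Lp.aestronglyMeasurable f).comp_snd
  refine AEStronglyMeasurable.mul ?_ h
  apply Measurable.aestronglyMeasurable
  fun_prop

theorem memLp_carlemanFun (f : L2) : MemLp (carlemanFun f) 2 halfLine :=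
  ⟨aestronglyMeasurable_carlemanFun f,
    (eLpNorm_carlemanFun_le f).trans_lt (ENNReal.mul_lt_top ENNReal.ofReal_lt_top enorm_lt_top)⟩

theorem integrable_carleman (f : L2) :
    ∀ᵐ t ∂halfLine, Integrable (fun s => (((t + s)⁻¹ : ℝ) : ℂ) * f s) halfLine := by
  have h := lintegral_carleman_sq_le _ (Lp.aestronglyMeasurable f).enorm
  rw [lintegral_enorm_sq] at h
  have hm : AEMeasurable (fun t => (∫⁻ s, ENNReal.ofReal (t + s)⁻¹ * ‖f s‖ₑ ∂halfLine) ^ (2 : ℝ))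
      halfLine := by
    have h2 : AEMeasurable (fun z : ℝ × ℝ => ‖f z.2‖ₑ) (halfLine.prod halfLine) :=
      (Lp.aestronglyMeasurable f).enorm.comp_snd
    have h3 : AEMeasurable (fun z : ℝ × ℝ => ENNReal.ofReal (z.1 + z.2)⁻¹ * ‖f z.2‖ₑ)
      (halfLine.prod halfLine) := by fun_prop
    exact h3.lintegral_prod_right'.pow_const _
  have h4 := ae_lt_top' hm (h.trans_lt (ENNReal.mul_lt_top (by simp)
    (by simp))).ne
  filter_upwards [h4, ae_restrict_mem measurableSet_Ioi] with t ht htpos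
  refine ⟨?_, ?_⟩
  · refine AEStronglyMeasurable.mul ?_ (Lp.aestronglyMeasurable f)
    apply Measurable.aestronglyMeasurable
    fun_prop
  · rw [hasFiniteIntegral_iff_enorm]
    have h5 : ∫⁻ s, ENNReal.ofReal (t + s)⁻¹ * ‖f s‖ₑ ∂halfLine < ⊤ := by
      by_contra hc
      rw [not_lt_top_iff] at hc
      rw [hc] at ht
      simp at ht
    refine lt_of_le_of_lt (le_of_eq ?_) h5
    apply lintegral_congr_ae
    filter_upwards [ae_restrict_mem measurableSet_Ioi] with s hs
    have h6 : 0 < s := hs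
    have h7 : 0 < t := htpos
    rw [enorm_mul, ← ofReal_norm, Complex.norm_real, Real.norm_of_nonneg (by positivity)]

/-- The Carleman operator `(C f)(t) = ∫₀^∞ (t + s)⁻¹ f(s) ds` on `L²(ℝ₊)`. -/
def carleman : L2 →L[ℂ] L2 :=
  LinearMap.mkContinuous
    { toFun := fun f => (memLp_carlemanFun f).toLp (carlemanFun f)
      map_add' := by
        intro f g
        rw [← MemLp.toLp_add, MemLp.toLp_eq_toLp_iff]
        filter_upwards [integrable_carleman f, integrable_carleman g] with t hf hg
        simp only [carlemanFun, Pi.add_apply]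
        rw [← integral_add hf hg]
        apply integral_congr_ae
        filter_upwards [Lp.coeFn_add f g] with s hs
        rw [hs, Pi.add_apply, mul_add]
      map_smul' := by
        intro c f
        rw [RingHom.id_apply, ← MemLp.toLp_const_smul, MemLp.toLp_eq_toLp_iff]
        filter_upwards with t
        simp only [carlemanFun, Pi.smul_apply]
        rw [← integral_smul]
        apply integral_congr_ae
        filter_upwards [Lp.coeFn_smul c f] with s hs
        rw [hs, Pi.smul_apply, smul_eq_mul, smul_eq_mul]
        ring }
    Real.pi (by
      intro f
      simp only [LinearMap.coe_mk, AddHom.coe_mk, Lp.norm_toLp]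
      refine ENNReal.toReal_le_of_le_ofReal (by positivity) ?_
      refine (eLpNorm_carlemanFun_le f).trans (le_of_eq ?_)
      rw [ENNReal.ofReal_mul Real.pi_pos.le, ofReal_norm])

theorem carleman_apply (f : L2) : carleman f =ᵐ[halfLine] carlemanFun f :=
  (memLp_carlemanFun f).coeFn_toLp

/-- The weight `⟨ln t⟩ = (1 + |ln t|²)^{1/2}`; the operator `Q` is multiplication by it. -/
def logWeight (t : ℝ) : ℝ := √(1 + Real.log t ^ 2)

theorem logWeight_pos (t : ℝ) : 0 < logWeight t := Real.sqrt_pos.2 (by positivity)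

/-- `K` is the bounded extension of `Q^α V Q^α`: for every `f` in the domain of `Q^α`, with
`g = Q^α f`, the function `V g` is in the domain of `Q^α` and `Q^α V g = K f`. -/
def IsWeightedExtension (α : ℝ) (V K : L2 →L[ℂ] L2) : Prop :=
  ∀ f g : L2, (g =ᵐ[halfLine] fun t => ((logWeight t ^ α : ℝ) : ℂ) * f t) →
    (K f =ᵐ[halfLine] fun t => ((logWeight t ^ α : ℝ) : ℂ) * V g t)

theorem memLp_weightedPsi (α : ℝ) (hα : 1 / 2 < α) :
    MemLp (fun t : ℝ => ((logWeight t ^ (-α) * t ^ (-(1 / 2 : ℝ)) : ℝ) : ℂ)) 2 halfLine := by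
  have hm : Measurable (fun t : ℝ => ((logWeight t ^ (-α) * t ^ (-(1 / 2 : ℝ)) : ℝ) : ℂ)) := by
    unfold logWeight
    fun_prop
  rw [memLp_two_iff_integrable_sq_norm hm.aestronglyMeasurable]
  have h1 := (integrable_rpow_neg_one_add_norm_sq (μ := (volume : Measure ℝ)) (E := ℝ)
    (r := 2 * α) (by simp; linarith)).integrableOn (s := univ)
  have hrange : Real.exp '' univ = Ioi (0 : ℝ) := by rw [image_univ, Real.range_exp]
  have h2 := integrableOn_image_iff_integrableOn_abs_deriv_smul (s := univ) MeasurableSet.univ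
    (f := Real.exp) (f' := Real.exp) (fun x _ => (Real.hasDerivAt_exp x).hasDerivWithinAt)
    Real.exp_injective.injOn
    (fun t : ℝ => ‖((logWeight t ^ (-α) * t ^ (-(1 / 2 : ℝ)) : ℝ) : ℂ)‖ ^ 2)
  rw [hrange] at h2
  refine h2.2 (h1.congr_fun ?_ MeasurableSet.univ)
  intro x _
  have hx : 0 < 1 + x ^ 2 := by positivity
  simp only [Complex.norm_real, Real.norm_eq_abs, sq_abs, smul_eq_mul, logWeight, Real.log_exp,
    abs_of_pos (Real.exp_pos x), mul_pow]
  rw [Real.sqrt_eq_rpow, ← Real.rpow_mul hx.le, ← Real.rpow_natCast (_ ^ _),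
    ← Real.rpow_mul hx.le, ← Real.exp_mul, ← Real.exp_nat_mul, mul_left_comm, ← Real.exp_add]
  have e : x + ((2 : ℕ) : ℝ) * (x * -(1 / 2)) = 0 := by push_cast; ring
  rw [e, Real.exp_zero, mul_one]
  congr 1
  push_cast
  ring

/-- The function `Q^{-α} ψ₀` with `ψ₀(t) = t^{-1/2}`, an element of `L²(ℝ₊)` for `α > 1/2`. -/
def weightedPsi (α : ℝ) (hα : 1 / 2 < α) : L2 := (memLp_weightedPsi α hα).toLp _

/-- The quadratic form `(V ψ₀, ψ₀)`, `ψ₀(t) = t^{-1/2}`. Since `ψ₀` is not in `L²(ℝ₊)`, it is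
understood as `(K Q^{-α} ψ₀, Q^{-α} ψ₀)`, where `K` is the bounded extension of `Q^α V Q^α`. -/
def psiForm (α : ℝ) (hα : 1 / 2 < α) (K : L2 →L[ℂ] L2) : ℂ :=
  ⟪weightedPsi α hα, K (weightedPsi α hα)⟫_ℂ

section HilbertSchmidt

variable {E : Type*} [NormedAddCommGroup E] [InnerProductSpace ℂ E]

theorem tsum_enorm_inner_sq {ι : Type*} (b : HilbertBasis ι ℂ E) (x : E) :
    ∑' i, ‖⟪b i, x⟫_ℂ‖ₑ ^ 2 = ‖x‖ₑ ^ 2 := by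
  have h := b.hasSum_inner_mul_inner x x
  have h1 : HasSum (fun i => ‖⟪b i, x⟫_ℂ‖ ^ 2) (‖x‖ ^ 2) := by
    have h2 := Complex.hasSum_re h
    convert h2 using 1
    · ext i
      rw [← inner_conj_symm x (b i), Complex.conj_mul']
      norm_cast
    · rw [inner_self_eq_norm_sq_to_K]
      norm_cast
  have h3 := ENNReal.ofReal_tsum_of_nonneg (fun i => by positivity) h1.summable
  rw [h1.tsum_eq] at h3
  simp only [ENNReal.ofReal_pow (norm_nonneg _), ofReal_norm] at h3
  exact h3.symm

variable [CompleteSpace E]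

/-- The square `∑ᵢ ‖T eᵢ‖²` of the Hilbert-Schmidt norm, for an orthonormal basis `(eᵢ)`; the value
does not depend on the basis, see `hsNormSq_eq_tsum`. -/
def hsNormSq (T : E →L[ℂ] E) : ℝ≥0∞ :=
  ∑' i, ‖T ((exists_hilbertBasis ℂ E).choose_spec.choose i)‖ₑ ^ 2

theorem tsum_enorm_sq_adjoint {ι κ : Type*} (b : HilbertBasis ι ℂ E) (c : HilbertBasis κ ℂ E)
    (T : E →L[ℂ] E) :
    ∑' i, ‖T (b i)‖ₑ ^ 2 = ∑' j, ‖ContinuousLinearMap.adjoint T (c j)‖ₑ ^ 2 := by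
  simp only [← tsum_enorm_inner_sq c (T _), ← tsum_enorm_inner_sq b (ContinuousLinearMap.adjoint T _)]
  rw [ENNReal.tsum_comm]
  congr 1; ext j; congr 1; ext i
  rw [ContinuousLinearMap.adjoint_inner_right, ← inner_conj_symm, RCLike.enorm_conj]

theorem hsNormSq_eq_tsum {ι : Type*} (b : HilbertBasis ι ℂ E) (T : E →L[ℂ] E) :
    hsNormSq T = ∑' i, ‖T (b i)‖ₑ ^ 2 := by
  rw [hsNormSq, tsum_enorm_sq_adjoint _ b, ← tsum_enorm_sq_adjoint b b]

/-- `T` belongs to the Hilbert-Schmidt class. -/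
def IsHilbertSchmidt (T : E →L[ℂ] E) : Prop := hsNormSq T < ⊤

/-- The Hilbert-Schmidt norm `‖T‖₂`. -/
def hsNorm (T : E →L[ℂ] E) : ℝ := √(hsNormSq T).toReal

/-- The total number, with multiplicities, of the real eigenvalues of `T` strictly larger than
`c`. -/
def eigenvalueCountAbove (T : E →L[ℂ] E) (c : ℝ) : ℝ≥0∞ :=
  ∑' μ : Ioi c, ((Cardinal.toENat (Module.rank ℂ
    (Module.End.eigenspace (T : E →ₗ[ℂ] E) ((μ : ℝ) : ℂ))) : ℕ∞) : ℝ≥0∞)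

end HilbertSchmidt

/-- The function `σ₁(u) = (1 + u²) / (1 - u²) · ln u`; its value at the single point `u = 1`
is irrelevant. -/
def sigmaOne (u : ℝ) : ℝ := (1 + u ^ 2) / (1 - u ^ 2) * Real.log u

/-- The integrand `⟨ln t⟩^{-2α} (t s)⁻¹ σ₁(t/s)² ⟨ln s⟩^{-2α}`, `z = (t, s)`. -/
def gammaIntegrand (α : ℝ) (z : ℝ × ℝ) : ℝ :=
  logWeight z.1 ^ (-(2 * α)) * (z.1 * z.2)⁻¹ * sigmaOne (z.1 / z.2) ^ 2 *
    logWeight z.2 ^ (-(2 * α))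

/-- The constant `γ_α ≥ 0` with `γ_α² = π⁻⁴ ∫₀^∞ ∫₀^∞ ⟨ln t⟩^{-2α} (ts)⁻¹ σ₁(t/s)² ⟨ln s⟩^{-2α}`. -/
def gammaConst (α : ℝ) : ℝ :=
  √((Real.pi ^ 4)⁻¹ * ∫ z, gammaIntegrand α z ∂(halfLine.prod halfLine))

/-- `V` is the integral operator with the square-integrable kernel `v(t, s)`. -/
def IsIntegralOperator (v : ℝ → ℝ → ℂ) (V : L2 →L[ℂ] L2) : Prop :=
  MemLp (Function.uncurry v) 2 (halfLine.prod halfLine) ∧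
    ∀ f : L2, V f =ᵐ[halfLine] fun t => ∫ s in Ioi (0 : ℝ), v t s * f s

/-- `V` is a (Hilbert-Schmidt) Hankel operator: its kernel is of the form `v(t + s)`. -/
def IsHankel (V : L2 →L[ℂ] L2) : Prop :=
  ∃ v : ℝ → ℂ, AEStronglyMeasurable v halfLine ∧ IsIntegralOperator (fun t s => v (t + s)) V

end

end CarlemanPerturbation

namespace CarlemanPerturbation

open MeasureTheory Set Filter Topology
open scoped ENNReal InnerProductSpace

noncomputable section

/-! ### Two Fourier integrals for hyperbolic functions -/

/-! The unitary map F ↦ e^{s/2} F(e^s) turns `carleman` into convolution with 1/(2 cosh(s/2)), and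
the Fourier transform turns this into multiplication by π/cosh(2π²w) (`inner_carleman_eq`). Hence π
− C has the symbol `gapSymbol`, which is positive except for a double zero at w = 0. Its reciprocal
is π⁻¹ + π⁻³ρ(w), where ρ is `resolventDensity` and behaves like w⁻² near 0 (`gapSymbol_inv`).

The singularity of ρ is harmless on functions γ with ∫ γ = 0. Since ∫ (1 − cos 2πwz) ρ(w) dw = z
coth z − 1, the form ∫ ρ |γ̂|² equals minus the double integral of (a − b) coth(a − b) against conj
γ(a) γ(b) (`mulCoth_form_eq`). In the variable t the kernel −z coth z is σ₁(t/s). After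
multiplication by the weights, which need α > 3/2 to beat its linear growth, it is square integrable
with norm γ_α/π.

The bound on N is a variational form of the Birman–Schwinger principle. Let F be the span of
finitely many orthonormal eigenvectors above π. One linear condition on F makes Q^α V f orthogonal
to Q^{-α}ψ₀; this costs the summand 1. On the remaining subspace choose fᵢ with V^{1/2}fᵢ
orthonormal. Cauchy–Schwarz with respect to π − C and its inverse (`norm_inner_weightOp_sq_le`),
together with (Hfᵢ, fᵢ) > π‖fᵢ‖², gives 1 ≤ aᵢ + rᵢ. Here aᵢ = π⁻¹‖V fᵢ‖², and rᵢ is the form of the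
singular part of the inverse. The ℓ² norms of (aᵢ) and (rᵢ) are at most ‖V‖₂/π and γ_α‖Q^αVQ^α‖/π
(`card_le_of_orthonormal`), so squaring and summing finishes the count.

For existence, the Gaussians t^{-1/2} exp(−πb ln² t) approximate ψ₀, and their π − C form is O(√b)
(`gap_trial_le`). If the form of V on them stays above a positive constant, the form of H exceeds π
somewhere. As ‖C‖ ≤ π and V is compact, the supremum of the form of H on the unit sphere is then an
eigenvalue (`exists_hasEigenvalue_of_lt_inner`). Conditions (a) and (b) make the forms of V converge
to a nonzero limit. Under (c) positivity forces v ≥ 0, so these forms increase as b decreases. -/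

theorem sigmoid_cpow_mul_cpow (ξ y : ℝ) :
    ((Real.sigmoid y : ℝ) : ℂ) ^ ((1 / 2 : ℂ) + ξ * Complex.I) *
      ((1 - Real.sigmoid y : ℝ) : ℂ) ^ ((1 / 2 : ℂ) - ξ * Complex.I)
      = Complex.exp (ξ * y * Complex.I) * (((2 * Real.cosh (y / 2))⁻¹ : ℝ) : ℂ) := by
  set p := Real.sigmoid (-y) with hp
  have hp0 : 0 < p := Real.sigmoid_pos _
  have h1 : 1 - Real.sigmoid y = p := (Real.sigmoid_neg y).symm
  have h2 : Real.sigmoid y = Real.exp (y + Real.log p) := by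
    rw [Real.exp_add, Real.exp_log hp0, hp, ← Real.sigmoid_mul_rexp_neg, mul_comm, mul_assoc,
      ← Real.exp_add]
    simp
  have h3 : p = Real.exp (Real.log p) := (Real.exp_log hp0).symm
  have h4 : (2 * Real.cosh (y / 2))⁻¹ = Real.exp (y / 2 + Real.log p) := by
    rw [Real.exp_add, Real.exp_log hp0, hp, Real.sigmoid_def, Real.cosh_eq, neg_neg]
    have e : Real.exp y = Real.exp (y / 2) * Real.exp (y / 2) := by
      rw [← Real.exp_add]; ring_nf
    rw [e, Real.exp_neg]
    have := Real.exp_pos (y / 2)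
    field_simp
    ring
  rw [h1, h2, h4]
  nth_rewrite 2 [h3]
  generalize Real.log p = l
  rw [Complex.cpow_def_of_ne_zero (by exact_mod_cast (Real.exp_pos _).ne'),
    Complex.cpow_def_of_ne_zero (by exact_mod_cast (Real.exp_pos _).ne'),
    ← Complex.ofReal_log (Real.exp_pos _).le, ← Complex.ofReal_log (Real.exp_pos _).le,
    Real.log_exp, Real.log_exp, Complex.ofReal_exp, ← Complex.exp_add, ← Complex.exp_add]
  congr 1
  push_cast
  ring

/-- With t = sigmoid y one has dt = t(1 − t) dy, so the integral is the Beta integral B(u, 1 − u) at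
u = 1/2 + iξ. The reflection formula evaluates it as π / sin(πu). -/
theorem integral_exp_mul_inv_cosh (ξ : ℝ) :
    ∫ y : ℝ, Complex.exp (ξ * y * Complex.I) * (((2 * Real.cosh (y / 2))⁻¹ : ℝ) : ℂ)
      = ((Real.pi / Real.cosh (Real.pi * ξ) : ℝ) : ℂ) := by
  set u : ℂ := (1 / 2 : ℂ) + ξ * Complex.I with hu
  set v : ℂ := (1 / 2 : ℂ) - ξ * Complex.I with hv
  have huv : u + v = 1 := by rw [hu, hv]; ring
  have hur : 0 < u.re := by simp [hu]
  have hvr : 0 < v.re := by simp [hv]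
  have hG := Complex.Gamma_mul_Gamma_eq_betaIntegral hur hvr
  have hv' : v = 1 - u := by rw [← huv]; ring
  rw [huv, Complex.Gamma_one, one_mul, hv', Complex.Gamma_mul_Gamma_one_sub, ← hv'] at hG
  have hs : Complex.sin (Real.pi * u) = Complex.cosh (Real.pi * ξ) := by
    rw [hu, mul_add, Complex.sin_add, ← mul_assoc, Complex.sin_mul_I, Complex.cos_mul_I]
    have e : (Real.pi : ℂ) * (1 / 2) = Real.pi / 2 := by ring
    rw [e, Complex.sin_pi_div_two, Complex.cos_pi_div_two]
    ring
  rw [hs] at hG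
  have hrange : Real.sigmoid '' univ = Ioo 0 1 := by rw [image_univ, Real.range_sigmoid]
  have hcv := integral_image_eq_integral_abs_deriv_smul (s := univ) MeasurableSet.univ
    (f := Real.sigmoid) (fun x _ => (Real.hasDerivAt_sigmoid x).hasDerivWithinAt)
    Real.sigmoid_injective.injOn
    (fun t : ℝ => (t : ℂ) ^ (u - 1) * (1 - (t : ℂ)) ^ (v - 1))
  rw [hrange, ← integral_Ioc_eq_integral_Ioo,
    ← intervalIntegral.integral_of_le zero_le_one, Measure.restrict_univ] at hcv
  have h5 : ∫ y : ℝ, Complex.exp (ξ * y * Complex.I) * (((2 * Real.cosh (y / 2))⁻¹ : ℝ) : ℂ)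
      = Complex.betaIntegral u v := by
    rw [Complex.betaIntegral, hcv]
    congr 1
    ext y
    rw [← sigmoid_cpow_mul_cpow, ← hu, ← hv]
    have a := Real.sigmoid_pos y
    have b : 0 < 1 - Real.sigmoid y := by linarith [Real.sigmoid_lt_one y]
    have a' : ((Real.sigmoid y : ℝ) : ℂ) ≠ 0 := by exact_mod_cast a.ne'
    have b' : 1 - ((Real.sigmoid y : ℝ) : ℂ) ≠ 0 := by exact_mod_cast b.ne'
    rw [abs_of_pos (mul_pos a b), Complex.cpow_sub _ _ a', Complex.cpow_sub _ _ b',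
      Complex.cpow_one, Complex.cpow_one, Complex.real_smul]
    push_cast
    field_simp
  rw [h5, ← hG]
  push_cast
  rfl

theorem integrable_inv_cosh_half :
    Integrable (fun y : ℝ => (2 * Real.cosh (y / 2))⁻¹) := by
  have h : Integrable (fun y : ℝ => Complex.exp ((0 : ℝ) * y * Complex.I) *
      (((2 * Real.cosh (y / 2))⁻¹ : ℝ) : ℂ)) := by
    -- The value at ξ = 0 is π, whereas a non-integrable function has Bochner integral 0.
    apply Integrable.of_integral_ne_zero
    rw [integral_exp_mul_inv_cosh]
    simp
  simp only [Complex.ofReal_zero, zero_mul, Complex.exp_zero, one_mul] at h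
  exact h.re

/-- The symbol of the Carleman operator, in the frequency normalization of Mathlib. -/
def carlemanSymbol (w : ℝ) : ℝ := Real.pi / Real.cosh (2 * Real.pi ^ 2 * w)

theorem carlemanSymbol_eq (w : ℝ) :
    carlemanSymbol w = 2 * Real.pi * (2 * Real.cosh ((4 * Real.pi ^ 2 * w) / 2))⁻¹ := by
  have : (4 * Real.pi ^ 2 * w) / 2 = 2 * Real.pi ^ 2 * w := by ring
  rw [carlemanSymbol, this]
  have := Real.cosh_pos (2 * Real.pi ^ 2 * w)
  field_simp

theorem integrable_carlemanSymbol : Integrable carlemanSymbol := by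
  have h := (integrable_inv_cosh_half.comp_mul_left' (R := 4 * Real.pi ^ 2)
    (by positivity)).const_mul (2 * Real.pi)
  exact h.congr (Eventually.of_forall fun w => (carlemanSymbol_eq w).symm)

/-- 1/cosh is its own Fourier transform up to scaling, so the substitution y = 4π²w recovers the
convolution kernel from the symbol without Fourier inversion. -/
theorem integral_exp_mul_carlemanSymbol (x : ℝ) :
    ∫ w : ℝ, Complex.exp ((2 * Real.pi * w * x : ℝ) * Complex.I) * (carlemanSymbol w : ℂ)
      = (((2 * Real.cosh (x / 2))⁻¹ : ℝ) : ℂ) := by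
  have h := Measure.integral_comp_mul_left (fun y : ℝ =>
    Complex.exp ((x / (2 * Real.pi) : ℝ) * y * Complex.I) *
      (((2 * Real.cosh (y / 2))⁻¹ : ℝ) : ℂ)) (4 * Real.pi ^ 2)
  rw [integral_exp_mul_inv_cosh] at h
  have e : ∀ w : ℝ, Complex.exp ((2 * Real.pi * w * x : ℝ) * Complex.I) * (carlemanSymbol w : ℂ)
      = ((2 * Real.pi : ℝ) : ℂ) * (Complex.exp ((x / (2 * Real.pi) : ℝ) *
        ((4 * Real.pi ^ 2 * w : ℝ) : ℂ) * Complex.I) *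
      (((2 * Real.cosh ((4 * Real.pi ^ 2 * w) / 2))⁻¹ : ℝ) : ℂ)) := by
    intro w
    rw [carlemanSymbol_eq, ← Complex.ofReal_mul (x / (2 * Real.pi))]
    have : x / (2 * Real.pi) * (4 * Real.pi ^ 2 * w) = 2 * Real.pi * w * x := by
      have := Real.pi_pos
      field_simp
      ring
    rw [this]
    push_cast
    ring
  simp_rw [e]
  rw [integral_const_mul, h, abs_of_pos (by positivity), Complex.real_smul, ← Complex.ofReal_mul,
    ← Complex.ofReal_mul]
  congr 1
  have h1 := Real.pi_pos
  have h2 : Real.pi * (x / (2 * Real.pi)) = x / 2 := by field_simp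
  rw [h2]
  have := Real.cosh_pos (x / 2)
  field_simp
  ring

/-! ### Partial fractions of z coth z and the density of the inverse symbol -/

/-- The Mittag-Leffler expansion of the cotangent at the imaginary point iz/π. -/
theorem hasSum_mul_coth {z : ℝ} (hz : z ≠ 0) :
    HasSum (fun n : ℕ => 2 * z ^ 2 / (z ^ 2 + Real.pi ^ 2 * (n + 1) ^ 2))
      (z * Real.cosh z / Real.sinh z - 1) := by
  have hpi : (Real.pi : ℂ) ≠ 0 := by exact_mod_cast Real.pi_pos.ne'
  have hzc : (z : ℂ) ≠ 0 := by exact_mod_cast hz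
  set x : ℂ := z * Complex.I / Real.pi with hx
  have hxm : x ∈ Complex.integerComplement := by
    rw [Complex.mem_integerComplement_iff]
    rintro ⟨n, hn⟩
    have := congrArg Complex.im hn
    rw [hx, Complex.div_ofReal_im] at this
    simp at this
    rcases div_eq_zero_iff.1 this.symm with h | h
    · exact hz h
    · exact Real.pi_pos.ne' h
  have h1 := (summable_cotTerm hxm).hasSum
  have h2 := cot_series_rep' hxm
  simp only [cotTerm_identity hxm] at h1
  have h2' : ∑' n : ℕ, 2 * x * (1 / ((x + (n + 1)) * (x - (n + 1)))) =
      Real.pi * Complex.cot (Real.pi * x) - 1 / x := by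
    rw [h2]
    refine tsum_congr fun n => ?_
    rw [← cotTerm_identity hxm, cotTerm]
  rw [h2'] at h1
  have h3 := h1.mul_left x
  have hpx : Real.pi * x = z * Complex.I := by rw [hx]; field_simp
  have hx0 : x ≠ 0 := by
    rw [hx]; simp [hz, Real.pi_pos.ne']
  rw [← Complex.hasSum_ofReal]
  convert! h3 using 1
  · ext n
    have hsq : (x + (n + 1)) * (x - (n + 1)) = -((z ^ 2 + Real.pi ^ 2 * (n + 1) ^ 2) / Real.pi ^ 2)
        := by
      rw [hx]
      field_simp
      ring_nf
      rw [Complex.I_sq]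
      ring
    have hp : ((z : ℂ) ^ 2 + (Real.pi : ℂ) ^ 2 * (n + 1) ^ 2) ≠ 0 := by
      have : 0 < z ^ 2 + Real.pi ^ 2 * ((n : ℝ) + 1) ^ 2 := by positivity
      exact_mod_cast this.ne'
    rw [hsq]
    push_cast
    have hxx : x * x = - (z ^ 2 / Real.pi ^ 2) := by
      rw [hx]; field_simp; rw [Complex.I_sq]
    rw [← mul_assoc, mul_left_comm, hxx]
    field_simp
  · rw [Complex.cot_eq_cos_div_sin, hpx, Complex.cos_mul_I, Complex.sin_mul_I, mul_sub,
      mul_one_div_cancel hx0]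
    have hs : Complex.sinh z ≠ 0 := by
      rw [← Complex.ofReal_sinh]
      exact_mod_cast (Real.sinh_ne_zero.2 hz)
    push_cast
    congr 1
    have e : x * (Real.pi * (Complex.cosh z / (Complex.sinh z * Complex.I)))
      = (Real.pi * x) * (Complex.cosh z / (Complex.sinh z * Complex.I)) := by ring
    rw [e, hpx]
    field_simp

theorem lintegral_exp_mul_one_sub_cos {a : ℝ} (ha : 0 < a) (b : ℝ) :
    ∫⁻ w in Ioi (0 : ℝ), ENNReal.ofReal (Real.exp (-(a * w)) * (1 - Real.cos (b * w)))
      = ENNReal.ofReal (b ^ 2 / (a * (a ^ 2 + b ^ 2))) := by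
  set F : ℝ → ℝ := fun w => Real.exp (-(a * w)) *
    (-1 / a + (a * Real.cos (b * w) - b * Real.sin (b * w)) / (a ^ 2 + b ^ 2)) with hF
  have hab : a ^ 2 + b ^ 2 ≠ 0 := by positivity
  have hd : ∀ w ∈ Ioi (0 : ℝ), HasDerivAt F
      (Real.exp (-(a * w)) * (1 - Real.cos (b * w))) w := by
    intro w _
    have h1 : HasDerivAt (fun w => a * w) a w := by simpa using (hasDerivAt_id w).const_mul a
    have h2 : HasDerivAt (fun w => b * w) b w := by simpa using (hasDerivAt_id w).const_mul b
    refine (h1.neg.exp.mul (((h2.cos.const_mul a).sub (h2.sin.const_mul b)).div_const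
      (a ^ 2 + b ^ 2) |>.const_add (-1 / a))).congr_deriv ?_
    simp only [Pi.neg_apply, Pi.sub_apply]
    field_simp
    ring
  have hp : ∀ w ∈ Ioi (0 : ℝ), 0 ≤ Real.exp (-(a * w)) * (1 - Real.cos (b * w)) := fun w _ =>
    mul_nonneg (Real.exp_pos _).le (by linarith [Real.cos_le_one (b * w)])
  have hc : ContinuousWithinAt F (Ici 0) 0 := by
    apply Continuous.continuousWithinAt
    fun_prop
  have hl : Tendsto F atTop (𝓝 0) := by
    have h1 : Tendsto (fun w => Real.exp (-(a * w))) atTop (𝓝 0) :=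
      Real.tendsto_exp_neg_atTop_nhds_zero.comp (tendsto_id.const_mul_atTop ha)
    refine h1.zero_mul_isBoundedUnder_le ?_
    refine isBoundedUnder_of ⟨|(-1) / a| + (|a| + |b|) / |a ^ 2 + b ^ 2|, fun w => ?_⟩
    simp only [Function.comp_apply, Real.norm_eq_abs]
    refine (abs_add_le _ _).trans ?_
    rw [abs_div _ (a ^ 2 + b ^ 2)]
    gcongr
    refine (abs_sub _ _).trans ?_
    rw [abs_mul, abs_mul]
    gcongr
    · exact mul_le_of_le_one_right (abs_nonneg _) (Real.abs_cos_le_one _)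
    · exact mul_le_of_le_one_right (abs_nonneg _) (Real.abs_sin_le_one _)
  rw [← ofReal_integral_eq_lintegral_ofReal (integrableOn_Ioi_deriv_of_nonneg hc hd hp hl)
    (ae_restrict_of_forall_mem measurableSet_Ioi hp),
    integral_Ioi_of_hasDerivAt_of_nonneg hc hd hp hl]
  congr 1
  simp only [hF, mul_zero, neg_zero, Real.exp_zero, Real.cos_zero, Real.sin_zero]
  field_simp
  ring

/-- The singular part of the symbol of `(π - C)⁻¹`, up to a factor. -/
def resolventDensity (w : ℝ) : ℝ := (Real.pi ^ 2 / 2) / Real.sinh (Real.pi ^ 2 * w) ^ 2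

theorem resolventDensity_nonneg (w : ℝ) : 0 ≤ resolventDensity w := by
  unfold resolventDensity; positivity

theorem measurable_resolventDensity : Measurable resolventDensity := by
  unfold resolventDensity; fun_prop

theorem resolventDensity_neg (w : ℝ) : resolventDensity (-w) = resolventDensity w := by
  simp [resolventDensity]

/-- This is ∑ n rⁿ = r/(1 − r)² at r = e^{−2π²w}, reindexed from n = 1 because the term n = 0
vanishes. -/
theorem hasSum_resolventDensity {w : ℝ} (hw : 0 < w) :
    HasSum (fun n : ℕ => 2 * Real.pi ^ 2 * (n + 1) * Real.exp (-(2 * Real.pi ^ 2 * (n + 1) * w)))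
      (resolventDensity w) := by
  set r := Real.exp (-(2 * Real.pi ^ 2 * w)) with hr
  have hr1 : r < 1 := Real.exp_lt_one_iff.2 (by have := Real.pi_pos; simp; positivity)
  have hr0 : 0 < r := Real.exp_pos _
  have h := hasSum_coe_mul_geometric_of_norm_lt_one (r := r) (by rwa [Real.norm_of_nonneg hr0.le])
  rw [← hasSum_nat_add_iff' 1] at h
  have h2 := h.mul_left (2 * Real.pi ^ 2)
  convert! h2 using 1
  · ext n
    have : Real.exp (-(2 * Real.pi ^ 2 * (n + 1) * w)) = r ^ (n + 1) := by
      rw [hr, ← Real.exp_nat_mul]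
      congr 1
      push_cast
      ring
    rw [this]
    push_cast
    ring
  · rw [resolventDensity, Real.sinh_eq]
    set q := Real.exp (Real.pi ^ 2 * w) with hq
    have hq0 : 0 < q := Real.exp_pos _
    have e : r = q⁻¹ * q⁻¹ := by
      rw [hr, hq, ← Real.exp_neg, ← Real.exp_add]
      ring_nf
    have hq1 : 1 < q := by
      rw [hq]; exact Real.one_lt_exp_iff.2 (by have := Real.pi_pos; positivity)
    rw [e, Real.exp_neg, ← hq]
    have : q ^ 2 - 1 ≠ 0 := by nlinarith
    simp
    field_simp

/-- Tonelli applied to the exponential series: the term with rate 2π²(n + 1) contributes z²/(z² +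
π²(n + 1)²), and these are the partial fractions of (z coth z − 1)/2. The factor 1 − cos tames the
w⁻² singularity at 0. -/
theorem lintegral_resolventDensity_Ioi {z : ℝ} (hz : z ≠ 0) :
    ∫⁻ w in Ioi (0 : ℝ), ENNReal.ofReal ((1 - Real.cos (2 * Real.pi * w * z)) * resolventDensity w)
      = ENNReal.ofReal ((z * Real.cosh z / Real.sinh z - 1) / 2) := by
  have hpi := Real.pi_pos
  have h1 : ∫⁻ w in Ioi (0 : ℝ),
      ENNReal.ofReal ((1 - Real.cos (2 * Real.pi * w * z)) * resolventDensity w)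
      = ∫⁻ w in Ioi (0 : ℝ), ∑' n : ℕ, ENNReal.ofReal (2 * Real.pi ^ 2 * (n + 1)) *
        ENNReal.ofReal (Real.exp (-(2 * Real.pi ^ 2 * (n + 1) * w)) *
          (1 - Real.cos (2 * Real.pi * z * w))) := by
    apply setLIntegral_congr_fun measurableSet_Ioi
    intro w hw
    have hw' : 0 < w := hw
    have hc : 0 ≤ 1 - Real.cos (2 * Real.pi * z * w) := by
      linarith [Real.cos_le_one (2 * Real.pi * z * w)]
    have hs := (hasSum_resolventDensity hw').mul_left (1 - Real.cos (2 * Real.pi * z * w))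
    have e : 2 * Real.pi * w * z = 2 * Real.pi * z * w := by ring
    simp only
    rw [e, ← hs.tsum_eq, ENNReal.ofReal_tsum_of_nonneg (fun n => by positivity) hs.summable]
    refine tsum_congr fun n => ?_
    rw [← ENNReal.ofReal_mul (by positivity)]
    congr 1
    ring
  rw [h1, lintegral_tsum (fun n => by fun_prop)]
  have hs := (hasSum_mul_coth hz).div_const 2
  rw [← hs.tsum_eq, ENNReal.ofReal_tsum_of_nonneg (fun n => by positivity) hs.summable]
  refine tsum_congr fun n => ?_
  rw [lintegral_const_mul _ (by fun_prop), lintegral_exp_mul_one_sub_cos (by positivity),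
    ← ENNReal.ofReal_mul (by positivity)]
  congr 1
  have : z ^ 2 + Real.pi ^ 2 * ((n : ℝ) + 1) ^ 2 ≠ 0 := by positivity
  field_simp
  ring

theorem lintegral_resolventDensity {z : ℝ} (hz : z ≠ 0) :
    ∫⁻ w : ℝ, ENNReal.ofReal ((1 - Real.cos (2 * Real.pi * w * z)) * resolventDensity w)
      = ENNReal.ofReal (z * Real.cosh z / Real.sinh z - 1) := by
  set f : ℝ → ℝ≥0∞ := fun w =>
    ENNReal.ofReal ((1 - Real.cos (2 * Real.pi * w * z)) * resolventDensity w) with hf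
  have hsym : ∀ w, f (-w) = f w := fun w => by
    simp only [hf, resolventDensity_neg]
    have : 2 * Real.pi * -w * z = -(2 * Real.pi * w * z) := by ring
    rw [this, Real.cos_neg]
  have h1 : ∫⁻ w in Iic (0 : ℝ), f w = ∫⁻ w in Ioi (0 : ℝ), f w := by
    rw [setLIntegral_congr Iio_ae_eq_Iic.symm]
    have := (Measure.measurePreserving_neg (volume : Measure ℝ)).setLIntegral_comp_preimage_emb
      (MeasurableEquiv.neg ℝ).measurableEmbedding f (Ioi 0)
    rw [← this]
    simp [hsym]
  have hnn : 0 ≤ (z * Real.cosh z / Real.sinh z - 1) / 2 := by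
    have := (hasSum_mul_coth hz).nonneg (fun n => by positivity)
    linarith
  rw [← lintegral_add_compl f measurableSet_Ioi, compl_Ioi, h1,
    lintegral_resolventDensity_Ioi hz, ← ENNReal.ofReal_add hnn hnn]
  congr 1
  ring

/-! ### Plancherel for functions in `L¹ ∩ L²` -/

section Plancherel

open FourierTransform

/-- Both transforms agree as distributions: against a test function φ each equals ∫ φ̂ f, by the
temperedness of the L² transform on one side and by the multiplication formula for L¹ on the other.
-/
theorem Lp_fourier_ae_eq {f : ℝ → ℂ} (h1 : Integrable f) (h2 : MemLp f 2) :
    (𝓕 (h2.toLp f) : Lp ℂ 2 (volume : Measure ℝ)) =ᵐ[volume] 𝓕 f := by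
  apply ae_eq_of_integral_contDiff_smul_eq
  · exact (Lp.memLp _).locallyIntegrable (by norm_num)
  · exact (VectorFourier.fourierIntegral_continuous Real.continuous_fourierChar
      (by exact (innerSL ℝ).continuous₂) h1).locallyIntegrable
  intro g g_smooth g_cpt
  have hg₁ : HasCompactSupport (Complex.ofRealCLM ∘ g) := g_cpt.comp_left rfl
  have hg₂ : ContDiff ℝ ((⊤ : ℕ∞) : WithTop ℕ∞) (Complex.ofRealCLM ∘ g) :=
    Complex.ofRealCLM.contDiff.comp g_smooth
  set φ := hg₁.toSchwartzMap hg₂ with hφ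
  have e1 := congrArg (fun T => T φ) (Lp.fourier_toTemperedDistribution_eq (h2.toLp f))
  simp only [TemperedDistribution.fourier_apply, Lp.toTemperedDistribution_apply] at e1
  have e2 : ∫ x, (𝓕 φ) x • (h2.toLp f) x = ∫ x, (𝓕 (φ : ℝ → ℂ)) x • f x := by
    apply integral_congr_ae
    filter_upwards [h2.coeFn_toLp] with x hx
    rw [hx, SchwartzMap.fourier_coe]
  have e3 : ∫ x, (𝓕 (φ : ℝ → ℂ)) x • f x = ∫ x, φ x • (𝓕 f) x := by
    have := VectorFourier.integral_fourierIntegral_smul_eq_flip (L := innerₗ ℝ) (μ := volume)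
      (ν := volume) Real.continuous_fourierChar (by exact (innerSL ℝ).continuous₂)
      (φ.integrable (μ := volume)) h1
    rwa [flip_innerₗ] at this
  calc _ = ∫ x, φ x • (𝓕 (h2.toLp f) : Lp ℂ 2 (volume : Measure ℝ)) x := by simp [hφ]
    _ = ∫ x, φ x • (𝓕 f) x := by rw [← e1, e2, e3]
    _ = _ := by simp [hφ]

theorem memLp_fourier {f : ℝ → ℂ} (h1 : Integrable f) (h2 : MemLp f 2) : MemLp (𝓕 f) 2 :=
  (memLp_congr_ae (Lp_fourier_ae_eq h1 h2)).1 (Lp.memLp _)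

theorem integral_conj_fourier_mul_fourier {f g : ℝ → ℂ} (hf1 : Integrable f) (hf2 : MemLp f 2)
    (hg1 : Integrable g) (hg2 : MemLp g 2) :
    ∫ w, starRingEnd ℂ (𝓕 f w) * 𝓕 g w = ∫ x, starRingEnd ℂ (f x) * g x := by
  have h := Lp.inner_fourier_eq (hf2.toLp f) (hg2.toLp g)
  rw [L2.inner_def, L2.inner_def] at h
  have e1 : ∫ a, ⟪(𝓕 (hf2.toLp f) : Lp ℂ 2 (volume : Measure ℝ)) a,
      (𝓕 (hg2.toLp g) : Lp ℂ 2 (volume : Measure ℝ)) a⟫_ℂ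
      = ∫ w, starRingEnd ℂ (𝓕 f w) * 𝓕 g w := by
    apply integral_congr_ae
    filter_upwards [Lp_fourier_ae_eq hf1 hf2, Lp_fourier_ae_eq hg1 hg2] with x h1 h2
    rw [h1, h2, RCLike.inner_apply, mul_comm]
  have e2 : ∫ a, ⟪hf2.toLp f a, hg2.toLp g a⟫_ℂ = ∫ x, starRingEnd ℂ (f x) * g x := by
    apply integral_congr_ae
    filter_upwards [hf2.coeFn_toLp, hg2.coeFn_toLp] with x h1 h2
    rw [h1, h2, RCLike.inner_apply, mul_comm]
  rw [← e1, ← e2, h]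

end Plancherel

/-! ### The exponential change of variables -/

theorem measurePreserving_exp :
    MeasurePreserving Real.exp (volume.withDensity fun s => ENNReal.ofReal (Real.exp s))
      halfLine := by
  refine ⟨Real.measurable_exp, ?_⟩
  ext A hA
  rw [Measure.map_apply Real.measurable_exp hA,
    withDensity_apply _ (Real.measurable_exp hA), Measure.restrict_apply hA]
  have h := lintegral_image_eq_lintegral_abs_deriv_mul (s := Real.exp ⁻¹' A)
    (Real.measurable_exp hA) (f := Real.exp) (f' := Real.exp)
    (fun x _ => (Real.hasDerivAt_exp x).hasDerivWithinAt) Real.exp_injective.injOn (fun _ => 1)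
  rw [image_preimage_eq_inter_range, Real.range_exp] at h
  simp only [lintegral_one, Measure.restrict_apply_univ, mul_one, Real.abs_exp] at h
  rw [h]

theorem measurableEmbedding_exp : MeasurableEmbedding Real.exp :=
  Real.isOpenEmbedding_exp.measurableEmbedding

theorem lintegral_halfLine (F : ℝ → ℝ≥0∞) :
    ∫⁻ t, F t ∂halfLine = ∫⁻ s, ENNReal.ofReal (Real.exp s) * F (Real.exp s) := by
  rw [← measurePreserving_exp.lintegral_comp_emb measurableEmbedding_exp]
  rw [lintegral_withDensity_eq_lintegral_mul_non_measurable _ (by fun_prop) (by simp)]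
  rfl

theorem integral_halfLine (F : ℝ → ℂ) :
    ∫ t, F t ∂halfLine = ∫ s, (Real.exp s : ℂ) * F (Real.exp s) := by
  rw [← measurePreserving_exp.integral_comp measurableEmbedding_exp]
  rw [integral_withDensity_eq_integral_toReal_smul (by fun_prop) (by simp)]
  simp [Real.exp_nonneg, ENNReal.toReal_ofReal]

theorem quasiMeasurePreserving_exp :
    Measure.QuasiMeasurePreserving Real.exp volume halfLine := by
  refine ⟨Real.measurable_exp, ?_⟩
  rw [← measurePreserving_exp.map_eq]
  apply Measure.AbsolutelyContinuous.map _ Real.measurable_exp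
  apply withDensity_absolutelyContinuous' (by fun_prop)
  simp [Real.exp_pos]

theorem integrable_halfLine_prod_iff {F : ℝ × ℝ → ℂ} :
    Integrable F (halfLine.prod halfLine) ↔
      Integrable (fun z : ℝ × ℝ => ((Real.exp z.1 * Real.exp z.2 : ℝ) : ℂ) *
        F (Real.exp z.1, Real.exp z.2)) := by
  have hmp := measurePreserving_exp.prod measurePreserving_exp
  have hemb := measurableEmbedding_exp.prodMap measurableEmbedding_exp
  rw [← hmp.integrable_comp_emb hemb, prod_withDensity (by fun_prop) (by fun_prop),
    integrable_withDensity_iff_integrable_smul' (by fun_prop)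
      (by simp [← ENNReal.ofReal_mul, Real.exp_nonneg])]
  rw [← Measure.volume_eq_prod]
  refine iff_of_eq (congrArg₂ _ ?_ rfl)
  ext z
  simp [Real.exp_nonneg, ENNReal.toReal_ofReal, Prod.map]

theorem integral_halfLine_prod (F : ℝ × ℝ → ℂ) :
    ∫ z, F z ∂(halfLine.prod halfLine) =
      ∫ z : ℝ × ℝ, ((Real.exp z.1 * Real.exp z.2 : ℝ) : ℂ) * F (Real.exp z.1, Real.exp z.2) := by
  have hmp := measurePreserving_exp.prod measurePreserving_exp
  have hemb := measurableEmbedding_exp.prodMap measurableEmbedding_exp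
  rw [← hmp.integral_comp hemb, prod_withDensity (by fun_prop) (by fun_prop),
    integral_withDensity_eq_integral_toReal_smul (by fun_prop)
      (by simp [← ENNReal.ofReal_mul, Real.exp_nonneg])]
  rw [← Measure.volume_eq_prod]
  congr 1
  ext z
  simp [Real.exp_nonneg, ENNReal.toReal_ofReal, Prod.map]

/-- The unitary transplantation `s ↦ e^{s/2} F(e^s)` of a function on the half-line to the line. -/
def lineFun (F : ℝ → ℂ) (s : ℝ) : ℂ := (Real.exp (s / 2) : ℂ) * F (Real.exp s)

theorem ofReal_exp_eq (s : ℝ) :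
    ((Real.exp s : ℝ) : ℂ) = (Real.exp (s / 2) : ℂ) * (Real.exp (s / 2) : ℂ) := by
  rw [← Complex.ofReal_mul, ← Real.exp_add]
  ring_nf

theorem integral_conj_mul_halfLine (F G : ℝ → ℂ) :
    ∫ t, starRingEnd ℂ (F t) * G t ∂halfLine
      = ∫ s, starRingEnd ℂ (lineFun F s) * lineFun G s := by
  rw [integral_halfLine]
  congr 1
  ext s
  rw [lineFun, lineFun, map_mul, Complex.conj_ofReal, ofReal_exp_eq]
  ring

theorem aestronglyMeasurable_lineFun {F : ℝ → ℂ} (hF : AEStronglyMeasurable F halfLine) :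
    AEStronglyMeasurable (lineFun F) := by
  have h := hF.comp_quasiMeasurePreserving quasiMeasurePreserving_exp
  refine AEStronglyMeasurable.mul ?_ h
  apply Measurable.aestronglyMeasurable
  fun_prop

theorem memLp_lineFun {F : ℝ → ℂ} (hF : MemLp F 2 halfLine) : MemLp (lineFun F) 2 := by
  refine ⟨aestronglyMeasurable_lineFun hF.1, ?_⟩
  have h := hF.2
  rw [eLpNorm_lt_top_iff_lintegral_rpow_enorm_lt_top (by norm_num) (by norm_num)] at h ⊢
  rw [lintegral_halfLine] at h
  refine lt_of_le_of_lt (le_of_eq ?_) h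
  congr 1
  ext s
  rw [lineFun, enorm_mul, ENNReal.mul_rpow_of_nonneg _ _ (by norm_num)]
  congr 1
  rw [← ofReal_norm, Complex.norm_real, Real.norm_of_nonneg (Real.exp_nonneg _)]
  norm_num
  rw [← ENNReal.ofReal_pow (Real.exp_nonneg _), ← Real.exp_nat_mul]
  congr 2
  push_cast
  ring

theorem lineFun_congr {F G : ℝ → ℂ} (h : F =ᵐ[halfLine] G) : lineFun F =ᵐ[volume] lineFun G := by
  have := quasiMeasurePreserving_exp.ae_eq_comp h
  filter_upwards [this] with s hs
  simp only [lineFun]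
  congr 1

theorem inner_eq_integral_lineFun (f g : L2) :
    ⟪f, g⟫_ℂ = ∫ s, starRingEnd ℂ (lineFun f s) * lineFun g s := by
  rw [← integral_conj_mul_halfLine, L2.inner_def]
  congr 1
  ext t
  rw [RCLike.inner_apply, mul_comm]

/-! ### The Mellin transform on the critical line diagonalizes the Carleman operator -/

section FourierSide

open FourierTransform

/-- The Fourier transform of the transplantation to the line, i.e. the Mellin transform on the
critical line. -/
def mellinFourier (f : ℝ → ℂ) : ℝ → ℂ := 𝓕 (lineFun f)

theorem mellinFourier_eq (f : ℝ → ℂ) (w : ℝ) :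
    mellinFourier f w = ∫ s : ℝ, Complex.exp (((-2 * Real.pi * s * w : ℝ) : ℂ) * Complex.I) *
      lineFun f s := by
  rw [mellinFourier, Real.fourier_real_eq_integral_exp_smul]
  simp only [smul_eq_mul]

theorem continuous_mellinFourier {f : ℝ → ℂ} (hf : Integrable (lineFun f)) :
    Continuous (mellinFourier f) :=
  VectorFourier.fourierIntegral_continuous Real.continuous_fourierChar
      (by exact (innerSL ℝ).continuous₂) hf

theorem norm_mellinFourier_le (f : ℝ → ℂ) (w : ℝ) :
    ‖mellinFourier f w‖ ≤ ∫ s, ‖lineFun f s‖ :=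
  VectorFourier.norm_fourierIntegral_le_integral_norm _ _ _ _ _

theorem memLp_mellinFourier {f : L2} (hf : Integrable (lineFun f)) :
    MemLp (mellinFourier f) 2 :=
  memLp_fourier hf (memLp_lineFun (Lp.memLp f))

theorem inner_eq_integral_mellinFourier {f g : L2} (hf : Integrable (lineFun f))
    (hg : Integrable (lineFun g)) :
    ⟪f, g⟫_ℂ = ∫ w, starRingEnd ℂ (mellinFourier f w) * mellinFourier g w := by
  rw [inner_eq_integral_lineFun]
  exact (integral_conj_fourier_mul_fourier hf (memLp_lineFun (Lp.memLp f)) hg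
    (memLp_lineFun (Lp.memLp g))).symm

theorem integral_exp_swap {F G : ℝ → ℂ} (hF : Integrable F) (hG : Integrable G) :
    ∫ x : ℝ, F x * ∫ w : ℝ, Complex.exp (((2 * Real.pi * x * w : ℝ) : ℂ) * Complex.I) * G w
      = ∫ w : ℝ, G w * ∫ x : ℝ, Complex.exp (((2 * Real.pi * x * w : ℝ) : ℂ) * Complex.I) * F x
      := by
  simp_rw [← integral_const_mul]
  rw [integral_integral_swap]
  · refine integral_congr_ae (Eventually.of_forall fun w => ?_)
    refine integral_congr_ae (Eventually.of_forall fun x => ?_)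
    simp only
    ring
  · have h := hF.mul_prod hG
    refine (h.bdd_mul (c := 1)
      (f := fun z : ℝ × ℝ => Complex.exp (((2 * Real.pi * z.1 * z.2 : ℝ) : ℂ) * Complex.I))
      (by apply Continuous.aestronglyMeasurable; fun_prop)
      (Eventually.of_forall fun z => (Complex.norm_exp_ofReal_mul_I _).le)).congr ?_
    refine Eventually.of_forall fun z => ?_
    simp only [Function.uncurry]
    ring

/-- Rests on e^{a/2} e^{b/2} / (e^a + e^b) = 1/(2 cosh((a − b)/2)): homogeneity of degree −1 becomes
translation invariance. -/
theorem lineFun_carlemanFun (g : ℝ → ℂ) (a : ℝ) :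
    lineFun (carlemanFun g) a =
      ∫ b : ℝ, lineFun g b * (((2 * Real.cosh ((a - b) / 2))⁻¹ : ℝ) : ℂ) := by
  rw [lineFun, carlemanFun, integral_halfLine, ← integral_const_mul]
  congr 1
  ext b
  rw [lineFun, ofReal_exp_eq b]
  have h : Real.exp (a / 2) * (Real.exp (b / 2) * (Real.exp a + Real.exp b)⁻¹)
      = (2 * Real.cosh ((a - b) / 2))⁻¹ := by
    have e1 : Real.exp a = Real.exp (a / 2) * Real.exp (a / 2) := by
      rw [← Real.exp_add]; ring_nf
    have e2 : Real.exp b = Real.exp (b / 2) * Real.exp (b / 2) := by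
      rw [← Real.exp_add]; ring_nf
    rw [e1, e2, Real.cosh_eq, sub_div, neg_sub, Real.exp_sub, Real.exp_sub]
    have := Real.exp_pos (a / 2)
    have := Real.exp_pos (b / 2)
    field_simp
  rw [← h]
  push_cast
  ring

theorem carlemanSymbol_neg (w : ℝ) : carlemanSymbol (-w) = carlemanSymbol w := by
  simp [carlemanSymbol]

theorem conj_mellinFourier (f : ℝ → ℂ) (w : ℝ) :
    starRingEnd ℂ (mellinFourier f w) =
      ∫ s : ℝ, Complex.exp (((2 * Real.pi * s * w : ℝ) : ℂ) * Complex.I) *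
        starRingEnd ℂ (lineFun f s) := by
  rw [mellinFourier_eq f, ← integral_conj]
  congr 1
  ext s
  rw [map_mul, ← Complex.exp_conj, map_mul, Complex.conj_ofReal, Complex.conj_I]
  congr 2
  push_cast
  ring

/-- The convolution kernel is written as a Fourier integral of its symbol, and two applications of
Fubini move the exponentials onto g and then onto f. Integrability on the line is all that this
needs; density extends the consequences later. -/
theorem inner_carleman_eq {f g : L2} (hf : Integrable (lineFun f)) (hg : Integrable (lineFun g)) :
    ⟪f, carleman g⟫_ℂ = ∫ w, (carlemanSymbol w : ℂ) *
      (starRingEnd ℂ (mellinFourier f w) * mellinFourier g w) := by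
  have hm := integrable_carlemanSymbol.ofReal (𝕜 := ℂ)
  have hmg : Integrable (fun w => (carlemanSymbol w : ℂ) * mellinFourier g w) :=
    hm.mul_bdd (c := ∫ s, ‖lineFun g s‖) (continuous_mellinFourier hg).aestronglyMeasurable
      (Eventually.of_forall (norm_mellinFourier_le g))
  have hconj : Integrable (fun s => starRingEnd ℂ (lineFun f s)) :=
    (Complex.conjCLE.toContinuousLinearMap.integrable_comp hf)
  have hinner : ∀ a : ℝ, lineFun (carlemanFun g) a =
      ∫ w : ℝ, Complex.exp (((2 * Real.pi * a * w : ℝ) : ℂ) * Complex.I) *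
        ((carlemanSymbol w : ℂ) * mellinFourier g w) := by
    intro a
    rw [lineFun_carlemanFun]
    have hma : Integrable (fun w : ℝ => Complex.exp (((-2 * Real.pi * a * w : ℝ) : ℂ) * Complex.I) *
        (carlemanSymbol w : ℂ)) :=
      hm.bdd_mul (c := 1) (by apply Continuous.aestronglyMeasurable; fun_prop)
        (Eventually.of_forall fun z => (Complex.norm_exp_ofReal_mul_I _).le)
    have h1 := integral_exp_swap hg hma
    have h2 : ∀ b : ℝ, ∫ w : ℝ, Complex.exp (((2 * Real.pi * b * w : ℝ) : ℂ) * Complex.I) *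
        (Complex.exp (((-2 * Real.pi * a * w : ℝ) : ℂ) * Complex.I) * (carlemanSymbol w : ℂ))
        = (((2 * Real.cosh ((a - b) / 2))⁻¹ : ℝ) : ℂ) := by
      intro b
      have e : (a - b) / 2 = -((b - a) / 2) := by ring
      rw [e, Real.cosh_neg, ← integral_exp_mul_carlemanSymbol]
      congr 1
      ext w
      rw [← mul_assoc, ← Complex.exp_add]
      congr 2
      push_cast
      ring
    simp only [h2] at h1
    -- The reflection w ↦ −w, harmless because the symbol is even, matches the sign in the
    -- exponential of `mellinFourier`.
    rw [h1, ← integral_neg_eq_self]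
    congr 1
    ext w
    rw [carlemanSymbol_neg, mellinFourier_eq, mul_assoc]
    congr 2
    · push_cast; ring_nf
    · congr 1
      ext b
      congr 3
      push_cast
      ring
  have h0 : ∫ s, starRingEnd ℂ (lineFun f s) * lineFun (carleman g) s
      = ∫ s, starRingEnd ℂ (lineFun f s) * lineFun (carlemanFun g) s := by
    apply integral_congr_ae
    filter_upwards [lineFun_congr (carleman_apply g)] with s hs
    rw [hs]
  rw [inner_eq_integral_lineFun, h0]
  simp only [hinner]
  rw [integral_exp_swap hconj hmg]
  congr 1
  ext w
  rw [conj_mellinFourier]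
  ring

end FourierSide

section WeightOperator

/-! ### Multiplication by the weight `⟨ln t⟩^{-α}` -/

theorem measurable_logWeight : Measurable logWeight := by
  unfold logWeight; fun_prop

theorem one_le_logWeight (t : ℝ) : 1 ≤ logWeight t := by
  rw [logWeight, Real.one_le_sqrt]
  nlinarith [sq_nonneg (Real.log t)]

theorem logWeight_rpow_neg_le_one {α : ℝ} (hα : 0 ≤ α) (t : ℝ) : logWeight t ^ (-α) ≤ 1 :=
  Real.rpow_le_one_of_one_le_of_nonpos (one_le_logWeight t) (by linarith)

theorem logWeight_rpow_neg_pos (α t : ℝ) : 0 < logWeight t ^ (-α) :=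
  Real.rpow_pos_of_pos (logWeight_pos t) _

theorem memLp_weight_mul {α : ℝ} (hα : 0 ≤ α) (f : L2) :
    MemLp (fun t => ((logWeight t ^ (-α) : ℝ) : ℂ) * f t) 2 halfLine := by
  refine MemLp.of_le (Lp.memLp f) ?_ ?_
  · refine AEStronglyMeasurable.mul ?_ (Lp.aestronglyMeasurable f)
    have := measurable_logWeight
    apply Measurable.aestronglyMeasurable
    fun_prop
  · refine Eventually.of_forall fun t => ?_
    rw [norm_mul, Complex.norm_real, Real.norm_of_nonneg (logWeight_rpow_neg_pos α t).le]
    exact mul_le_of_le_one_left (norm_nonneg _) (logWeight_rpow_neg_le_one hα t)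

/-- The bounded operator `Q^{-α}`. -/
def weightOp {α : ℝ} (hα : 0 ≤ α) : L2 →L[ℂ] L2 :=
  LinearMap.mkContinuous
    { toFun := fun f => (memLp_weight_mul hα f).toLp _
      map_add' := by
        intro f g
        rw [← MemLp.toLp_add, MemLp.toLp_eq_toLp_iff]
        filter_upwards [Lp.coeFn_add f g] with t ht
        rw [ht, Pi.add_apply, Pi.add_apply, mul_add]
      map_smul' := by
        intro c f
        rw [RingHom.id_apply, ← MemLp.toLp_const_smul, MemLp.toLp_eq_toLp_iff]
        filter_upwards [Lp.coeFn_smul c f] with t ht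
        rw [ht, Pi.smul_apply, Pi.smul_apply, smul_eq_mul, smul_eq_mul]
        ring }
    1 (by
      intro f
      simp only [LinearMap.coe_mk, AddHom.coe_mk, one_mul]
      refine Lp.norm_le_norm_of_ae_le ?_
      filter_upwards [(memLp_weight_mul hα f).coeFn_toLp] with t ht
      rw [ht, norm_mul, Complex.norm_real, Real.norm_of_nonneg (logWeight_rpow_neg_pos α t).le]
      exact mul_le_of_le_one_left (norm_nonneg _) (logWeight_rpow_neg_le_one hα t))

variable {α : ℝ}

theorem weightOp_apply (hα : 0 ≤ α) (f : L2) :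
    weightOp hα f =ᵐ[halfLine] fun t => ((logWeight t ^ (-α) : ℝ) : ℂ) * f t :=
  (memLp_weight_mul hα f).coeFn_toLp

theorem inner_weightOp_left (hα : 0 ≤ α) (f g : L2) :
    ⟪weightOp hα f, g⟫_ℂ = ⟪f, weightOp hα g⟫_ℂ := by
  rw [L2.inner_def, L2.inner_def]
  apply integral_congr_ae
  filter_upwards [weightOp_apply hα f, weightOp_apply hα g] with t hf hg
  rw [hf, hg, RCLike.inner_apply, RCLike.inner_apply, map_mul, Complex.conj_ofReal]
  ring

theorem weightOp_injective (hα : 0 ≤ α) : Function.Injective (weightOp hα) := by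
  intro f g h
  apply Lp.ext
  filter_upwards [weightOp_apply hα f, weightOp_apply hα g] with t hf hg
  rw [h, hg] at hf
  have : ((logWeight t ^ (-α) : ℝ) : ℂ) ≠ 0 := by
    exact_mod_cast (logWeight_rpow_neg_pos α t).ne'
  exact (mul_left_cancel₀ this hf).symm

/-- A vector orthogonal to the range of an injective self-adjoint operator is zero. -/
theorem denseRange_weightOp (hα : 0 ≤ α) : DenseRange (weightOp hα) := by
  have h : (LinearMap.range (weightOp hα : L2 →ₗ[ℂ] L2)).topologicalClosure = ⊤ := by
    rw [Submodule.topologicalClosure_eq_top_iff, Submodule.eq_bot_iff]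
    intro g hg
    have h1 : weightOp hα g = 0 := by
      rw [← inner_self_eq_zero (𝕜 := ℂ), inner_weightOp_left]
      have := (Submodule.mem_orthogonal' _ g).1 hg (weightOp hα (weightOp hα g)) ⟨_, rfl⟩
      exact this
    exact weightOp_injective hα (by rw [h1, map_zero])
  have h2 := (Submodule.dense_iff_topologicalClosure_eq_top).2 h
  exact h2

/-- The weight `⟨s⟩^{-α}` on the line. -/
def lineWeight (α s : ℝ) : ℝ := (1 + s ^ 2) ^ (-α / 2)

theorem lineWeight_pos (α s : ℝ) : 0 < lineWeight α s :=
  Real.rpow_pos_of_pos (by positivity) _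

theorem measurable_lineWeight (α : ℝ) : Measurable (lineWeight α) := by
  unfold lineWeight; fun_prop

theorem logWeight_exp_rpow (α s : ℝ) : logWeight (Real.exp s) ^ (-α) = lineWeight α s := by
  rw [logWeight, Real.log_exp, lineWeight, Real.sqrt_eq_rpow, ← Real.rpow_mul (by positivity)]
  congr 1
  ring

theorem one_add_abs_mul_lineWeight_sq_le (α s : ℝ) :
    ((1 + |s|) * lineWeight α s) ^ 2 ≤ 2 * (1 + ‖s‖ ^ 2) ^ (-(2 * α - 2) / 2) := by
  have h0 : 0 < 1 + s ^ 2 := by positivity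
  have h1 : lineWeight α s ^ 2 = (1 + s ^ 2) ^ (-(2 * α - 2) / 2) * (1 + s ^ 2)⁻¹ := by
    rw [lineWeight, ← Real.rpow_natCast, ← Real.rpow_mul h0.le, ← Real.rpow_neg_one,
      ← Real.rpow_add h0]
    congr 1
    push_cast
    ring
  have h2 : (1 + |s|) ^ 2 ≤ 2 * (1 + s ^ 2) := by
    nlinarith [sq_nonneg (1 - |s|), sq_abs s]
  rw [mul_pow, h1, Real.norm_eq_abs, sq_abs]
  have h3 := Real.rpow_pos_of_pos h0 (-(2 * α - 2) / 2)
  calc _ ≤ 2 * (1 + s ^ 2) * ((1 + s ^ 2) ^ (-(2 * α - 2) / 2) * (1 + s ^ 2)⁻¹) := by gcongr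
    _ = _ := by field_simp

/-- This is where the threshold comes from: the function is O(⟨s⟩^{−(2α − 2)}), and 2α − 2 > 1. -/
theorem integrable_one_add_abs_mul_lineWeight_sq (hα : 3 / 2 < α) :
    Integrable (fun s => ((1 + |s|) * lineWeight α s) ^ 2) := by
  have h := (integrable_rpow_neg_one_add_norm_sq (μ := (volume : Measure ℝ)) (E := ℝ)
    (r := 2 * α - 2) (by simp; linarith)).const_mul 2
  have := measurable_lineWeight α
  refine h.mono' (by fun_prop) (Eventually.of_forall fun s => ?_)
  rw [Real.norm_of_nonneg (by positivity)]
  exact one_add_abs_mul_lineWeight_sq_le α s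

theorem memLp_one_add_abs_mul_lineWeight (hα : 3 / 2 < α) :
    MemLp (fun s => (((1 + |s|) * lineWeight α s : ℝ) : ℂ)) 2 := by
  have := measurable_lineWeight α
  rw [memLp_two_iff_integrable_sq_norm (by fun_prop)]
  refine (integrable_one_add_abs_mul_lineWeight_sq hα).congr (Eventually.of_forall fun s => ?_)
  simp only [Complex.norm_real, Real.norm_eq_abs, sq_abs]

theorem lineFun_weightOp (hα : 0 ≤ α) (f : L2) :
    lineFun (weightOp hα f) =ᵐ[volume] fun s => (lineWeight α s : ℂ) * lineFun f s := by
  filter_upwards [lineFun_congr (weightOp_apply hα f)] with s hs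
  rw [hs]
  simp only [lineFun, logWeight_exp_rpow]
  ring

/-- Cauchy–Schwarz. A finite first absolute moment is what the linear growth of z coth z requires.
-/
theorem integrable_one_add_abs_mul_lineFun_weightOp (hα : 3 / 2 < α) (f : L2) :
    Integrable (fun s => ((1 + |s| : ℝ) : ℂ) *
      lineFun (weightOp (by linarith : 0 ≤ α) f) s) := by
  have h := (memLp_one_add_abs_mul_lineWeight hα).integrable_mul (memLp_lineFun (Lp.memLp f))
  refine h.congr ?_
  filter_upwards [lineFun_weightOp (by linarith : 0 ≤ α) f] with s hs
  rw [hs, Pi.mul_apply]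
  push_cast
  ring

theorem integrable_of_one_add_abs_mul {γ : ℝ → ℂ} (hm : AEStronglyMeasurable γ)
    (h : Integrable (fun s => ((1 + |s| : ℝ) : ℂ) * γ s)) : Integrable γ := by
  refine h.mono hm (Eventually.of_forall fun s => ?_)
  rw [norm_mul, Complex.norm_real, Real.norm_of_nonneg (by positivity)]
  exact le_mul_of_one_le_left (norm_nonneg _) (by linarith [abs_nonneg s])

theorem integrable_lineFun_weightOp (hα : 3 / 2 < α) (f : L2) :
    Integrable (lineFun (weightOp (by linarith : 0 ≤ α) f)) :=
  integrable_of_one_add_abs_mul (aestronglyMeasurable_lineFun (Lp.aestronglyMeasurable _))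
    (integrable_one_add_abs_mul_lineFun_weightOp hα f)

theorem lineFun_weightedPsi (hα : 1 / 2 < α) :
    lineFun (weightedPsi α hα) =ᵐ[volume] fun s => (lineWeight α s : ℂ) := by
  filter_upwards [lineFun_congr (memLp_weightedPsi α hα).coeFn_toLp] with s hs
  rw [weightedPsi, hs]
  simp only [lineFun, logWeight_exp_rpow]
  rw [← Complex.ofReal_mul, ← Real.exp_mul, mul_left_comm, ← Real.exp_add]
  have : s / 2 + s * -(1 / 2) = 0 := by ring
  rw [this, Real.exp_zero, mul_one]

/-- Since ψ₀ becomes the constant 1 on the line, orthogonality to Q^{-α}ψ₀ says that the Fourier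
transform of the transplanted Q^{-α}x vanishes at frequency 0, the zero of `gapSymbol`. -/
theorem inner_weightedPsi (hα : 3 / 2 < α) (x : L2) :
    ⟪weightedPsi α (by linarith), x⟫_ℂ
      = ∫ s, lineFun (weightOp (by linarith : 0 ≤ α) x) s := by
  rw [inner_eq_integral_lineFun]
  apply integral_congr_ae
  filter_upwards [lineFun_weightedPsi (by linarith : 1 / 2 < α),
    lineFun_weightOp (by linarith : 0 ≤ α) x] with s h1 h2
  rw [h1, h2, Complex.conj_ofReal]

/-! ### The function `z coth z` -/

/-- The function `z coth z` (with value `0` at `z = 0`). -/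
def mulCoth (z : ℝ) : ℝ := z * Real.cosh z / Real.sinh z

theorem measurable_mulCoth : Measurable mulCoth := by
  unfold mulCoth; fun_prop

theorem one_le_mulCoth {z : ℝ} (hz : z ≠ 0) : 1 ≤ mulCoth z := by
  have := (hasSum_mul_coth hz).nonneg (fun n => by positivity)
  unfold mulCoth
  linarith

theorem mulCoth_nonneg (z : ℝ) : 0 ≤ mulCoth z := by
  by_cases hz : z = 0
  · simp [hz, mulCoth]
  · linarith [one_le_mulCoth hz]

theorem mulCoth_neg (z : ℝ) : mulCoth (-z) = mulCoth z := by
  simp [mulCoth, Real.cosh_neg, Real.sinh_neg]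

theorem mulCoth_le (z : ℝ) : mulCoth z ≤ 1 + |z| := by
  have key : ∀ z : ℝ, 0 < z → mulCoth z ≤ 1 + z := by
    intro z hz
    have hs : 0 < Real.sinh z := Real.sinh_pos_iff.2 hz
    have h1 : z ≤ Real.sinh z := Real.self_le_sinh_iff.2 hz.le
    rw [mulCoth, div_le_iff₀ hs]
    have h2 : Real.cosh z - Real.sinh z = Real.exp (-z) := Real.cosh_sub_sinh z
    have h3 : Real.exp (-z) ≤ 1 := Real.exp_le_one_iff.2 (by linarith)
    nlinarith [Real.exp_pos (-z)]
  rcases lt_trichotomy z 0 with h | h | h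
  · rw [← mulCoth_neg, abs_of_neg h]; exact key _ (by linarith)
  · simp [h, mulCoth]
  · rw [abs_of_pos h]; exact key _ h

/-- The product form separates the variables in every double integral with this kernel. -/
theorem mulCoth_sub_le (a b : ℝ) : mulCoth (a - b) ≤ (1 + |a|) * (1 + |b|) := by
  have h1 := mulCoth_le (a - b)
  have h2 := abs_sub a b
  nlinarith [abs_nonneg a, abs_nonneg b]

/-- At y = 0 both sides take the conventional value 0, so no exceptional point is needed. -/
theorem sigmaOne_exp (y : ℝ) : sigmaOne (Real.exp y) = -mulCoth y := by
  by_cases hy : y = 0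
  · simp [hy, sigmaOne, mulCoth]
  rw [sigmaOne, mulCoth, Real.log_exp, Real.cosh_eq, Real.sinh_eq, Real.exp_neg]
  have h1 := Real.exp_pos y
  have h2 : Real.exp y ^ 2 ≠ 1 := by
    rw [← Real.exp_nat_mul]
    intro h
    rw [Real.exp_eq_one_iff] at h
    simp [hy] at h
  have h3 : 1 - Real.exp y ^ 2 ≠ 0 := fun h => h2 (by linarith)
  have h4 : Real.exp y ^ 2 - 1 ≠ 0 := fun h => h2 (by linarith)
  field_simp
  ring

/-! ### The kernel of the regularized resolvent -/

/-- The kernel of `Q^{-α} R Q^{-α}`, where `R` is the regular part of `(π - C)⁻¹ - π⁻¹`. -/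
def resolventKernel (α : ℝ) (z : ℝ × ℝ) : ℝ :=
  (Real.pi ^ 3)⁻¹ * (logWeight z.1 ^ (-α) * (z.1 * z.2) ^ (-(1 / 2 : ℝ)) *
    sigmaOne (z.1 / z.2) * logWeight z.2 ^ (-α))

theorem measurable_sigmaOne : Measurable sigmaOne := by
  unfold sigmaOne; fun_prop

theorem measurable_resolventKernel (α : ℝ) : Measurable (resolventKernel α) := by
  have := measurable_logWeight
  have := measurable_sigmaOne
  unfold resolventKernel
  fun_prop

theorem resolventKernel_exp (α a b : ℝ) :
    Real.exp (a / 2) * Real.exp (b / 2) * resolventKernel α (Real.exp a, Real.exp b)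
      = -((Real.pi ^ 3)⁻¹ * (mulCoth (a - b) * (lineWeight α a * lineWeight α b))) := by
  simp only [resolventKernel]
  rw [logWeight_exp_rpow, logWeight_exp_rpow, ← Real.exp_sub, sigmaOne_exp, ← Real.exp_add a b,
    ← Real.exp_mul]
  have : Real.exp (a / 2) * Real.exp (b / 2) * Real.exp ((a + b) * -(1 / 2)) = 1 := by
    rw [← Real.exp_add, ← Real.exp_add, Real.exp_eq_one_iff]
    ring
  linear_combination (-(Real.pi ^ 3)⁻¹ * (mulCoth (a - b) * (lineWeight α a * lineWeight α b))) *
    this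

theorem resolventKernel_sq {z : ℝ × ℝ} (h1 : 0 < z.1) (h2 : 0 < z.2) :
    resolventKernel α z ^ 2 = (Real.pi ^ 6)⁻¹ * gammaIntegrand α z := by
  have e : ∀ t : ℝ, (logWeight t ^ (-α)) ^ 2 = logWeight t ^ (-(2 * α)) := fun t => by
    rw [← Real.rpow_natCast, ← Real.rpow_mul (logWeight_pos t).le]
    congr 1; push_cast; ring
  have e2 : ((z.1 * z.2) ^ (-(1 / 2 : ℝ))) ^ 2 = (z.1 * z.2)⁻¹ := by
    rw [← Real.rpow_natCast, ← Real.rpow_mul (by positivity), ← Real.rpow_neg_one]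
    congr 1; push_cast; ring
  rw [resolventKernel, gammaIntegrand, mul_pow, mul_pow, mul_pow, mul_pow, e, e, e2]
  ring

theorem ae_pos_prod : ∀ᵐ z ∂(halfLine.prod halfLine), 0 < z.1 ∧ 0 < z.2 := by
  rw [Measure.prod_restrict]
  filter_upwards [ae_restrict_mem (measurableSet_Ioi.prod measurableSet_Ioi)] with z hz
  exact hz

theorem memLp_resolventKernel (hα : 3 / 2 < α) :
    MemLp (fun z => (resolventKernel α z : ℂ)) 2 (halfLine.prod halfLine) := by
  have hm := measurable_resolventKernel α
  have hw := measurable_lineWeight α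
  have hc := measurable_mulCoth
  rw [memLp_two_iff_integrable_sq_norm (by fun_prop)]
  have h : Integrable (fun z => ((resolventKernel α z ^ 2 : ℝ) : ℂ)) (halfLine.prod halfLine) := by
    rw [integrable_halfLine_prod_iff]
    have h1 := (integrable_one_add_abs_mul_lineWeight_sq hα).mul_prod
      (integrable_one_add_abs_mul_lineWeight_sq hα)
    have h2 := h1.const_mul ((Real.pi ^ 3)⁻¹ ^ 2)
    refine h2.mono' (by fun_prop) (Eventually.of_forall fun z => ?_)
    have e := resolventKernel_exp α z.1 z.2
    have e3 : Real.exp z.1 * Real.exp z.2 * resolventKernel α (Real.exp z.1, Real.exp z.2) ^ 2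
        = (mulCoth (z.1 - z.2)) ^ 2 * ((Real.pi ^ 3)⁻¹ ^ 2 *
          (lineWeight α z.1 ^ 2 * lineWeight α z.2 ^ 2)) := by
      calc _ = (Real.exp (z.1 / 2) * Real.exp (z.2 / 2) *
            resolventKernel α (Real.exp z.1, Real.exp z.2)) ^ 2 := by
            rw [mul_pow, mul_pow, ← Real.exp_nat_mul, ← Real.exp_nat_mul]
            push_cast
            rw [mul_div_cancel₀ _ two_ne_zero, mul_div_cancel₀ _ two_ne_zero]
        _ = _ := by rw [e]; ring
    rw [← Complex.ofReal_mul, e3, Complex.norm_real, Real.norm_of_nonneg (by positivity)]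
    have h4 := pow_le_pow_left₀ (mulCoth_nonneg _) (mulCoth_sub_le z.1 z.2) 2
    calc _ ≤ ((1 + |z.1|) * (1 + |z.2|)) ^ 2 * ((Real.pi ^ 3)⁻¹ ^ 2 *
          (lineWeight α z.1 ^ 2 * lineWeight α z.2 ^ 2)) := by gcongr
      _ = _ := by ring
  refine h.re.congr (Eventually.of_forall fun z => ?_)
  simp only [RCLike.re_to_complex, Complex.ofReal_re, Complex.norm_real, Real.norm_eq_abs, sq_abs]

theorem integrable_gammaIntegrand (hα : 3 / 2 < α) :
    Integrable (gammaIntegrand α) (halfLine.prod halfLine) := by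
  have h := (memLp_two_iff_integrable_sq_norm (memLp_resolventKernel hα).1).1
    (memLp_resolventKernel hα)
  refine (h.const_mul (Real.pi ^ 6)).congr ?_
  filter_upwards [ae_pos_prod] with z hz
  rw [Complex.norm_real, Real.norm_eq_abs, sq_abs, resolventKernel_sq hz.1 hz.2]
  have := Real.pi_pos
  field_simp

/-- The squared kernel carries π⁻⁶ and γ_α² carries π⁻⁴, which leaves the factor π⁻². -/
theorem integral_resolventKernel_sq (α : ℝ) :
    ∫ z, resolventKernel α z ^ 2 ∂(halfLine.prod halfLine) = (gammaConst α / Real.pi) ^ 2 := by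
  have h : ∫ z, resolventKernel α z ^ 2 ∂(halfLine.prod halfLine)
      = (Real.pi ^ 6)⁻¹ * ∫ z, gammaIntegrand α z ∂(halfLine.prod halfLine) := by
    rw [← integral_const_mul]
    apply integral_congr_ae
    filter_upwards [ae_pos_prod] with z hz
    rw [resolventKernel_sq hz.1 hz.2]
  have hn : 0 ≤ ∫ z, gammaIntegrand α z ∂(halfLine.prod halfLine) := by
    apply integral_nonneg_of_ae
    filter_upwards [ae_pos_prod] with z hz
    have := logWeight_pos z.1
    have := logWeight_pos z.2
    have := hz.1
    have := hz.2
    simp only [Pi.zero_apply, gammaIntegrand]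
    positivity
  rw [h, gammaConst, div_pow, Real.sq_sqrt (by positivity)]
  have := Real.pi_pos
  field_simp

end WeightOperator

/-! ### The quadratic form of the regularized resolvent -/

theorem one_sub_cos_mul_resolventDensity_nonneg (z w : ℝ) :
    0 ≤ (1 - Real.cos (2 * Real.pi * w * z)) * resolventDensity w :=
  mul_nonneg (by linarith [Real.cos_le_one (2 * Real.pi * w * z)]) (resolventDensity_nonneg w)

theorem integrable_one_sub_cos_mul_resolventDensity {z : ℝ} (hz : z ≠ 0) :
    Integrable (fun w => (1 - Real.cos (2 * Real.pi * w * z)) * resolventDensity w) := by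
  have hm := measurable_resolventDensity
  refine ⟨by fun_prop, ?_⟩
  rw [hasFiniteIntegral_iff_ofReal, lintegral_resolventDensity hz]
  · exact ENNReal.ofReal_lt_top
  · exact Eventually.of_forall (one_sub_cos_mul_resolventDensity_nonneg z)

theorem integral_one_sub_cos_mul_resolventDensity {z : ℝ} (hz : z ≠ 0) :
    ∫ w, (1 - Real.cos (2 * Real.pi * w * z)) * resolventDensity w = mulCoth z - 1 := by
  have hm := measurable_resolventDensity
  rw [integral_eq_lintegral_of_nonneg_ae, lintegral_resolventDensity hz, ENNReal.toReal_ofReal]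
  · rfl
  · have := one_le_mulCoth hz
    unfold mulCoth at this
    linarith
  · exact Eventually.of_forall (one_sub_cos_mul_resolventDensity_nonneg z)
  · fun_prop

theorem ae_ne_prod : ∀ᵐ z : ℝ × ℝ, z.1 - z.2 ≠ 0 := by
  rw [Measure.volume_eq_prod]
  have hs : MeasurableSet {z : ℝ × ℝ | z.1 - z.2 ≠ 0} := by
    apply MeasurableSet.compl
    exact measurableSet_eq_fun (by fun_prop) (by fun_prop)
  rw [Measure.ae_prod_iff_ae_ae hs]
  refine Eventually.of_forall fun a => ?_
  have : ∀ᵐ b : ℝ, b ≠ a := by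
    simp [ae_iff]
  filter_upwards [this] with b hb
  exact sub_ne_zero.2 hb.symm

section FourierSide

open FourierTransform

variable {γ : ℝ → ℂ}

/-- The constant 1 integrates to |∫ γ|² = 0. Splitting the cosine into two exponentials gives the
average of |γ̂|² over w and −w. -/
theorem integral_one_sub_cos_mul_conj_mul (hγ : Integrable γ) (h0 : ∫ s, γ s = 0) (w : ℝ) :
    ∫ z : ℝ × ℝ, ((1 - Real.cos (2 * Real.pi * w * (z.1 - z.2)) : ℝ) : ℂ) *
      (starRingEnd ℂ (γ z.1) * γ z.2)
      = -(((‖𝓕 γ w‖ ^ 2 + ‖𝓕 γ (-w)‖ ^ 2) / 2 : ℝ) : ℂ) := by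
  have hconj : Integrable (fun s => starRingEnd ℂ (γ s)) :=
    Complex.conjCLE.toContinuousLinearMap.integrable_comp hγ
  have he : ∀ v : ℝ, Integrable (fun s => Complex.exp (((-2 * Real.pi * s * v : ℝ) : ℂ) *
      Complex.I) * γ s) := fun v =>
    hγ.bdd_mul (c := 1) (by apply Continuous.aestronglyMeasurable; fun_prop)
        (Eventually.of_forall fun z => (Complex.norm_exp_ofReal_mul_I _).le)
  have hec : ∀ v : ℝ, Integrable (fun s => starRingEnd ℂ (Complex.exp
      (((-2 * Real.pi * s * v : ℝ) : ℂ) * Complex.I) * γ s)) := fun v =>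
    Complex.conjCLE.toContinuousLinearMap.integrable_comp (he v)
  have hF : ∀ v : ℝ, ∫ z : ℝ × ℝ, starRingEnd ℂ (Complex.exp
      (((-2 * Real.pi * z.1 * v : ℝ) : ℂ) * Complex.I) * γ z.1) *
      (Complex.exp (((-2 * Real.pi * z.2 * v : ℝ) : ℂ) * Complex.I) * γ z.2)
      = ((‖𝓕 γ v‖ ^ 2 : ℝ) : ℂ) := by
    intro v
    refine (integral_prod_mul (μ := volume) (ν := volume) (fun s => starRingEnd ℂ (Complex.exp
      (((-2 * Real.pi * s * v : ℝ) : ℂ) * Complex.I) * γ s)) (fun s => Complex.exp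
      (((-2 * Real.pi * s * v : ℝ) : ℂ) * Complex.I) * γ s)).trans ?_
    rw [integral_conj, Real.fourier_real_eq_integral_exp_smul]
    simp only [smul_eq_mul]
    rw [Complex.conj_mul']
    push_cast
    rfl
  have hI : ∀ v : ℝ, Integrable (fun z : ℝ × ℝ => starRingEnd ℂ (Complex.exp
      (((-2 * Real.pi * z.1 * v : ℝ) : ℂ) * Complex.I) * γ z.1) *
      (Complex.exp (((-2 * Real.pi * z.2 * v : ℝ) : ℂ) * Complex.I) * γ z.2)) := fun v =>
    (hec v).mul_prod (he v)
  have h1 : ∫ z : ℝ × ℝ, starRingEnd ℂ (γ z.1) * γ z.2 = 0 := by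
    rw [Measure.volume_eq_prod, integral_prod_mul (fun s => starRingEnd ℂ (γ s)), h0, mul_zero]
  have hI1 : Integrable (fun z : ℝ × ℝ => starRingEnd ℂ (γ z.1) * γ z.2) := hconj.mul_prod hγ
  have key : ∀ z : ℝ × ℝ, ((1 - Real.cos (2 * Real.pi * w * (z.1 - z.2)) : ℝ) : ℂ) *
      (starRingEnd ℂ (γ z.1) * γ z.2)
      = starRingEnd ℂ (γ z.1) * γ z.2 - 2⁻¹ * (starRingEnd ℂ (Complex.exp
      (((-2 * Real.pi * z.1 * w : ℝ) : ℂ) * Complex.I) * γ z.1) *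
      (Complex.exp (((-2 * Real.pi * z.2 * w : ℝ) : ℂ) * Complex.I) * γ z.2)) -
      2⁻¹ * (starRingEnd ℂ (Complex.exp
      (((-2 * Real.pi * z.1 * (-w) : ℝ) : ℂ) * Complex.I) * γ z.1) *
      (Complex.exp (((-2 * Real.pi * z.2 * (-w) : ℝ) : ℂ) * Complex.I) * γ z.2)) := by
    intro z
    have e : ∀ v : ℝ, starRingEnd ℂ (Complex.exp
      (((-2 * Real.pi * z.1 * v : ℝ) : ℂ) * Complex.I) * γ z.1) *
      (Complex.exp (((-2 * Real.pi * z.2 * v : ℝ) : ℂ) * Complex.I) * γ z.2)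
      = Complex.exp (((2 * Real.pi * v * (z.1 - z.2) : ℝ) : ℂ) * Complex.I) *
        (starRingEnd ℂ (γ z.1) * γ z.2) := by
      intro v
      rw [map_mul, ← Complex.exp_conj, map_mul, Complex.conj_ofReal, Complex.conj_I]
      have : Complex.exp (((2 * Real.pi * v * (z.1 - z.2) : ℝ) : ℂ) * Complex.I)
        = Complex.exp (((-2 * Real.pi * z.1 * v : ℝ) : ℂ) * -Complex.I) *
          Complex.exp (((-2 * Real.pi * z.2 * v : ℝ) : ℂ) * Complex.I) := by
        rw [← Complex.exp_add]
        congr 1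
        push_cast
        ring
      rw [this]
      ring
    rw [e, e]
    have h2 : 2 * Real.pi * -w * (z.1 - z.2) = -(2 * Real.pi * w * (z.1 - z.2)) := by ring
    rw [h2]
    push_cast
    rw [Complex.cos]
    ring_nf
  have hlin : ∀ A B C : ℝ × ℝ → ℂ, Integrable A → Integrable B → Integrable C →
      ∫ z, (A z - 2⁻¹ * B z - 2⁻¹ * C z) =
        (∫ z, A z) - 2⁻¹ * (∫ z, B z) - 2⁻¹ * ∫ z, C z := by
    intro A B C hA hB hC
    have h3 := integral_sub (hA.sub (hB.const_mul 2⁻¹)) (hC.const_mul 2⁻¹)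
    have h4 := integral_sub hA (hB.const_mul 2⁻¹)
    simp only [Pi.sub_apply, integral_const_mul] at h3 h4
    rw [h3, h4]
  simp_rw [key]
  rw [hlin _ _ _ hI1 (hI w) (hI (-w)), hF, hF, h1]
  push_cast
  ring

theorem integrable_mulCoth_kernel
    (hw : Integrable (fun s => ((1 + |s| : ℝ) : ℂ) * γ s)) (hγ : Integrable γ) :
    Integrable (fun z : ℝ × ℝ => ((mulCoth (z.1 - z.2) : ℝ) : ℂ) *
      (starRingEnd ℂ (γ z.1) * γ z.2)) := by
  have hconj : Integrable (fun s => starRingEnd ℂ (γ s)) :=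
    Complex.conjCLE.toContinuousLinearMap.integrable_comp hγ
  have hI1 : Integrable (fun z : ℝ × ℝ => starRingEnd ℂ (γ z.1) * γ z.2) := hconj.mul_prod hγ
  have hc := measurable_mulCoth
  refine (hw.norm.mul_prod hw.norm).mono' ?_ (Eventually.of_forall fun z => ?_)
  · refine AEStronglyMeasurable.mul ?_ hI1.1
    apply Measurable.aestronglyMeasurable
    fun_prop
  · simp only [norm_mul, Complex.norm_real, RCLike.norm_conj]
    rw [Real.norm_of_nonneg (mulCoth_nonneg _), Real.norm_of_nonneg (by positivity),
      Real.norm_of_nonneg (by positivity)]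
    calc _ ≤ ((1 + |z.1|) * (1 + |z.2|)) * (‖γ z.1‖ * ‖γ z.2‖) := by
          gcongr; exact mulCoth_sub_le _ _
      _ = _ := by ring

/-- The licence for Fubini. The density alone is not integrable at 0, but integrating (1 − cos)ρ in
w first gives exactly z coth z − 1 off the diagonal, which the first moments of γ control. -/
theorem integrable_resolventDensity_triple
    (hw : Integrable (fun s => ((1 + |s| : ℝ) : ℂ) * γ s)) (hγ : Integrable γ) :
    Integrable (fun p : (ℝ × ℝ) × ℝ =>
      (((1 - Real.cos (2 * Real.pi * p.2 * (p.1.1 - p.1.2))) * resolventDensity p.2 : ℝ) : ℂ) *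
      (starRingEnd ℂ (γ p.1.1) * γ p.1.2)) := by
  have hconj : Integrable (fun s => starRingEnd ℂ (γ s)) :=
    Complex.conjCLE.toContinuousLinearMap.integrable_comp hγ
  have hI1 : Integrable (fun z : ℝ × ℝ => starRingEnd ℂ (γ z.1) * γ z.2) := hconj.mul_prod hγ
  have hm := measurable_resolventDensity
  have hmeas : AEStronglyMeasurable (fun p : (ℝ × ℝ) × ℝ =>
      (((1 - Real.cos (2 * Real.pi * p.2 * (p.1.1 - p.1.2))) * resolventDensity p.2 : ℝ) : ℂ) *
      (starRingEnd ℂ (γ p.1.1) * γ p.1.2)) (volume.prod volume) := by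
    refine AEStronglyMeasurable.mul ?_ (hI1.1.comp_fst)
    apply Measurable.aestronglyMeasurable
    fun_prop
  rw [Measure.volume_eq_prod, integrable_prod_iff hmeas]
  constructor
  · filter_upwards [ae_ne_prod] with z hz
    exact ((integrable_one_sub_cos_mul_resolventDensity hz).ofReal (𝕜 := ℂ)).mul_const _
  · have hk := integrable_mulCoth_kernel hw hγ
    refine ((hk.norm.sub hI1.norm)).congr ?_
    filter_upwards [ae_ne_prod] with z hz
    simp only [Pi.sub_apply, norm_mul, Complex.norm_real]
    rw [integral_mul_const]
    have e : ∫ w, ‖1 - Real.cos (2 * Real.pi * w * (z.1 - z.2))‖ * ‖resolventDensity w‖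
        = mulCoth (z.1 - z.2) - 1 := by
      rw [← integral_one_sub_cos_mul_resolventDensity hz]
      congr 1
      ext w
      rw [Real.norm_of_nonneg (resolventDensity_nonneg w), Real.norm_of_nonneg (by
        linarith [Real.cos_le_one (2 * Real.pi * w * (z.1 - z.2))])]
    rw [e, Real.norm_of_nonneg (mulCoth_nonneg _)]
    ring

/-- Integrate the triple integral in both orders. Integrating in w first gives the kernel z coth z −
1, whose constant part drops out because ∫ γ = 0; integrating over the plane first gives −ρ|γ̂|²,
symmetrized in w. -/
theorem mulCoth_form_eq (hw : Integrable (fun s => ((1 + |s| : ℝ) : ℂ) * γ s))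
    (hγ : Integrable γ) (h0 : ∫ s, γ s = 0) :
    Integrable (fun w => resolventDensity w * ‖𝓕 γ w‖ ^ 2) ∧
    ∫ z : ℝ × ℝ, ((mulCoth (z.1 - z.2) : ℝ) : ℂ) * (starRingEnd ℂ (γ z.1) * γ z.2)
      = -((∫ w, resolventDensity w * ‖𝓕 γ w‖ ^ 2 : ℝ) : ℂ) := by
  have hconj : Integrable (fun s => starRingEnd ℂ (γ s)) :=
    Complex.conjCLE.toContinuousLinearMap.integrable_comp hγ
  have hI1 : Integrable (fun z : ℝ × ℝ => starRingEnd ℂ (γ z.1) * γ z.2) := hconj.mul_prod hγ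
  have hT := integrable_resolventDensity_triple hw hγ
  have hm := measurable_resolventDensity
  have hin : ∀ w : ℝ, ∫ z : ℝ × ℝ,
      (((1 - Real.cos (2 * Real.pi * w * (z.1 - z.2))) * resolventDensity w : ℝ) : ℂ) *
      (starRingEnd ℂ (γ z.1) * γ z.2)
      = ((-(resolventDensity w * ((‖𝓕 γ w‖ ^ 2 + ‖𝓕 γ (-w)‖ ^ 2) / 2)) : ℝ) : ℂ) := by
    intro w
    have e : ∀ z : ℝ × ℝ,
        (((1 - Real.cos (2 * Real.pi * w * (z.1 - z.2))) * resolventDensity w : ℝ) : ℂ) *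
        (starRingEnd ℂ (γ z.1) * γ z.2) = (resolventDensity w : ℂ) *
        (((1 - Real.cos (2 * Real.pi * w * (z.1 - z.2)) : ℝ) : ℂ) *
        (starRingEnd ℂ (γ z.1) * γ z.2)) := fun z => by push_cast; ring
    simp_rw [e]
    rw [integral_const_mul, integral_one_sub_cos_mul_conj_mul hγ h0]
    push_cast
    ring
  have hcont : Continuous (𝓕 γ) :=
    VectorFourier.fourierIntegral_continuous Real.continuous_fourierChar
      (by exact (innerSL ℝ).continuous₂) hγ
  have hint2 : Integrable (fun w => resolventDensity w *
      ((‖𝓕 γ w‖ ^ 2 + ‖𝓕 γ (-w)‖ ^ 2) / 2)) := by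
    have h := hT.integral_prod_right
    simp only [hin] at h
    have := h.re.neg
    refine this.congr (Eventually.of_forall fun w => ?_)
    simp only [Pi.neg_apply, RCLike.re_to_complex, Complex.ofReal_re, neg_neg]
  have hint : Integrable (fun w => resolventDensity w * ‖𝓕 γ w‖ ^ 2) := by
    -- Fubini gives integrability only of the average over ±w; twice that average dominates the
    -- single term.
    refine (hint2.const_mul 2).mono' ?_ (Eventually.of_forall fun w => ?_)
    · have := hcont.measurable
      fun_prop
    · have := resolventDensity_nonneg w
      rw [Real.norm_of_nonneg (by positivity)]
      nlinarith [mul_nonneg this (sq_nonneg ‖𝓕 γ (-w)‖)]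
  refine ⟨hint, ?_⟩
  have hneg : Integrable (fun w => resolventDensity w * ‖𝓕 γ (-w)‖ ^ 2) := by
    have := hint.comp_neg
    simpa only [resolventDensity_neg] using this
  have hneg' : ∫ w, resolventDensity w * ‖𝓕 γ (-w)‖ ^ 2
      = ∫ w, resolventDensity w * ‖𝓕 γ w‖ ^ 2 := by
    rw [← integral_neg_eq_self]
    simp only [resolventDensity_neg, neg_neg]
  have hsum : ∫ w, resolventDensity w * ((‖𝓕 γ w‖ ^ 2 + ‖𝓕 γ (-w)‖ ^ 2) / 2)
      = ∫ w, resolventDensity w * ‖𝓕 γ w‖ ^ 2 := by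
    have e : ∀ w, resolventDensity w * ((‖𝓕 γ w‖ ^ 2 + ‖𝓕 γ (-w)‖ ^ 2) / 2)
        = 2⁻¹ * (resolventDensity w * ‖𝓕 γ w‖ ^ 2 + resolventDensity w * ‖𝓕 γ (-w)‖ ^ 2) :=
      fun w => by ring
    simp_rw [e]
    rw [integral_const_mul, integral_add hint hneg, hneg']
    ring
  have hswap := integral_integral_swap (f := fun (z : ℝ × ℝ) (w : ℝ) =>
      (((1 - Real.cos (2 * Real.pi * w * (z.1 - z.2))) * resolventDensity w : ℝ) : ℂ) *
      (starRingEnd ℂ (γ z.1) * γ z.2)) hT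
  simp only [hin] at hswap
  have hre : ∫ w, ((-(resolventDensity w * ((‖𝓕 γ w‖ ^ 2 + ‖𝓕 γ (-w)‖ ^ 2) / 2)) : ℝ) : ℂ)
      = ((-∫ w, resolventDensity w * ‖𝓕 γ w‖ ^ 2 : ℝ) : ℂ) := by
    rw [← hsum, ← integral_neg]
    exact integral_ofReal
  rw [hre] at hswap
  have hl : ∫ z : ℝ × ℝ, ∫ w : ℝ,
      (((1 - Real.cos (2 * Real.pi * w * (z.1 - z.2))) * resolventDensity w : ℝ) : ℂ) *
      (starRingEnd ℂ (γ z.1) * γ z.2)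
      = ∫ z : ℝ × ℝ, (((mulCoth (z.1 - z.2) : ℝ) : ℂ) * (starRingEnd ℂ (γ z.1) * γ z.2)
        - starRingEnd ℂ (γ z.1) * γ z.2) := by
    apply integral_congr_ae
    filter_upwards [ae_ne_prod] with z hz
    rw [integral_mul_const, integral_complex_ofReal, integral_one_sub_cos_mul_resolventDensity hz]
    push_cast
    ring
  have h1 : ∫ z : ℝ × ℝ, starRingEnd ℂ (γ z.1) * γ z.2 = 0 := by
    rw [Measure.volume_eq_prod, integral_prod_mul (fun s => starRingEnd ℂ (γ s)), h0, mul_zero]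
  rw [integral_sub (integrable_mulCoth_kernel hw hγ) hI1, h1, sub_zero] at hl
  rw [← hl, hswap, Complex.ofReal_neg]

end FourierSide

section CarlemanGap

theorem sq_integral_mul_le {X : Type*} [MeasurableSpace X] {μ : Measure X} {f g : X → ℝ}
    (hf : MemLp f 2 μ) (hg : MemLp g 2 μ) (hf0 : 0 ≤ᵐ[μ] f) (hg0 : 0 ≤ᵐ[μ] g) :
    (∫ x, f x * g x ∂μ) ^ 2 ≤ (∫ x, f x ^ 2 ∂μ) * ∫ x, g x ^ 2 ∂μ := by
  have h := integral_mul_le_Lp_mul_Lq_of_nonneg (μ := μ) Real.HolderConjugate.two_two hf0 hg0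
    (by simpa using hf) (by simpa using hg)
  have hn : 0 ≤ ∫ x, f x * g x ∂μ := by
    apply integral_nonneg_of_ae
    filter_upwards [hf0, hg0] with x h1 h2
    exact mul_nonneg h1 h2
  simp only [Real.rpow_two] at h
  rw [← Real.sqrt_eq_rpow, ← Real.sqrt_eq_rpow] at h
  calc _ ≤ (√(∫ x, f x ^ 2 ∂μ) * √(∫ x, g x ^ 2 ∂μ)) ^ 2 := pow_le_pow_left₀ hn h 2
    _ = _ := by
      rw [mul_pow, Real.sq_sqrt (integral_nonneg fun x => sq_nonneg _),
        Real.sq_sqrt (integral_nonneg fun x => sq_nonneg _)]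

/-! ### The Carleman operator as a quadratic form -/

variable {α : ℝ}

theorem norm_carleman_le : ‖carleman‖ ≤ Real.pi :=
  LinearMap.mkContinuous_norm_le _ Real.pi_pos.le _

theorem re_inner_carleman_le (f : L2) :
    (⟪f, carleman f⟫_ℂ).re ≤ Real.pi * ‖f‖ ^ 2 := by
  calc _ ≤ ‖⟪f, carleman f⟫_ℂ‖ := Complex.re_le_norm _
    _ ≤ ‖f‖ * ‖carleman f‖ := norm_inner_le_norm _ _
    _ ≤ ‖f‖ * (Real.pi * ‖f‖) := by
      gcongr
      exact (carleman.le_opNorm f).trans (by gcongr; exact norm_carleman_le)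
    _ = _ := by ring

theorem inner_carleman_left (f g : L2) : ⟪carleman f, g⟫_ℂ = ⟪f, carleman g⟫_ℂ := by
  -- Any exponent above 3/2 would serve; it only has to supply a dense set of functions integrable
  -- on the line.
  have hD := denseRange_weightOp (by norm_num : (0 : ℝ) ≤ 2)
  refine hD.induction_on₂ (p := fun f g => ⟪carleman f, g⟫_ℂ = ⟪f, carleman g⟫_ℂ) ?_ ?_ f g
  · apply isClosed_eq <;> fun_prop
  · intro x y
    have hx := integrable_lineFun_weightOp (by norm_num : (3 / 2 : ℝ) < 2) x
    have hy := integrable_lineFun_weightOp (by norm_num : (3 / 2 : ℝ) < 2) y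
    rw [inner_carleman_eq hx hy, ← inner_conj_symm, inner_carleman_eq hy hx, ← integral_conj]
    congr 1
    ext w
    simp only [map_mul, Complex.conj_ofReal, Complex.conj_conj]
    ring

/-- The symbol of `π - C`. -/
def gapSymbol (w : ℝ) : ℝ := Real.pi - carlemanSymbol w

theorem gapSymbol_pos {w : ℝ} (hw : w ≠ 0) : 0 < gapSymbol w := by
  have hc : 1 < Real.cosh (2 * Real.pi ^ 2 * w) :=
    Real.one_lt_cosh.2 (by have := Real.pi_pos; positivity)
  rw [gapSymbol, carlemanSymbol, sub_pos, div_lt_iff₀ (by linarith)]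
  nlinarith [Real.pi_pos]

theorem gapSymbol_nonneg (w : ℝ) : 0 ≤ gapSymbol w := by
  by_cases hw : w = 0
  · simp [hw, gapSymbol, carlemanSymbol]
  · exact (gapSymbol_pos hw).le

theorem measurable_gapSymbol : Measurable gapSymbol := by
  unfold gapSymbol carlemanSymbol; fun_prop

theorem gapSymbol_le_pi (w : ℝ) : gapSymbol w ≤ Real.pi := by
  have : 0 ≤ carlemanSymbol w := by
    have := Real.cosh_pos (2 * Real.pi ^ 2 * w)
    have := Real.pi_pos
    unfold carlemanSymbol
    positivity
  unfold gapSymbol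
  linarith

/-- From cosh 2x = 1 + 2 sinh² x at x = π²w. The constant π⁻¹ later produces the ‖V‖₂ term of the
bound, and the singular rest produces the γ_α term. -/
theorem gapSymbol_inv {w : ℝ} (hw : w ≠ 0) :
    (gapSymbol w)⁻¹ = Real.pi⁻¹ + (Real.pi ^ 3)⁻¹ * resolventDensity w := by
  have hpi := Real.pi_pos
  have hs : Real.sinh (Real.pi ^ 2 * w) ≠ 0 := Real.sinh_ne_zero.2 (by positivity)
  have hc : Real.cosh (2 * Real.pi ^ 2 * w) = 1 + 2 * Real.sinh (Real.pi ^ 2 * w) ^ 2 := by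
    rw [mul_assoc, Real.cosh_two_mul, Real.cosh_sq]
    ring
  have h0 : 1 + 2 * Real.sinh (Real.pi ^ 2 * w) ^ 2 ≠ 0 := by positivity
  have e : gapSymbol w = 2 * Real.pi * Real.sinh (Real.pi ^ 2 * w) ^ 2 /
      (1 + 2 * Real.sinh (Real.pi ^ 2 * w) ^ 2) := by
    rw [gapSymbol, carlemanSymbol, hc]
    field_simp
    ring
  rw [e, resolventDensity]
  field_simp
  ring

theorem integrable_gapSymbol_mul {f : L2} (hf : Integrable (lineFun f)) :
    Integrable (fun w => gapSymbol w * ‖mellinFourier f w‖ ^ 2) := by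
  have hm := measurable_gapSymbol
  have h := (memLp_two_iff_integrable_sq_norm (memLp_mellinFourier hf).1).1
    (memLp_mellinFourier hf)
  refine h.bdd_mul (c := Real.pi) (by fun_prop) (Eventually.of_forall fun w => ?_)
  rw [Real.norm_of_nonneg (gapSymbol_nonneg w)]
  exact gapSymbol_le_pi w

theorem norm_sq_eq_integral {f : L2} (hf : Integrable (lineFun f)) :
    ‖f‖ ^ 2 = ∫ w, ‖mellinFourier f w‖ ^ 2 := by
  have h := inner_eq_integral_mellinFourier hf hf
  simp only [Complex.conj_mul'] at h
  have h2 : ∫ w, ((‖mellinFourier f w‖ : ℂ)) ^ 2 = ((∫ w, ‖mellinFourier f w‖ ^ 2 : ℝ) : ℂ) := by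
    rw [← integral_complex_ofReal]
    push_cast
    rfl
  rw [← inner_self_eq_norm_sq (𝕜 := ℂ) f, h, h2]
  rfl

theorem pi_mul_norm_sq_sub_inner_carleman {f : L2} (hf : Integrable (lineFun f)) :
    Real.pi * ‖f‖ ^ 2 - (⟪f, carleman f⟫_ℂ).re =
      ∫ w, gapSymbol w * ‖mellinFourier f w‖ ^ 2 := by
  have h := inner_carleman_eq hf hf
  simp only [Complex.conj_mul'] at h
  have h2 : ∫ w, (carlemanSymbol w : ℂ) * (‖mellinFourier f w‖ : ℂ) ^ 2
      = ((∫ w, carlemanSymbol w * ‖mellinFourier f w‖ ^ 2 : ℝ) : ℂ) := by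
    rw [← integral_complex_ofReal]
    push_cast
    rfl
  rw [h2] at h
  have hsq := (memLp_two_iff_integrable_sq_norm (memLp_mellinFourier hf).1).1
    (memLp_mellinFourier hf)
  have h3 := (hsq.const_mul Real.pi).sub (integrable_gapSymbol_mul hf)
  have e : ∀ w, carlemanSymbol w * ‖mellinFourier f w‖ ^ 2 =
      Real.pi * ‖mellinFourier f w‖ ^ 2 - gapSymbol w * ‖mellinFourier f w‖ ^ 2 := fun w => by
    unfold gapSymbol; ring
  have h4 : ∫ w, carlemanSymbol w * ‖mellinFourier f w‖ ^ 2 =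
      Real.pi * ‖f‖ ^ 2 - ∫ w, gapSymbol w * ‖mellinFourier f w‖ ^ 2 := by
    simp_rw [e]
    rw [integral_sub (hsq.const_mul _) (integrable_gapSymbol_mul hf), integral_const_mul,
      norm_sq_eq_integral hf]
  rw [h, Complex.ofReal_re, h4]
  ring

/-- The quadratic form of `Q^{-α} R Q^{-α}`. -/
def resolventForm (α : ℝ) (x : L2) : ℂ :=
  ∫ z, (resolventKernel α z : ℂ) * (starRingEnd ℂ (x z.1) * x z.2) ∂(halfLine.prod halfLine)

theorem resolventForm_eq (hα : 0 ≤ α) (x : L2) :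
    resolventForm α x = -((Real.pi ^ 3)⁻¹ : ℝ) * ∫ z : ℝ × ℝ, ((mulCoth (z.1 - z.2) : ℝ) : ℂ) *
      (starRingEnd ℂ (lineFun (weightOp hα x) z.1) * lineFun (weightOp hα x) z.2) := by
  rw [resolventForm, integral_halfLine_prod, ← integral_const_mul]
  have h := lineFun_weightOp hα x
  have h1 := (Measure.quasiMeasurePreserving_fst (μ := (volume : Measure ℝ))
    (ν := (volume : Measure ℝ))).ae_eq_comp h
  have h2 := (Measure.quasiMeasurePreserving_snd (μ := (volume : Measure ℝ))
    (ν := (volume : Measure ℝ))).ae_eq_comp h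
  rw [← Measure.volume_eq_prod] at h1 h2
  apply integral_congr_ae
  filter_upwards [h1, h2] with z h1 h2
  simp only [Function.comp_apply] at h1 h2
  rw [h1, h2]
  have hk := congrArg (fun r : ℝ => (r : ℂ)) (resolventKernel_exp α z.1 z.2)
  rw [map_mul, Complex.conj_ofReal, Complex.ofReal_mul (Real.exp z.1), ofReal_exp_eq z.1,
    ofReal_exp_eq z.2]
  simp only [lineFun, map_mul, Complex.conj_ofReal]
  push_cast at hk ⊢
  linear_combination (Complex.exp (z.1 / 2) * Complex.exp (z.2 / 2) *
    (starRingEnd ℂ (x (Real.exp z.1)) * x (Real.exp z.2))) * hk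

theorem resolventForm_eq_integral (hα : 3 / 2 < α) {x : L2}
    (hx : ⟪weightedPsi α (by linarith), x⟫_ℂ = 0) :
    Integrable (fun w => resolventDensity w *
      ‖mellinFourier (weightOp (by linarith : 0 ≤ α) x) w‖ ^ 2) ∧
    (resolventForm α x).re = (Real.pi ^ 3)⁻¹ * ∫ w, resolventDensity w *
      ‖mellinFourier (weightOp (by linarith : 0 ≤ α) x) w‖ ^ 2 := by
  rw [inner_weightedPsi hα] at hx
  have h := mulCoth_form_eq (integrable_one_add_abs_mul_lineFun_weightOp hα x)
    (integrable_lineFun_weightOp hα x) hx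
  refine ⟨h.1, ?_⟩
  rw [resolventForm_eq (by linarith), h.2, neg_mul_neg, ← Complex.ofReal_mul, Complex.ofReal_re]
  rfl

/-- The basic estimate: Cauchy-Schwarz for the form of `π - C` and its inverse. -/
theorem norm_inner_weightOp_sq_le (hα : 3 / 2 < α) {x : L2}
    (hx : ⟪weightedPsi α (by linarith), x⟫_ℂ = 0) (f : L2) :
    ‖⟪f, weightOp (by linarith : 0 ≤ α) x⟫_ℂ‖ ^ 2 ≤
      (Real.pi * ‖f‖ ^ 2 - (⟪f, carleman f⟫_ℂ).re) *
      (Real.pi⁻¹ * ‖weightOp (by linarith : 0 ≤ α) x‖ ^ 2 + (resolventForm α x).re) := by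
  have hα0 : 0 ≤ α := by linarith
  set u := weightOp hα0 x with hu
  have hui : Integrable (lineFun u) := integrable_lineFun_weightOp hα x
  obtain ⟨hki, hke⟩ := resolventForm_eq_integral hα hx
  -- Both sides are continuous in f, so f may be taken in the range of Q^{-α}, where the Fourier
  -- formulas apply.
  refine (denseRange_weightOp hα0).induction_on (p := fun f => ‖⟪f, u⟫_ℂ‖ ^ 2 ≤
      (Real.pi * ‖f‖ ^ 2 - (⟪f, carleman f⟫_ℂ).re) *
      (Real.pi⁻¹ * ‖u‖ ^ 2 + (resolventForm α x).re)) f ?_ ?_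
  · apply isClosed_le
    · fun_prop
    · have : Continuous fun f : L2 => (⟪f, carleman f⟫_ℂ).re :=
        Complex.continuous_re.comp (by fun_prop)
      fun_prop
  intro y
  set f := weightOp hα0 y with hf
  have hfi : Integrable (lineFun f) := integrable_lineFun_weightOp hα y
  have hw0 : ∀ᵐ w : ℝ, w ≠ 0 := by simp [ae_iff]
  have husq := (memLp_two_iff_integrable_sq_norm (memLp_mellinFourier hui).1).1
    (memLp_mellinFourier hui)
  have hinv : (fun w => (gapSymbol w)⁻¹ * ‖mellinFourier u w‖ ^ 2) =ᵐ[volume]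
      fun w => Real.pi⁻¹ * ‖mellinFourier u w‖ ^ 2 + (Real.pi ^ 3)⁻¹ *
        (resolventDensity w * ‖mellinFourier u w‖ ^ 2) := by
    filter_upwards [hw0] with w hw
    rw [gapSymbol_inv hw]
    ring
  have hinvi : Integrable (fun w => (gapSymbol w)⁻¹ * ‖mellinFourier u w‖ ^ 2) :=
    ((husq.const_mul _).add (hki.const_mul _)).congr hinv.symm
  have hinve : ∫ w, (gapSymbol w)⁻¹ * ‖mellinFourier u w‖ ^ 2
      = Real.pi⁻¹ * ‖u‖ ^ 2 + (resolventForm α x).re := by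
    rw [integral_congr_ae hinv, integral_add (husq.const_mul _) (hki.const_mul _),
      integral_const_mul, integral_const_mul, ← norm_sq_eq_integral hui, hke]
  rw [pi_mul_norm_sq_sub_inner_carleman hfi, ← hinve, inner_eq_integral_mellinFourier hfi hui]
  have hm := measurable_gapSymbol
  have hmf := (continuous_mellinFourier hfi).measurable
  have hmu := (continuous_mellinFourier hui).measurable
  have e1 : ∀ w, (√(gapSymbol w) * ‖mellinFourier f w‖) ^ 2 =
      gapSymbol w * ‖mellinFourier f w‖ ^ 2 := fun w => by
    rw [mul_pow, Real.sq_sqrt (gapSymbol_nonneg w)]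
  have e2 : ∀ w, (√((gapSymbol w)⁻¹) * ‖mellinFourier u w‖) ^ 2 =
      (gapSymbol w)⁻¹ * ‖mellinFourier u w‖ ^ 2 := fun w => by
    rw [mul_pow, Real.sq_sqrt (inv_nonneg.2 (gapSymbol_nonneg w))]
  -- The product of the two transforms is split by the factors √gap and 1/√gap, which are mutually
  -- inverse away from w = 0.
  have hcs := sq_integral_mul_le (μ := (volume : Measure ℝ))
    (f := fun w => √(gapSymbol w) * ‖mellinFourier f w‖)
    (g := fun w => √((gapSymbol w)⁻¹) * ‖mellinFourier u w‖)
    ((memLp_two_iff_integrable_sq (by fun_prop)).2 (by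
      simp only [e1]; exact integrable_gapSymbol_mul hfi))
    ((memLp_two_iff_integrable_sq (by fun_prop)).2 (by simp only [e2]; exact hinvi))
    (Eventually.of_forall fun w => by positivity) (Eventually.of_forall fun w => by positivity)
  simp only [e1, e2] at hcs
  refine le_trans (pow_le_pow_left₀ (norm_nonneg _) ?_ 2) hcs
  refine (norm_integral_le_integral_norm _).trans (le_of_eq ?_)
  apply integral_congr_ae
  filter_upwards [hw0] with w hw
  have hs := Real.sqrt_pos.2 (gapSymbol_pos hw)
  rw [norm_mul, RCLike.norm_conj, Real.sqrt_inv]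
  field_simp

end CarlemanGap

section Hilbert

variable {E : Type*} [NormedAddCommGroup E] [InnerProductSpace ℂ E]

/-! ### Counting eigenvalues by orthonormal families -/

theorem exists_orthonormal_of_le_rank (U : Submodule ℂ E) {n : ℕ} (h : (n : Cardinal) ≤ Module.rank ℂ U) :
    ∃ v : Fin n → U, Orthonormal ℂ v := by
  obtain ⟨v, hv⟩ := Module.le_rank_iff.1 h
  have hf : Module.finrank ℂ (Submodule.span ℂ (range v)) = n := by
    rw [finrank_span_eq_card hv, Fintype.card_fin]
  have : FiniteDimensional ℂ (Submodule.span ℂ (range v)) :=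
    FiniteDimensional.span_of_finite ℂ (finite_range v)
  let b := (stdOrthonormalBasis ℂ (Submodule.span ℂ (range v))).reindex (finCongr hf)
  exact ⟨fun i => (b i : U), b.orthonormal.comp_linearIsometry (Submodule.subtypeₗᵢ _)⟩

/-- An infinite-dimensional eigenspace would contain orthonormal families of every size, so
multiplicities are finite. Eigenspaces of a symmetric operator are mutually orthogonal, so bases of
finitely many of them join into one orthonormal family, whose size bounds the partial sum. -/
theorem eigenvalueCountAbove_le [CompleteSpace E] {H : E →L[ℂ] E} {c R : ℝ}
    (hH : (H : E →ₗ[ℂ] E).IsSymmetric)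
    (hcount : ∀ {ι : Type} [Fintype ι] (e : ι → E) (μ : ι → ℝ), Orthonormal ℂ e →
      (∀ i, c < μ i) → (∀ i, H (e i) = (μ i : ℂ) • e i) → (Fintype.card ι : ℝ) ≤ R) :
    eigenvalueCountAbove H c ≤ ENNReal.ofReal R := by
  set U : ℝ → Submodule ℂ E := fun μ => Module.End.eigenspace (H : E →ₗ[ℂ] E) (μ : ℂ) with hU
  have heig : ∀ (μ : ℝ) (x : U μ), H x = (μ : ℂ) • (x : E) := fun μ x =>
    Module.End.mem_eigenspace_iff.1 x.2
  have hfin : ∀ μ : ℝ, c < μ → Module.rank ℂ (U μ) < Cardinal.aleph0 := by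
    intro μ hμ
    by_contra hcon
    rw [not_lt] at hcon
    obtain ⟨n, hn⟩ := exists_nat_gt R
    obtain ⟨v, hv⟩ := exists_orthonormal_of_le_rank (U μ) (Cardinal.natCast_le_aleph0.trans hcon)
      (n := n)
    have := hcount (fun i => (v i : E)) (fun _ => μ)
      (hv.comp_linearIsometry (Submodule.subtypeₗᵢ _)) (fun _ => hμ) (fun i => heig μ (v i))
    rw [Fintype.card_fin] at this
    linarith
  rw [eigenvalueCountAbove, ENNReal.tsum_eq_iSup_sum]
  refine iSup_le fun S => ?_
  have hn : ∀ μ : S, (Module.finrank ℂ (U μ) : Cardinal) ≤ Module.rank ℂ (U μ) := fun μ => by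
    have := Module.rank_lt_aleph0_iff.1 (hfin μ μ.1.2)
    rw [Module.finrank_eq_rank]
  choose v hv using fun μ : S => exists_orthonormal_of_le_rank (U μ) (hn μ)
  have hof : OrthogonalFamily ℂ (fun μ : S => U (μ : Ioi c)) fun μ => (U (μ : Ioi c)).subtypeₗᵢ :=
    hH.orthogonalFamily_eigenspaces.comp (f := fun μ : S => (((μ : Ioi c) : ℝ) : ℂ))
      (Complex.ofReal_injective.comp (Subtype.val_injective.comp Subtype.val_injective))
  have hon := hof.orthonormal_sigma_orthonormal hv
  have h := hcount _ (fun a : Σ μ : S, Fin (Module.finrank ℂ (U (μ : Ioi c))) =>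
    ((a.1 : Ioi c) : ℝ)) hon (fun a => a.1.1.2) (fun a => heig _ _)
  rw [Fintype.card_sigma] at h
  simp only [Fintype.card_fin] at h
  rw [← Finset.sum_coe_sort]
  have e : ∀ μ : S, ((Cardinal.toENat (Module.rank ℂ (U (μ : Ioi c))) : ℕ∞) : ℝ≥0∞)
      = ((Module.finrank ℂ (U (μ : Ioi c)) : ℕ) : ℝ≥0∞) := by
    intro μ
    have := Module.rank_lt_aleph0_iff.1 (hfin μ μ.1.2)
    rw [← Module.finrank_eq_rank, Cardinal.toENat_nat, ENat.toENNReal_coe]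
  rw [Finset.sum_congr rfl fun μ _ => e μ, ← Nat.cast_sum, ← ENNReal.ofReal_natCast]
  exact ENNReal.ofReal_le_ofReal h

/-! ### Positive operators and Hilbert-Schmidt norms -/

theorem exists_isPositive_sqrt [CompleteSpace E] {T : E →L[ℂ] E} (hT : T.IsPositive) :
    ∃ S : E →L[ℂ] E, S.IsPositive ∧ ∀ x, S (S x) = T x := by
  have h0 : 0 ≤ T := (ContinuousLinearMap.nonneg_iff_isPositive T).2 hT
  refine ⟨CFC.sqrt T, (ContinuousLinearMap.nonneg_iff_isPositive _).1 (CFC.sqrt_nonneg T), ?_⟩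
  intro x
  exact congrArg (fun A : E →L[ℂ] E => A x) (CFC.sqrt_mul_sqrt_self T h0)

/-- Bessel's inequality for the vectors T* bⱼ, summed over a Hilbert basis (bⱼ). -/
theorem sum_norm_sq_apply_le_hsNorm_sq [CompleteSpace E] {T : E →L[ℂ] E}
    (hT : IsHilbertSchmidt T) {ι : Type*} [Fintype ι] {g : ι → E} (hg : Orthonormal ℂ g) :
    ∑ i, ‖T (g i)‖ ^ 2 ≤ hsNorm T ^ 2 := by
  obtain ⟨w, b, -⟩ := exists_hilbertBasis ℂ E
  have h1 : ∑ i, ‖T (g i)‖ₑ ^ 2 ≤ hsNormSq T := by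
    rw [hsNormSq_eq_tsum b, tsum_enorm_sq_adjoint b b]
    simp only [← tsum_enorm_inner_sq b (T _)]
    rw [← Summable.tsum_finsetSum fun _ _ => ENNReal.summable]
    refine ENNReal.tsum_le_tsum fun j => ?_
    have h2 := hg.sum_inner_products_le (ContinuousLinearMap.adjoint T (b j)) (s := Finset.univ)
    have h3 : ∑ i, ‖⟪b j, T (g i)⟫_ℂ‖ ^ 2 ≤ ‖ContinuousLinearMap.adjoint T (b j)‖ ^ 2 := by
      refine le_trans (le_of_eq (Finset.sum_congr rfl fun i _ => ?_)) h2
      rw [ContinuousLinearMap.adjoint_inner_right, ← inner_conj_symm, RCLike.norm_conj]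
    have h4 := ENNReal.ofReal_le_ofReal h3
    rw [ENNReal.ofReal_sum_of_nonneg fun i _ => by positivity] at h4
    simpa only [ENNReal.ofReal_pow (norm_nonneg _), ofReal_norm] using h4
  rw [hsNorm, Real.sq_sqrt ENNReal.toReal_nonneg]
  have h5 := ENNReal.toReal_mono hT.ne h1
  rw [ENNReal.toReal_sum fun i _ => by simp] at h5
  simpa using h5

/-- A duality argument: with r the vector of real parts and G = ∑ rᵢPᵢ, one has ∑ rᵢ² = Re (κ, G) ≤
‖κ‖‖G‖, and Schur's test on the Gram matrix gives ‖G‖² ≤ M² ∑ rᵢ². -/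
theorem sum_sq_re_inner_le {ι : Type*} [Fintype ι] (κ : E) (P : ι → E) {M : ℝ}
    (hP : ∀ i, ∑ j, ‖⟪P i, P j⟫_ℂ‖ ≤ M ^ 2) :
    ∑ i, (⟪κ, P i⟫_ℂ).re ^ 2 ≤ (‖κ‖ * M) ^ 2 := by
  set r : ι → ℝ := fun i => (⟪κ, P i⟫_ℂ).re with hr
  set S := ∑ i, r i ^ 2 with hS
  set G : E := ∑ i, (r i : ℂ) • P i with hG
  have hS0 : 0 ≤ S := Finset.sum_nonneg fun i _ => sq_nonneg _
  have h1 : S = (⟪κ, G⟫_ℂ).re := by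
    rw [hG, inner_sum, Complex.re_sum]
    refine Finset.sum_congr rfl fun i _ => ?_
    rw [inner_smul_right, Complex.re_ofReal_mul, sq]
  have h2 : ‖G‖ ^ 2 ≤ M ^ 2 * S := by
    have e : ‖G‖ ^ 2 = ∑ i, ∑ j, r i * r j * (⟪P i, P j⟫_ℂ).re := by
      rw [← inner_self_eq_norm_sq (𝕜 := ℂ) G, hG, sum_inner]
      simp only [inner_sum, RCLike.re_to_complex, Complex.re_sum]
      refine Finset.sum_congr rfl fun i _ => Finset.sum_congr rfl fun j _ => ?_
      rw [inner_smul_left, inner_smul_right, Complex.conj_ofReal, Complex.re_ofReal_mul,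
        Complex.re_ofReal_mul, mul_assoc]
    have hsymm : ∀ i j, ‖⟪P i, P j⟫_ℂ‖ = ‖⟪P j, P i⟫_ℂ‖ := fun i j => norm_inner_symm _ _
    calc ‖G‖ ^ 2 = ∑ i, ∑ j, r i * r j * (⟪P i, P j⟫_ℂ).re := e
      _ ≤ ∑ i, ∑ j, (r i ^ 2 * ‖⟪P i, P j⟫_ℂ‖ / 2 + r j ^ 2 * ‖⟪P j, P i⟫_ℂ‖ / 2) := by
        refine Finset.sum_le_sum fun i _ => Finset.sum_le_sum fun j _ => ?_
        rw [hsymm j i]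
        have h3 : |r i * r j * (⟪P i, P j⟫_ℂ).re| ≤ |r i * r j| * ‖⟪P i, P j⟫_ℂ‖ := by
          rw [abs_mul]
          gcongr
          exact Complex.abs_re_le_norm _
        have h4 : |r i * r j| ≤ (r i ^ 2 + r j ^ 2) / 2 := by
          rw [abs_le]; constructor <;> nlinarith [sq_nonneg (r i + r j), sq_nonneg (r i - r j)]
        have h5 := mul_le_mul_of_nonneg_right h4 (norm_nonneg (⟪P i, P j⟫_ℂ))
        linarith [le_abs_self (r i * r j * (⟪P i, P j⟫_ℂ).re)]
      _ = ∑ i, r i ^ 2 * ∑ j, ‖⟪P i, P j⟫_ℂ‖ := by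
        simp only [Finset.sum_add_distrib]
        rw [Finset.sum_comm (f := fun i j => r j ^ 2 * ‖⟪P j, P i⟫_ℂ‖ / 2),
          ← Finset.sum_add_distrib]
        refine Finset.sum_congr rfl fun i _ => ?_
        rw [Finset.mul_sum, ← Finset.sum_add_distrib]
        refine Finset.sum_congr rfl fun j _ => ?_
        ring
      _ ≤ ∑ i, r i ^ 2 * M ^ 2 := by
        gcongr with i
        exact hP i
      _ = M ^ 2 * S := by rw [← Finset.sum_mul, mul_comm]
  have h3 : S ≤ ‖κ‖ * ‖G‖ := by
    rw [h1]
    exact (Complex.re_le_norm _).trans (norm_inner_le_norm _ _)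
  have h4 : S ^ 2 ≤ ‖κ‖ ^ 2 * (M ^ 2 * S) := by
    calc S ^ 2 ≤ (‖κ‖ * ‖G‖) ^ 2 := pow_le_pow_left₀ hS0 h3 2
      _ = ‖κ‖ ^ 2 * ‖G‖ ^ 2 := by ring
      _ ≤ _ := by gcongr
  by_cases hz : S = 0
  · rw [hz]; positivity
  · have : 0 < S := lt_of_le_of_ne hS0 (Ne.symm hz)
    nlinarith

end Hilbert

section CountingBound

variable {α : ℝ} {V K : L2 →L[ℂ] L2}

/-! ### Factorization through the weight -/

theorem weightOp_extension_weightOp (hα : 0 ≤ α) (hK : IsWeightedExtension α V K) (g : L2) :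
    weightOp hα (K (weightOp hα g)) = V g := by
  have hinv : ∀ t, ((logWeight t ^ (-α) : ℝ) : ℂ) * ((logWeight t ^ α : ℝ) : ℂ) = 1 := fun t => by
    rw [← Complex.ofReal_mul, ← Real.rpow_add (logWeight_pos t)]
    simp
  have h := hK (weightOp hα g) g (by
    filter_upwards [weightOp_apply hα g] with t ht
    rw [ht, ← mul_assoc, mul_comm ((logWeight t ^ α : ℝ) : ℂ), hinv, one_mul])
  apply Lp.ext
  filter_upwards [h, weightOp_apply hα (K (weightOp hα g))] with t h1 h2
  rw [h2, h1, ← mul_assoc, hinv, one_mul]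

open scoped ComplexOrder in
-- On the dense range of Q^{-α} the form of K is the form of V. Positivity gives K a square root.
theorem isPositive_extension (hα : 0 ≤ α) (hV : V.IsPositive) (hK : IsWeightedExtension α V K) :
    K.IsPositive := by
  rw [ContinuousLinearMap.isPositive_iff_complex]
  intro x
  have h : 0 ≤ ⟪K x, x⟫_ℂ := by
    refine (denseRange_weightOp hα).induction_on (p := fun x => 0 ≤ ⟪K x, x⟫_ℂ) x ?_ ?_
    · exact isClosed_le continuous_const (by fun_prop)
    · intro g
      rw [← inner_weightOp_left, weightOp_extension_weightOp hα hK]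
      exact hV.inner_nonneg_left g
  obtain ⟨h1, h2⟩ := Complex.nonneg_iff.1 h
  exact ⟨Complex.ext (by simp) (by simpa using h2), h1⟩

/-! ### The tensor products `conj x ⊗ x` -/

theorem memLp_conj_mul (x : L2) :
    MemLp (fun z : ℝ × ℝ => starRingEnd ℂ (x z.1) * x z.2) 2 (halfLine.prod halfLine) := by
  have hx := Lp.aestronglyMeasurable x
  have hm : AEStronglyMeasurable (fun z : ℝ × ℝ => starRingEnd ℂ (x z.1) * x z.2)
      (halfLine.prod halfLine) :=
    (Complex.continuous_conj.comp_aestronglyMeasurable hx).comp_fst.mul hx.comp_snd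
  rw [memLp_two_iff_integrable_sq_norm hm]
  have h := (memLp_two_iff_integrable_sq_norm hx).1 (Lp.memLp x)
  refine (h.mul_prod h).congr (Eventually.of_forall fun z => ?_)
  simp only [norm_mul, RCLike.norm_conj, mul_pow]

/-- The function `conj x(t) x(s)` in `L²(ℝ₊ × ℝ₊)`. -/
def conjTensor (x : L2) : Lp ℂ 2 (halfLine.prod halfLine) := (memLp_conj_mul x).toLp _

theorem inner_conjTensor (x y : L2) :
    ⟪conjTensor x, conjTensor y⟫_ℂ = ⟪y, x⟫_ℂ * ⟪x, y⟫_ℂ := by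
  rw [L2.inner_def, L2.inner_def, L2.inner_def, ← integral_prod_mul]
  apply integral_congr_ae
  filter_upwards [(memLp_conj_mul x).coeFn_toLp, (memLp_conj_mul y).coeFn_toLp] with z hx hy
  simp only [conjTensor]
  rw [hx, hy]
  simp only [RCLike.inner_apply, map_mul, Complex.conj_conj]
  ring

theorem resolventForm_eq_inner (hα : 3 / 2 < α) (x : L2) :
    resolventForm α x = ⟪(memLp_resolventKernel hα).toLp _, conjTensor x⟫_ℂ := by
  rw [resolventForm, L2.inner_def]
  apply integral_congr_ae
  filter_upwards [(memLp_conj_mul x).coeFn_toLp, (memLp_resolventKernel hα).coeFn_toLp] with z hx hk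
  simp only [conjTensor]
  rw [hx, hk, RCLike.inner_apply, Complex.conj_ofReal, mul_comm]

theorem gammaConst_nonneg (α : ℝ) : 0 ≤ gammaConst α := Real.sqrt_nonneg _

theorem norm_toLp_resolventKernel (hα : 3 / 2 < α) :
    ‖(memLp_resolventKernel hα).toLp _‖ = gammaConst α / Real.pi := by
  have h : ‖(memLp_resolventKernel hα).toLp _‖ ^ 2 = (gammaConst α / Real.pi) ^ 2 := by
    rw [← integral_resolventKernel_sq, ← inner_self_eq_norm_sq (𝕜 := ℂ), L2.inner_def,
      ← integral_re (L2.integrable_inner _ _)]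
    apply integral_congr_ae
    filter_upwards [(memLp_resolventKernel hα).coeFn_toLp] with z hk
    rw [hk, RCLike.inner_apply, Complex.conj_ofReal, ← Complex.ofReal_mul, RCLike.re_to_complex,
      Complex.ofReal_re, sq]
  exact (pow_left_inj₀ (norm_nonneg _) (div_nonneg (gammaConst_nonneg α) Real.pi_pos.le)
    two_ne_zero).1 h

/-! ### The bound on the dimension of spectral subspaces -/

theorem one_le_of_gap {A E : ℝ} (hA0 : 0 ≤ A) (hA1 : A < 1) (h : 1 ≤ A * E) : 1 ≤ E := by
  by_contra hE
  nlinarith [not_le.1 hE]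

/-- The heart of the count. With x = Q^α V f = K Q^{-α} f, the basic estimate applies to (f,
Q^{-α}x) = (f, V f) = 1, and the two parts of the inverse of π − C are summed separately in ℓ². -/
theorem card_le_of_orthonormal (hα : 3 / 2 < α) (hV : V.IsPositive) (hVhs : IsHilbertSchmidt V)
    (hK : IsWeightedExtension α V K) {W : L2 →L[ℂ] L2} (hW : W.IsPositive)
    (hWV : ∀ x, W (W x) = V x) {ι : Type*} [Fintype ι] (f : ι → L2)
    (hf : Orthonormal ℂ fun i => W (f i))
    (hlt : ∀ i, Real.pi * ‖f i‖ ^ 2 < (⟪f i, (carleman + V) (f i)⟫_ℂ).re)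
    (hψ : ∀ i, ⟪weightedPsi α (by linarith), K (weightOp (by linarith : 0 ≤ α) (f i))⟫_ℂ = 0) :
    (Fintype.card ι : ℝ) ≤ (Real.pi ^ 2)⁻¹ * (hsNorm V + gammaConst α * ‖K‖) ^ 2 := by
  have hα0 : 0 ≤ α := by linarith
  have hpi := Real.pi_pos
  have hKpos := isPositive_extension hα0 hV hK
  obtain ⟨X, hX, hXK⟩ := exists_isPositive_sqrt hKpos
  have hVD : ∀ g, weightOp hα0 (K (weightOp hα0 g)) = V g := weightOp_extension_weightOp hα0 hK
  set x : ι → L2 := fun i => K (weightOp hα0 (f i)) with hx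
  set h : ι → L2 := fun i => X (weightOp hα0 (f i)) with hh
  have hVW : ∀ i j, ⟪f i, V (f j)⟫_ℂ = ⟪W (f i), W (f j)⟫_ℂ := fun i j => by
    rw [← hWV, ← hW.inner_left_eq_inner_right]
  -- The families V^{1/2}fᵢ and K^{1/2}Q^{-α}fᵢ have the same Gram matrix, namely that of the form
  -- of V.
  have hon : Orthonormal ℂ h := by
    classical
    rw [orthonormal_iff_ite] at hf ⊢
    intro i j
    rw [← hf i j, ← hVW, ← hVD, ← inner_weightOp_left, ← hXK]
    exact hX.inner_left_eq_inner_right _ _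
  have hV1 : ∀ i, ⟪f i, V (f i)⟫_ℂ = 1 := fun i => by
    rw [hVW, inner_self_eq_norm_sq_to_K, hf.1 i]
    simp
  set a : ι → ℝ := fun i => Real.pi⁻¹ * ‖V (f i)‖ ^ 2 with ha
  set r : ι → ℝ := fun i => (resolventForm α (x i)).re with hr
  have hE : ∀ i, 1 ≤ a i + r i := by
    intro i
    have hkey := norm_inner_weightOp_sq_le hα (hψ i) (f i)
    rw [hVD, hV1, norm_one, one_pow] at hkey
    -- Because (V f, f) = 1, the assumption that the form of H exceeds π‖f‖² says that the form of π
    -- − C is below 1, so that factor can be dropped.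
    refine one_le_of_gap ?_ ?_ hkey
    · linarith [re_inner_carleman_le (f i)]
    · have := hlt i
      rw [add_apply, inner_add_right, hV1, Complex.add_re, Complex.one_re]
        at this
      linarith
  have hA : ∑ i, a i ^ 2 ≤ (Real.pi⁻¹ * hsNorm V) ^ 2 := by
    have h1 : ∀ i, a i ^ 2 ≤ Real.pi⁻¹ ^ 2 * ‖V (W (f i))‖ ^ 2 := by
      intro i
      -- ‖V f‖² = (V g, g) for the unit vector g = W f; hence the fourth powers of ‖V fᵢ‖ are
      -- summable against the Hilbert–Schmidt norm.
      have h2 : ‖V (f i)‖ ^ 2 ≤ ‖V (W (f i))‖ := by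
        have h3 : (‖V (f i)‖ ^ 2 : ℝ) = (⟪V (W (f i)), W (f i)⟫_ℂ).re := by
          rw [← inner_self_eq_norm_sq (𝕜 := ℂ), ← hWV (f i), hW.inner_left_eq_inner_right, hWV,
            ← hV.inner_left_eq_inner_right]
          rfl
        rw [h3]
        refine (Complex.re_le_norm _).trans ((norm_inner_le_norm _ _).trans ?_)
        rw [hf.1 i, mul_one]
      rw [ha, mul_pow]
      gcongr
    calc _ ≤ ∑ i, Real.pi⁻¹ ^ 2 * ‖V (W (f i))‖ ^ 2 := Finset.sum_le_sum fun i _ => h1 i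
      _ ≤ Real.pi⁻¹ ^ 2 * hsNorm V ^ 2 := by
        rw [← Finset.mul_sum]
        gcongr
        exact sum_norm_sq_apply_le_hsNorm_sq hVhs hf
      _ = _ := by ring
  have hR : ∑ i, r i ^ 2 ≤ (gammaConst α / Real.pi * ‖K‖) ^ 2 := by
    have h1 := sum_sq_re_inner_le ((memLp_resolventKernel hα).toLp _) (fun i => conjTensor (x i))
      (M := ‖K‖) (by
        intro i
        -- Since xᵢ = K^{1/2}hᵢ, Bessel's inequality for the orthonormal hⱼ bounds each row sum of
        -- the Gram matrix by ‖K hᵢ‖² ≤ ‖K‖².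
        have h2 : ∀ j, ‖⟪conjTensor (x i), conjTensor (x j)⟫_ℂ‖ = ‖⟪h j, K (h i)⟫_ℂ‖ ^ 2 := by
          intro j
          rw [inner_conjTensor, norm_mul, ← norm_inner_symm (x j), ← sq]
          have h3 : ∀ j, x j = X (h j) := fun j => by simp only [hx, hh, hXK]
          rw [h3, h3, hX.inner_left_eq_inner_right, hXK]
        simp only [h2]
        refine (hon.sum_inner_products_le (K (h i)) (s := Finset.univ)).trans ?_
        have := K.le_opNorm (h i)
        rw [hon.1 i, mul_one] at this
        gcongr)
    rw [norm_toLp_resolventKernel hα] at h1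
    refine le_trans (le_of_eq (Finset.sum_congr rfl fun i _ => ?_)) h1
    rw [hr, ← resolventForm_eq_inner hα]
  have hhs : 0 ≤ hsNorm V := Real.sqrt_nonneg _
  have hg := gammaConst_nonneg α
  have hcross : ∑ i, a i * r i ≤ (Real.pi⁻¹ * hsNorm V) * (gammaConst α / Real.pi * ‖K‖) := by
    refine le_of_sq_le_sq ?_ (by positivity)
    calc _ ≤ (∑ i, a i ^ 2) * ∑ i, r i ^ 2 := Finset.sum_mul_sq_le_sq_mul_sq _ _ _
      _ ≤ (Real.pi⁻¹ * hsNorm V) ^ 2 * (gammaConst α / Real.pi * ‖K‖) ^ 2 := by gcongr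
      _ = _ := by ring
  calc (Fintype.card ι : ℝ) = ∑ i : ι, (1 : ℝ) := by simp
    -- Each summand is (aᵢ + rᵢ)² ≥ 1; what follows is Minkowski's inequality in expanded form.
    _ ≤ ∑ i, (a i ^ 2 + 2 * (a i * r i) + r i ^ 2) := by
      refine Finset.sum_le_sum fun i _ => ?_
      nlinarith [hE i]
    _ = ∑ i, a i ^ 2 + 2 * ∑ i, a i * r i + ∑ i, r i ^ 2 := by
      rw [Finset.sum_add_distrib, Finset.sum_add_distrib, Finset.mul_sum]
    _ ≤ (Real.pi⁻¹ * hsNorm V) ^ 2 + 2 * ((Real.pi⁻¹ * hsNorm V) *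
        (gammaConst α / Real.pi * ‖K‖)) + (gammaConst α / Real.pi * ‖K‖) ^ 2 := by gcongr
    _ = _ := by field_simp; ring

/-- The summand 1 is the codimension lost by passing to the kernel of the functional f ↦ (Q^{-α}ψ₀,
K Q^{-α} f). -/
theorem finrank_le_of_lt_inner (hα : 3 / 2 < α) (hV : V.IsPositive) (hVhs : IsHilbertSchmidt V)
    (hK : IsWeightedExtension α V K) (F : Submodule ℂ L2) [FiniteDimensional ℂ F]
    (hF : ∀ f ∈ F, f ≠ 0 → Real.pi * ‖f‖ ^ 2 < (⟪f, (carleman + V) f⟫_ℂ).re) :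
    (Module.finrank ℂ F : ℝ) ≤
      (Real.pi ^ 2)⁻¹ * (hsNorm V + gammaConst α * ‖K‖) ^ 2 + 1 := by
  have hα0 : 0 ≤ α := by linarith
  obtain ⟨W, hW, hWV⟩ := exists_isPositive_sqrt hV
  let ℓ : F →ₗ[ℂ] ℂ := ((innerSL ℂ (weightedPsi α (by linarith)) ∘L K ∘L weightOp hα0 :
    L2 →L[ℂ] ℂ) : L2 →ₗ[ℂ] ℂ) ∘ₗ F.subtype
  have hrank := ℓ.finrank_range_add_finrank_ker
  have hrange : Module.finrank ℂ (LinearMap.range ℓ) ≤ 1 := by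
    simpa using Submodule.finrank_le (LinearMap.range ℓ)
  let T : LinearMap.ker ℓ →ₗ[ℂ] L2 := (W : L2 →ₗ[ℂ] L2) ∘ₗ F.subtype ∘ₗ (LinearMap.ker ℓ).subtype
  -- Where V^{1/2} vanishes the form of H reduces to that of C, which never exceeds π.
  have hTinj : Function.Injective T := by
    rw [← LinearMap.ker_eq_bot, LinearMap.ker_eq_bot']
    intro m hm
    by_contra hm0
    have hne : ((m : F) : L2) ≠ 0 := fun h => hm0 (Subtype.ext (Subtype.ext h))
    have h1 := hF _ (m : F).2 hne
    have h2 : V ((m : F) : L2) = 0 := by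
      rw [← hWV]
      have : W ((m : F) : L2) = 0 := hm
      rw [this, map_zero]
    rw [add_apply, h2, add_zero] at h1
    linarith [re_inner_carleman_le ((m : F) : L2)]
  let b := stdOrthonormalBasis ℂ (LinearMap.range T)
  have hb : ∀ i, ∃ m : LinearMap.ker ℓ, T m = b i := fun i => (b i).2
  choose m hm using hb
  have hon : Orthonormal ℂ fun i => W ((m i : F) : L2) := by
    have h1 : (fun i => W ((m i : F) : L2)) = fun i => ((b i : LinearMap.range T) : L2) :=
      funext hm
    rw [h1]
    exact b.orthonormal.comp_linearIsometry (Submodule.subtypeₗᵢ _)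
  have hcard := card_le_of_orthonormal hα hV hVhs hK hW hWV (fun i => ((m i : F) : L2)) hon
    (fun i => hF _ (m i : F).2 (by
      intro h0
      have := hon.ne_zero i
      simp [h0] at this)) (fun i => (m i).2)
  rw [Fintype.card_fin, LinearMap.finrank_range_of_inj hTinj] at hcard
  have h2 : Module.finrank ℂ F ≤ Module.finrank ℂ (LinearMap.ker ℓ) + 1 := by omega
  have h3 : (Module.finrank ℂ F : ℝ) ≤ (Module.finrank ℂ (LinearMap.ker ℓ) : ℝ) + 1 := by
    exact_mod_cast h2
  linarith

theorem isSymmetric_carleman_add (hV : V.IsPositive) :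
    ((carleman + V : L2 →L[ℂ] L2) : L2 →ₗ[ℂ] L2).IsSymmetric := by
  intro f g
  simp only [ContinuousLinearMap.coe_coe, add_apply, inner_add_left,
    inner_add_right]
  rw [inner_carleman_left, hV.inner_left_eq_inner_right]

theorem lt_inner_of_mem_span {E ι : Type*} [NormedAddCommGroup E] [InnerProductSpace ℂ E]
    [Fintype ι] {H : E →L[ℂ] E} {c : ℝ} {e : ι → E} {μ : ι → ℝ} (he : Orthonormal ℂ e)
    (hμ : ∀ i, c < μ i) (hH : ∀ i, H (e i) = (μ i : ℂ) • e i) {f : E}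
    (hf : f ∈ Submodule.span ℂ (range e)) (hf0 : f ≠ 0) :
    c * ‖f‖ ^ 2 < (⟪f, H f⟫_ℂ).re := by
  obtain ⟨l, rfl⟩ := (Submodule.mem_span_range_iff_exists_fun ℂ).1 hf
  have h1 : ∀ d : ι → ℂ, (⟪∑ i, l i • e i, ∑ i, d i • e i⟫_ℂ) =
      ∑ i, starRingEnd ℂ (l i) * d i := fun d => he.inner_sum l d Finset.univ
  have h2 : ‖∑ i, l i • e i‖ ^ 2 = ∑ i, ‖l i‖ ^ 2 := by
    rw [← inner_self_eq_norm_sq (𝕜 := ℂ), h1]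
    simp only [Complex.conj_mul', RCLike.re_to_complex, Complex.re_sum]
    refine Finset.sum_congr rfl fun i _ => ?_
    rw [← Complex.ofReal_pow, Complex.ofReal_re]
  have h3 : H (∑ i, l i • e i) = ∑ i, (l i * μ i) • e i := by
    rw [map_sum]
    refine Finset.sum_congr rfl fun i _ => ?_
    rw [map_smul, hH, smul_smul]
  have h4 : (⟪∑ i, l i • e i, H (∑ i, l i • e i)⟫_ℂ).re = ∑ i, μ i * ‖l i‖ ^ 2 := by
    rw [h3, h1, Complex.re_sum]
    refine Finset.sum_congr rfl fun i _ => ?_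
    rw [← mul_assoc, Complex.conj_mul', ← Complex.ofReal_pow, ← Complex.ofReal_mul,
      Complex.ofReal_re, mul_comm]
  rw [h2, h4, Finset.mul_sum]
  have h5 : ∃ i, l i ≠ 0 := by
    by_contra hcon
    push Not at hcon
    exact hf0 (by simp [hcon])
  obtain ⟨i, hi⟩ := h5
  refine Finset.sum_lt_sum (fun j _ => ?_) ⟨i, Finset.mem_univ i, ?_⟩
  · exact mul_le_mul_of_nonneg_right (hμ j).le (by positivity)
  · exact mul_lt_mul_of_pos_right (hμ i) (by positivity)

theorem eigenvalueCountAbove_carleman_add_le (hα : 3 / 2 < α) (hV : V.IsPositive)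
    (hVhs : IsHilbertSchmidt V) (hK : IsWeightedExtension α V K) :
    eigenvalueCountAbove (carleman + V) Real.pi ≤
      ENNReal.ofReal ((Real.pi ^ 2)⁻¹ * (hsNorm V + gammaConst α * ‖K‖) ^ 2 + 1) := by
  refine eigenvalueCountAbove_le (isSymmetric_carleman_add hV) ?_
  intro ι _ e μ he hμ hH
  have : FiniteDimensional ℂ (Submodule.span ℂ (range e)) :=
    FiniteDimensional.span_of_finite ℂ (finite_range e)
  have h := finrank_le_of_lt_inner hα hV hVhs hK (Submodule.span ℂ (range e))
    (fun f hf hf0 => lt_inner_of_mem_span he hμ hH hf hf0)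
  rwa [finrank_span_eq_card he.linearIndependent] at h

end CountingBound

section EigenvalueExistence

variable {α : ℝ} {V K : L2 →L[ℂ] L2}

/-! ### Existence of an eigenvalue above `π` -/

theorem isCompactOperator_of_extension (hα : 0 ≤ α) (hK : IsWeightedExtension α V K)
    (hKc : IsCompactOperator K) : IsCompactOperator V := by
  have h1 : IsCompactOperator (fun g => weightOp hα (K (weightOp hα g))) :=
    (hKc.comp_clm (weightOp hα)).clm_comp (weightOp hα)
  rwa [show (fun g => weightOp hα (K (weightOp hα g))) = V from
    funext (weightOp_extension_weightOp hα hK)] at h1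

/-- Let l > c be the supremum of the form on the unit sphere. A maximizing sequence satisfies (l −
H)gₙ → 0. Compactness of V makes (l − C)gₙ converge along a subsequence, and l − C is bounded below
by l − c > 0, so gₙ converges to a unit eigenvector. -/
theorem exists_hasEigenvalue_of_lt_inner {E : Type*} [NormedAddCommGroup E]
    [InnerProductSpace ℂ E] [CompleteSpace E] {C V : E →L[ℂ] E} {c : ℝ} (hC : ‖C‖ ≤ c)
    (hV : IsCompactOperator V) (hsymm : ((C + V : E →L[ℂ] E) : E →ₗ[ℂ] E).IsSymmetric) {f : E}
    (hf : c * ‖f‖ ^ 2 < (⟪f, (C + V) f⟫_ℂ).re) :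
    ∃ μ : ℝ, c < μ ∧ Module.End.HasEigenvalue ((C + V : E →L[ℂ] E) : E →ₗ[ℂ] E) (μ : ℂ) := by
  set H := C + V with hH
  set S : Set ℝ := (fun g : E => (⟪g, H g⟫_ℂ).re) '' {g | ‖g‖ = 1} with hS
  have hf0 : f ≠ 0 := by
    rintro rfl
    simp at hf
  have hfn : 0 < ‖f‖ := norm_pos_iff.2 hf0
  have hquad : ∀ (r : ℝ) (g : E), (⟪(r : ℂ) • g, H ((r : ℂ) • g)⟫_ℂ).re =
      r ^ 2 * (⟪g, H g⟫_ℂ).re := by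
    intro r g
    rw [map_smul, inner_smul_left, inner_smul_right, Complex.conj_ofReal, Complex.re_ofReal_mul,
      Complex.re_ofReal_mul]
    ring
  have hunit : ∀ g : E, g ≠ 0 → ‖((‖g‖⁻¹ : ℝ) : ℂ) • g‖ = 1 := by
    intro g hg
    rw [norm_smul, Complex.norm_real, norm_inv, norm_norm, inv_mul_cancel₀ (norm_ne_zero_iff.2 hg)]
  have hSbdd : BddAbove S := by
    refine ⟨‖H‖, ?_⟩
    rintro _ ⟨g, hg, rfl⟩
    have hg' : ‖g‖ = 1 := hg
    calc _ ≤ ‖⟪g, H g⟫_ℂ‖ := Complex.re_le_norm _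
      _ ≤ ‖g‖ * (‖H‖ * ‖g‖) := (norm_inner_le_norm _ _).trans (by gcongr; exact H.le_opNorm g)
      _ = ‖H‖ := by rw [hg']; ring
  have hSne : S.Nonempty := ⟨_, _, hunit f hf0, rfl⟩
  set l := sSup S with hl
  have hle : ∀ g : E, (⟪g, H g⟫_ℂ).re ≤ l * ‖g‖ ^ 2 := by
    intro g
    by_cases hg : g = 0
    · simp [hg]
    have h1 := le_csSup hSbdd ⟨_, hunit g hg, rfl⟩
    simp only at h1
    rw [hquad, inv_pow] at h1
    have := norm_pos_iff.2 hg
    rw [← div_le_iff₀ (by positivity), div_eq_inv_mul]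
    exact h1
  have hcl : c < l := by
    have := hf.trans_le (hle f)
    exact lt_of_mul_lt_mul_right this (by positivity)
  set P : E →L[ℂ] E := (l : ℂ) • ContinuousLinearMap.id ℂ E - H with hP
  have hPapp : ∀ g, P g = (l : ℂ) • g - H g := fun g => by simp [hP]
  have hPre : ∀ g, (⟪g, P g⟫_ℂ).re = l * ‖g‖ ^ 2 - (⟪g, H g⟫_ℂ).re := by
    intro g
    rw [hPapp, inner_sub_right, inner_smul_right, Complex.sub_re, Complex.re_ofReal_mul]
    congr 2
    exact inner_self_eq_norm_sq (𝕜 := ℂ) g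
  have hPpos : P.IsPositive := by
    refine ⟨?_, fun g => ?_⟩
    · intro x y
      have := hsymm x y
      simp only [ContinuousLinearMap.coe_coe] at this ⊢
      rw [hPapp, hPapp, inner_sub_left, inner_sub_right, this, inner_smul_left, inner_smul_right,
        Complex.conj_ofReal]
    · rw [ContinuousLinearMap.reApplyInnerSelf_apply, inner_re_symm, RCLike.re_to_complex, hPre]
      linarith [hle g]
  -- Smallness of the form of P = l − H on gₙ is ‖P^{1/2}gₙ‖ → 0; one more application of P^{1/2}
  -- upgrades this to P gₙ → 0.
  obtain ⟨R, hR, hRP⟩ := exists_isPositive_sqrt hPpos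
  obtain ⟨u, -, hutend, huS⟩ := exists_seq_tendsto_sSup hSne hSbdd
  choose g hg1 hgu using huS
  have hg1' : ∀ n, ‖g n‖ = 1 := hg1
  have hRg : Tendsto (fun n => ‖R (g n)‖ ^ 2) atTop (𝓝 0) := by
    have e : ∀ n, ‖R (g n)‖ ^ 2 = l - u n := by
      intro n
      rw [← inner_self_eq_norm_sq (𝕜 := ℂ), hR.inner_left_eq_inner_right, hRP,
        RCLike.re_to_complex, hPre, hg1' n, ← hgu n]
      ring
    simp_rw [e]
    have h1 := (tendsto_const_nhds (x := l)).sub hutend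
    rwa [← hl, sub_self] at h1
  have hPg : Tendsto (fun n => P (g n)) atTop (𝓝 0) := by
    have h1 : Tendsto (fun n => R (g n)) atTop (𝓝 0) := by
      rw [tendsto_zero_iff_norm_tendsto_zero]
      have := (Real.continuous_sqrt.tendsto 0).comp hRg
      simpa [Function.comp_def, Real.sqrt_sq (norm_nonneg _)] using this
    have h2 := (R.continuous.tendsto 0).comp h1
    simpa [Function.comp_def, hRP] using h2
  have hcpt := hV.isCompact_closure_image_closedBall (𝕜₁ := ℂ) (r := 1)
  obtain ⟨h, -, φ, hφ, hφt⟩ := hcpt.tendsto_subseq (x := fun n => V (g n)) (fun n =>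
    subset_closure ⟨g n, by simp [hg1' n], rfl⟩)
  have hlow : ∀ x : E, (l - c) * ‖x‖ ≤ ‖(l : ℂ) • x - C x‖ := by
    intro x
    have h1 : ‖(l : ℂ) • x‖ - ‖C x‖ ≤ ‖(l : ℂ) • x - C x‖ := norm_sub_norm_le _ _
    have h2 : ‖C x‖ ≤ c * ‖x‖ := (C.le_opNorm x).trans (by gcongr)
    have h3 : l * ‖x‖ ≤ ‖(l : ℂ) • x‖ := by
      rw [norm_smul, Complex.norm_real]
      gcongr
      exact le_abs_self l
    linarith
  have hq : ∀ n, (l : ℂ) • g (φ n) - C (g (φ n)) = P (g (φ n)) + V (g (φ n)) := by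
    intro n
    rw [hPapp, hH, add_apply]
    abel
  have hqt : CauchySeq (fun n => (l : ℂ) • g (φ n) - C (g (φ n))) := by
    simp_rw [hq]
    exact ((hPg.comp hφ.tendsto_atTop).add hφt).cauchySeq
  have hgc : CauchySeq (fun n => g (φ n)) := by
    rw [Metric.cauchySeq_iff'] at hqt ⊢
    intro ε hε
    obtain ⟨N, hN⟩ := hqt (ε * (l - c)) (mul_pos hε (sub_pos.2 hcl))
    refine ⟨N, fun n hn => ?_⟩
    have h1 := hN n hn
    rw [dist_eq_norm] at h1 ⊢
    have h2 := hlow (g (φ n) - g (φ N))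
    have h3 : (l : ℂ) • (g (φ n) - g (φ N)) - C (g (φ n) - g (φ N)) =
      ((l : ℂ) • g (φ n) - C (g (φ n))) - ((l : ℂ) • g (φ N) - C (g (φ N))) := by
      rw [smul_sub, map_sub]; abel
    rw [h3] at h2
    have h4 := sub_pos.2 hcl
    nlinarith
  obtain ⟨x, hx⟩ := cauchySeq_tendsto_of_complete hgc
  have hx1 : ‖x‖ = 1 := by
    have h1 := hx.norm
    simp only [hg1'] at h1
    exact (tendsto_nhds_unique h1 tendsto_const_nhds)
  have hPx : P x = 0 :=
    tendsto_nhds_unique ((P.continuous.tendsto x).comp hx) (hPg.comp hφ.tendsto_atTop)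
  refine ⟨l, hcl, Module.End.hasEigenvalue_of_hasEigenvector (x := x) ⟨?_, ?_⟩⟩
  · rw [Module.End.mem_eigenspace_iff]
    rw [hPapp, sub_eq_zero] at hPx
    exact hPx.symm
  · intro h0
    simp [h0] at hx1

/-! ### Gaussian trial functions -/

/-- The trial function `t^{-1/2} exp(-π b ln² t)`. -/
def trialFun (b t : ℝ) : ℝ := t ^ (-(1 / 2 : ℝ)) * Real.exp (-Real.pi * b * Real.log t ^ 2)

theorem measurable_trialFun (b : ℝ) : Measurable (trialFun b) := by
  unfold trialFun; fun_prop

theorem trialFun_pos (b : ℝ) {t : ℝ} (ht : 0 < t) : 0 < trialFun b t := by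
  unfold trialFun; positivity

theorem trialFun_anti {b c : ℝ} (hbc : b ≤ c) {t : ℝ} (ht : 0 < t) :
    trialFun c t ≤ trialFun b t := by
  unfold trialFun
  have := Real.pi_pos
  have h : -Real.pi * c * Real.log t ^ 2 ≤ -Real.pi * b * Real.log t ^ 2 := by
    have := mul_le_mul_of_nonneg_left hbc (mul_nonneg this.le (sq_nonneg (Real.log t)))
    linarith
  gcongr

theorem trialFun_le {b : ℝ} (hb : 0 ≤ b) {t : ℝ} (ht : 0 < t) :
    trialFun b t ≤ t ^ (-(1 / 2 : ℝ)) := by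
  have h := trialFun_anti hb ht
  simpa [trialFun] using h

theorem memLp_trialFun {b : ℝ} (hb : 0 < b) :
    MemLp (fun t => (trialFun b t : ℂ)) 2 halfLine := by
  have hm := measurable_trialFun b
  have hpi := Real.pi_pos
  -- The constant is chosen so that 1 + L ≤ (1 + 1/(πb))(1 + πbL) ≤ (1 + 1/(πb)) e^{πbL} for L = ln²
  -- t.
  refine MemLp.of_le_mul (c := 1 + 1 / (Real.pi * b)) (memLp_weightedPsi 2 (by norm_num))
    (by fun_prop) ?_
  filter_upwards [ae_restrict_mem measurableSet_Ioi] with t ht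
  have ht' : 0 < t := ht
  rw [Complex.norm_real, Complex.norm_real, Real.norm_of_nonneg (trialFun_pos b ht').le,
    Real.norm_of_nonneg (by have := logWeight_rpow_neg_pos 2 t; positivity)]
  have e : logWeight t ^ (-(2 : ℝ)) = (1 + Real.log t ^ 2)⁻¹ := by
    rw [Real.rpow_neg (logWeight_pos t).le, Real.rpow_two, logWeight, Real.sq_sqrt (by positivity)]
  rw [e, trialFun]
  set L := Real.log t ^ 2 with hL
  have hL0 : 0 ≤ L := sq_nonneg _
  have h1 : Real.exp (-Real.pi * b * L) ≤ (1 + 1 / (Real.pi * b)) * (1 + L)⁻¹ := by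
    have e2 : -Real.pi * b * L = -(Real.pi * b * L) := by ring
    rw [e2, Real.exp_neg, inv_le_comm₀ (Real.exp_pos _) (by positivity), mul_inv, inv_inv]
    have h2 : 1 + Real.pi * b * L ≤ Real.exp (Real.pi * b * L) := by
      linarith [Real.add_one_le_exp (Real.pi * b * L)]
    refine le_trans ?_ h2
    rw [inv_mul_le_iff₀ (by positivity)]
    have h3 : 1 / (Real.pi * b) * (Real.pi * b * L) = L := by field_simp
    have h4 : 0 ≤ 1 / (Real.pi * b) := by positivity
    have h5 : 0 ≤ Real.pi * b * L := by positivity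
    nlinarith
  calc _ ≤ t ^ (-(1 / 2 : ℝ)) * ((1 + 1 / (Real.pi * b)) * (1 + L)⁻¹) := by gcongr
    _ = _ := by ring

/-- The trial function as an element of `L²(ℝ₊)`. -/
def trial {b : ℝ} (hb : 0 < b) : L2 := (memLp_trialFun hb).toLp _

theorem trial_apply {b : ℝ} (hb : 0 < b) : trial hb =ᵐ[halfLine] fun t => (trialFun b t : ℂ) :=
  (memLp_trialFun hb).coeFn_toLp

theorem lineFun_trial {b : ℝ} (hb : 0 < b) :
    lineFun (trial hb) =ᵐ[volume] fun s => (Real.exp (-Real.pi * b * s ^ 2) : ℂ) := by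
  filter_upwards [lineFun_congr (trial_apply hb)] with s hs
  rw [hs]
  simp only [lineFun, trialFun, Real.log_exp]
  rw [← Real.exp_mul, Complex.ofReal_mul, ← mul_assoc, ← Complex.ofReal_mul, ← Real.exp_add]
  have : s / 2 + s * -(1 / 2) = 0 := by ring
  rw [this, Real.exp_zero, Complex.ofReal_one, one_mul, Complex.ofReal_exp]

theorem integrable_lineFun_trial {b : ℝ} (hb : 0 < b) : Integrable (lineFun (trial hb)) := by
  refine Integrable.congr ?_ (lineFun_trial hb).symm
  have h := (integrable_exp_neg_mul_sq (b := Real.pi * b) (by have := Real.pi_pos; positivity))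
  refine (h.ofReal (𝕜 := ℂ)).congr (Eventually.of_forall fun s => ?_)
  simp

theorem norm_mellinFourier_trial_sq {b : ℝ} (hb : 0 < b) (w : ℝ) :
    ‖mellinFourier (trial hb) w‖ ^ 2 = b⁻¹ * Real.exp (-(2 * Real.pi / b) * w ^ 2) := by
  have h1 : mellinFourier (trial hb) w =
      FourierTransform.fourier (fun x : ℝ => Complex.exp (-Real.pi * (b : ℂ) * x ^ 2)) w := by
    rw [mellinFourier, Real.fourier_real_eq_integral_exp_smul,
      Real.fourier_real_eq_integral_exp_smul]
    apply integral_congr_ae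
    filter_upwards [lineFun_trial hb] with s hs
    rw [hs]
    push_cast
    rfl
  rw [h1, fourier_gaussian_pi (by simpa using hb)]
  have e1 : Complex.exp (-Real.pi / (b : ℂ) * (w : ℂ) ^ 2) =
      ((Real.exp (-Real.pi / b * w ^ 2) : ℝ) : ℂ) := by push_cast; rfl
  have e2 : (b : ℂ) ^ (1 / 2 : ℂ) = ((b ^ (1 / 2 : ℝ) : ℝ) : ℂ) := by
    rw [Complex.ofReal_cpow hb.le]; push_cast; rfl
  simp only
  rw [e1, e2, norm_mul, norm_div, norm_one, Complex.norm_real, Complex.norm_real,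
    Real.norm_of_nonneg (Real.exp_nonneg _), Real.norm_of_nonneg (by positivity),
    ← Real.sqrt_eq_rpow, mul_pow, div_pow, Real.sq_sqrt hb.le, ← Real.exp_nat_mul]
  congr 1
  · simp
  · congr 1
    push_cast
    ring

/-- From cosh x ≤ e^{x²/2} one gets 1/cosh x ≥ 1 − x²/2; take x = 2π²w. -/
theorem gapSymbol_le (w : ℝ) : gapSymbol w ≤ 2 * Real.pi ^ 5 * w ^ 2 := by
  set x := 2 * Real.pi ^ 2 * w with hx
  have h1 : Real.cosh x ≤ Real.exp (x ^ 2 / 2) := Real.cosh_le_exp_half_sq x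
  have h2 : 1 - x ^ 2 / 2 ≤ (Real.cosh x)⁻¹ := by
    calc 1 - x ^ 2 / 2 ≤ Real.exp (-(x ^ 2 / 2)) := by
          linarith [Real.add_one_le_exp (-(x ^ 2 / 2))]
      _ = (Real.exp (x ^ 2 / 2))⁻¹ := Real.exp_neg _
      _ ≤ _ := by
        have := Real.cosh_pos x
        gcongr
  have h3 := mul_le_mul_of_nonneg_left h2 Real.pi_pos.le
  rw [gapSymbol, carlemanSymbol, div_eq_mul_inv, ← hx]
  have e : Real.pi * (1 - x ^ 2 / 2) = Real.pi - 2 * Real.pi ^ 5 * w ^ 2 := by rw [hx]; ring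
  linarith

/-- The Gaussian concentrates at frequencies |w| ~ √b, where the gap is quadratic. Half of its
exponent absorbs w²/b and the other half integrates to √b. The trial functions are not normalized,
so they may tend to ψ₀ outside L² while the gap form tends to 0. -/
theorem gap_trial_le {b : ℝ} (hb : 0 < b) :
    Real.pi * ‖trial hb‖ ^ 2 - (⟪trial hb, carleman (trial hb)⟫_ℂ).re ≤
      2 * Real.pi ^ 4 * √b := by
  have hpi := Real.pi_pos
  have hi := integrable_lineFun_trial hb
  have hg : Integrable fun w : ℝ => Real.exp (-(Real.pi / b) * w ^ 2) :=
    integrable_exp_neg_mul_sq (by positivity)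
  rw [pi_mul_norm_sq_sub_inner_carleman hi]
  calc _ ≤ ∫ w, 2 * Real.pi ^ 4 * Real.exp (-(Real.pi / b) * w ^ 2) := by
        refine integral_mono (integrable_gapSymbol_mul hi) (hg.const_mul _) fun w => ?_
        simp only
        rw [norm_mellinFourier_trial_sq]
        have h1 : Real.exp (-(2 * Real.pi / b) * w ^ 2) =
            Real.exp (-(Real.pi / b) * w ^ 2) * Real.exp (-(Real.pi / b) * w ^ 2) := by
          rw [← Real.exp_add]; ring_nf
        have h2 : Real.pi / b * w ^ 2 * Real.exp (-(Real.pi / b) * w ^ 2) ≤ 1 := by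
          rw [neg_mul, Real.exp_neg, mul_inv_le_iff₀ (Real.exp_pos _), one_mul]
          linarith [Real.add_one_le_exp (Real.pi / b * w ^ 2)]
        have h3 := Real.exp_pos (-(Real.pi / b) * w ^ 2)
        calc _ ≤ 2 * Real.pi ^ 5 * w ^ 2 * (b⁻¹ * Real.exp (-(2 * Real.pi / b) * w ^ 2)) := by
              gcongr; exact gapSymbol_le w
          _ = 2 * Real.pi ^ 4 * Real.exp (-(Real.pi / b) * w ^ 2) *
              (Real.pi / b * w ^ 2 * Real.exp (-(Real.pi / b) * w ^ 2)) := by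
              rw [h1]; ring
          _ ≤ 2 * Real.pi ^ 4 * Real.exp (-(Real.pi / b) * w ^ 2) * 1 := by gcongr
          _ = _ := mul_one _
    _ = _ := by
      rw [integral_const_mul, integral_gaussian]
      congr 2
      field_simp

/-- If `(V ψ_b, ψ_b)` stays bounded away from zero as `b → 0`, then `C + V` has an eigenvalue
larger than `π`. -/
theorem exists_hasEigenvalue_of_trial (hV : V.IsPositive) (hVc : IsCompactOperator V) {c : ℝ}
    (hc : 0 < c) (h : ∀ᶠ n : ℕ in atTop,
      c ≤ (⟪trial (Nat.one_div_pos_of_nat (α := ℝ) (n := n)),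
        V (trial (Nat.one_div_pos_of_nat (α := ℝ) (n := n)))⟫_ℂ).re) :
    ∃ μ : ℝ, Real.pi < μ ∧
      Module.End.HasEigenvalue ((carleman + V : L2 →L[ℂ] L2) : L2 →ₗ[ℂ] L2) (μ : ℂ) := by
  have hlim : Tendsto (fun n : ℕ => 2 * Real.pi ^ 4 * √(1 / ((n : ℝ) + 1))) atTop (𝓝 0) := by
    have h1 := (Real.continuous_sqrt.tendsto 0).comp
      (tendsto_one_div_add_atTop_nhds_zero_nat (𝕜 := ℝ))
    simpa using h1.const_mul (2 * Real.pi ^ 4)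
  obtain ⟨n, hn1, hn2⟩ := (h.and (hlim.eventually_lt_const hc)).exists
  refine exists_hasEigenvalue_of_lt_inner norm_carleman_le hVc (isSymmetric_carleman_add hV)
    (f := trial (Nat.one_div_pos_of_nat (α := ℝ) (n := n))) ?_
  have h2 := gap_trial_le (Nat.one_div_pos_of_nat (α := ℝ) (n := n))
  rw [add_apply, inner_add_right, Complex.add_re]
  linarith

/-- Positivity of V makes the limit real and nonnegative, so a nonzero limit is positive and half of
it is an eventual lower bound. -/
theorem exists_hasEigenvalue_of_tendsto (hV : V.IsPositive) (hVc : IsCompactOperator V) {L : ℂ}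
    (hL : L ≠ 0) (h : Tendsto (fun n : ℕ => ⟪trial (Nat.one_div_pos_of_nat (α := ℝ) (n := n)),
        V (trial (Nat.one_div_pos_of_nat (α := ℝ) (n := n)))⟫_ℂ) atTop (𝓝 L)) :
    ∃ μ : ℝ, Real.pi < μ ∧
      Module.End.HasEigenvalue ((carleman + V : L2 →L[ℂ] L2) : L2 →ₗ[ℂ] L2) (μ : ℂ) := by
  have hre := (Complex.continuous_re.tendsto L).comp h
  have him := (Complex.continuous_im.tendsto L).comp h
  have him0 : L.im = 0 := by
    refine tendsto_nhds_unique him ((tendsto_congr fun n => ?_).2 tendsto_const_nhds)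
    exact hV.isSymmetric.im_inner_self_apply _
  have hre0 : 0 ≤ L.re := ge_of_tendsto' hre fun n => hV.re_inner_nonneg_right _
  have hpos : 0 < L.re := lt_of_le_of_ne hre0 fun h0 => hL (Complex.ext h0.symm him0)
  refine exists_hasEigenvalue_of_trial hV hVc (half_pos hpos) ?_
  filter_upwards [hre.eventually_const_lt (half_lt_self hpos)] with n hn
  exact hn.le

end EigenvalueExistence

section TrialLimits

variable {α : ℝ} {V K : L2 →L[ℂ] L2}

/-! ### Limits of the trial forms -/

theorem norm_weightOp_trial_sub_sq (hα : 1 / 2 < α) {b : ℝ} (hb : 0 < b) :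
    ‖weightOp (by linarith : 0 ≤ α) (trial hb) - weightedPsi α hα‖ ^ 2 =
      ∫ s, (lineWeight α s * (Real.exp (-Real.pi * b * s ^ 2) - 1)) ^ 2 := by
  have hα0 : 0 ≤ α := by linarith
  rw [← inner_self_eq_norm_sq (𝕜 := ℂ), inner_eq_integral_lineFun]
  have e : ∫ s, starRingEnd ℂ (lineFun (weightOp hα0 (trial hb) - weightedPsi α hα : L2) s) *
      lineFun (weightOp hα0 (trial hb) - weightedPsi α hα : L2) s
      = ∫ s, (((lineWeight α s * (Real.exp (-Real.pi * b * s ^ 2) - 1)) ^ 2 : ℝ) : ℂ) := by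
    apply integral_congr_ae
    filter_upwards [lineFun_congr (Lp.coeFn_sub (weightOp hα0 (trial hb)) (weightedPsi α hα)),
      lineFun_weightOp hα0 (trial hb), lineFun_trial hb, lineFun_weightedPsi hα] with s h1 h2 h3 h4
    have h5 : lineFun ((weightOp hα0 (trial hb) : ℝ → ℂ) - (weightedPsi α hα : ℝ → ℂ)) s
        = lineFun (weightOp hα0 (trial hb)) s - lineFun (weightedPsi α hα) s := by
      simp only [lineFun, Pi.sub_apply]
      ring
    rw [h1, h5, h2, h3, h4]
    simp only [map_sub, map_mul, Complex.conj_ofReal]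
    push_cast
    ring
  rw [e, integral_complex_ofReal]
  rfl

theorem tendsto_weightOp_trial (hα : 3 / 2 < α) :
    Tendsto (fun n : ℕ => weightOp (by linarith : 0 ≤ α)
      (trial (Nat.one_div_pos_of_nat (α := ℝ) (n := n)))) atTop
      (𝓝 (weightedPsi α (by linarith))) := by
  have hm := measurable_lineWeight α
  have h : Tendsto (fun n : ℕ => ∫ s, (lineWeight α s *
      (Real.exp (-Real.pi * (1 / ((n : ℝ) + 1)) * s ^ 2) - 1)) ^ 2) atTop
      (𝓝 (∫ _ : ℝ, (0 : ℝ))) := by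
    refine tendsto_integral_of_dominated_convergence
      (fun s => ((1 + |s|) * lineWeight α s) ^ 2) (fun n => by fun_prop)
      (integrable_one_add_abs_mul_lineWeight_sq hα) (fun n => Eventually.of_forall fun s => ?_)
      (Eventually.of_forall fun s => ?_)
    · have h1 : Real.exp (-Real.pi * (1 / ((n : ℝ) + 1)) * s ^ 2) ≤ 1 := by
        rw [Real.exp_le_one_iff]
        have : 0 ≤ Real.pi * (1 / ((n : ℝ) + 1)) * s ^ 2 := by
          have := Real.pi_pos
          positivity
        linarith
      have h2 := Real.exp_pos (-Real.pi * (1 / ((n : ℝ) + 1)) * s ^ 2)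
      have h3 := lineWeight_pos α s
      rw [Real.norm_of_nonneg (sq_nonneg _), mul_pow, mul_pow, mul_comm]
      gcongr ?_ * _
      nlinarith [abs_nonneg s]
    · have h1 : Tendsto (fun n : ℕ => -Real.pi * (1 / ((n : ℝ) + 1)) * s ^ 2) atTop (𝓝 0) := by
        have := (tendsto_one_div_add_atTop_nhds_zero_nat (𝕜 := ℝ)).const_mul (-Real.pi)
        simpa using this.mul_const (s ^ 2)
      have h2 := (Real.continuous_exp.tendsto 0).comp h1
      rw [Real.exp_zero] at h2
      have h3 := ((h2.sub_const 1).const_mul (lineWeight α s)).pow 2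
      simpa using h3
  rw [integral_zero] at h
  rw [tendsto_iff_norm_sub_tendsto_zero]
  have h2 := (Real.continuous_sqrt.tendsto 0).comp h
  rw [Real.sqrt_zero] at h2
  refine h2.congr fun n => ?_
  rw [Function.comp_apply, ← norm_weightOp_trial_sub_sq (by linarith)
    (Nat.one_div_pos_of_nat (α := ℝ) (n := n)), Real.sqrt_sq (norm_nonneg _)]

/-- Factoring V = Q^{-α} K Q^{-α} puts the weights on the trial functions, which then converge in
norm. -/
theorem tendsto_inner_trial_psiForm (hα : 3 / 2 < α) (hK : IsWeightedExtension α V K) :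
    Tendsto (fun n : ℕ => ⟪trial (Nat.one_div_pos_of_nat (α := ℝ) (n := n)),
      V (trial (Nat.one_div_pos_of_nat (α := ℝ) (n := n)))⟫_ℂ) atTop
      (𝓝 (psiForm α (by linarith) K)) := by
  have h := tendsto_weightOp_trial hα
  have h2 := h.inner ((K.continuous.tendsto _).comp h) (𝕜 := ℂ)
  refine h2.congr fun n => ?_
  rw [Function.comp_apply, inner_weightOp_left, weightOp_extension_weightOp (by linarith) hK]

theorem integrable_integralOperator {v : ℝ → ℝ → ℂ} (hv : IsIntegralOperator v V) (f g : L2) :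
    Integrable (fun z : ℝ × ℝ => starRingEnd ℂ (f z.1) * (v z.1 z.2 * g z.2))
      (halfLine.prod halfLine) := by
  have hf := Lp.aestronglyMeasurable f
  have hg := Lp.aestronglyMeasurable g
  have hm : AEStronglyMeasurable (fun z : ℝ × ℝ => starRingEnd ℂ (f z.1) * g z.2)
      (halfLine.prod halfLine) :=
    (Complex.continuous_conj.comp_aestronglyMeasurable hf).comp_fst.mul hg.comp_snd
  have hfg : MemLp (fun z : ℝ × ℝ => starRingEnd ℂ (f z.1) * g z.2) 2
      (halfLine.prod halfLine) := by
    rw [memLp_two_iff_integrable_sq_norm hm]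
    have h1 := (memLp_two_iff_integrable_sq_norm hf).1 (Lp.memLp f)
    have h2 := (memLp_two_iff_integrable_sq_norm hg).1 (Lp.memLp g)
    refine (h1.mul_prod h2).congr (Eventually.of_forall fun z => ?_)
    simp only [norm_mul, RCLike.norm_conj, mul_pow]
  refine (hfg.integrable_mul hv.1).congr (Eventually.of_forall fun z => ?_)
  simp only [Pi.mul_apply, Function.uncurry]
  ring

theorem inner_integralOperator {v : ℝ → ℝ → ℂ} (hv : IsIntegralOperator v V) (f g : L2) :
    ⟪f, V g⟫_ℂ = ∫ z, starRingEnd ℂ (f z.1) * (v z.1 z.2 * g z.2) ∂(halfLine.prod halfLine) := by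
  rw [integral_prod _ (integrable_integralOperator hv f g), L2.inner_def]
  apply integral_congr_ae
  filter_upwards [hv.2 g] with t ht
  rw [RCLike.inner_apply, ht, integral_const_mul, mul_comm]

theorem trial_prod_apply {b : ℝ} (hb : 0 < b) : ∀ᵐ z ∂(halfLine.prod halfLine),
    trial hb z.1 = (trialFun b z.1 : ℂ) ∧ trial hb z.2 = (trialFun b z.2 : ℂ) := by
  filter_upwards [Measure.quasiMeasurePreserving_fst.ae_eq_comp (trial_apply hb),
    Measure.quasiMeasurePreserving_snd.ae_eq_comp (trial_apply hb)] with z h1 h2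
  exact ⟨h1, h2⟩

theorem inner_trial_eq {v : ℝ → ℝ → ℂ} (hv : IsIntegralOperator v V) {b : ℝ} (hb : 0 < b) :
    ⟪trial hb, V (trial hb)⟫_ℂ = ∫ z, v z.1 z.2 * ((trialFun b z.1 * trialFun b z.2 : ℝ) : ℂ)
      ∂(halfLine.prod halfLine) := by
  rw [inner_integralOperator hv]
  apply integral_congr_ae
  filter_upwards [trial_prod_apply hb] with z hz
  rw [hz.1, hz.2, Complex.conj_ofReal]
  push_cast
  ring

theorem tendsto_inner_trial_kernel {v : ℝ → ℝ → ℂ} (hv : IsIntegralOperator v V)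
    (hint : Integrable (fun z => v z.1 z.2 * (((z.1 * z.2) ^ (-(1 / 2 : ℝ)) : ℝ) : ℂ))
      (halfLine.prod halfLine)) :
    Tendsto (fun n : ℕ => ⟪trial (Nat.one_div_pos_of_nat (α := ℝ) (n := n)),
      V (trial (Nat.one_div_pos_of_nat (α := ℝ) (n := n)))⟫_ℂ) atTop
      (𝓝 (∫ z, v z.1 z.2 * (((z.1 * z.2) ^ (-(1 / 2 : ℝ)) : ℝ) : ℂ)
        ∂(halfLine.prod halfLine))) := by
  simp_rw [inner_trial_eq hv]
  have hvm : AEStronglyMeasurable (fun z : ℝ × ℝ => v z.1 z.2) (halfLine.prod halfLine) := hv.1.1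
  refine tendsto_integral_of_dominated_convergence _ (fun n => ?_) hint.norm (fun n => ?_) ?_
  · have := measurable_trialFun (1 / ((n : ℝ) + 1))
    refine hvm.mul (Measurable.aestronglyMeasurable ?_)
    fun_prop
  · filter_upwards [ae_pos_prod] with z hz
    rw [norm_mul, norm_mul, Complex.norm_real, Complex.norm_real]
    have h0 : (0 : ℝ) ≤ 1 / ((n : ℝ) + 1) := by positivity
    have h1 := trialFun_pos (1 / ((n : ℝ) + 1)) hz.1
    have h2 := trialFun_pos (1 / ((n : ℝ) + 1)) hz.2
    rw [Real.norm_of_nonneg (by positivity), Real.norm_of_nonneg (by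
      have := mul_pos hz.1 hz.2; positivity), Real.mul_rpow hz.1.le hz.2.le]
    gcongr
    · have := hz.1; positivity
    · exact trialFun_le h0 hz.1
    · exact trialFun_le h0 hz.2
  · filter_upwards [ae_pos_prod] with z hz
    have hlim : ∀ t : ℝ, Tendsto (fun n : ℕ => trialFun (1 / ((n : ℝ) + 1)) t) atTop
        (𝓝 (t ^ (-(1 / 2 : ℝ)))) := by
      intro t
      have h1 : Tendsto (fun n : ℕ => -Real.pi * (1 / ((n : ℝ) + 1)) * Real.log t ^ 2) atTop
          (𝓝 0) := by
        have := (tendsto_one_div_add_atTop_nhds_zero_nat (𝕜 := ℝ)).const_mul (-Real.pi)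
        simpa using this.mul_const (Real.log t ^ 2)
      have h2 := (Real.continuous_exp.tendsto 0).comp h1
      rw [Real.exp_zero] at h2
      simpa [trialFun] using h2.const_mul (t ^ (-(1 / 2 : ℝ)))
    rw [Real.mul_rpow hz.1.le hz.2.le]
    exact ((Complex.continuous_ofReal.tendsto _).comp
      ((hlim z.1).mul (hlim z.2))).const_mul (v z.1 z.2)

/-! ### Positive Hankel operators -/

/-- By Fubini almost every slice v(t + ·) is square integrable on the half-line; a slice with 0 < t
< η covers (η, ∞). -/
theorem memLp_indicator_of_hankel {v : ℝ → ℂ} (hvm : AEStronglyMeasurable v halfLine)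
    (hv : MemLp (Function.uncurry fun t s => v (t + s)) 2 (halfLine.prod halfLine)) {η : ℝ}
    (hη : 0 < η) : MemLp ((Ioi η).indicator v) 2 := by
  have h1 := ((memLp_two_iff_integrable_sq_norm hv.1).1 hv).prod_right_ae
  have h2 : ∀ᵐ t ∂(volume.restrict (Ioo 0 η)), Integrable (fun s => ‖v (t + s)‖ ^ 2) halfLine :=
    ae_mono (Measure.restrict_mono Ioo_subset_Ioi_self le_rfl) h1
  have hne : NeBot (ae (volume.restrict (Ioo 0 η))) := by
    rw [ae_neBot, Ne, Measure.restrict_eq_zero]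
    simp [hη]
  obtain ⟨t, ht, htm⟩ := (h2.and (ae_restrict_mem measurableSet_Ioo)).exists
  have h3 : IntegrableOn (fun τ => ‖v τ‖ ^ 2) (Ioi t) := by
    have := (measurePreserving_add_left (volume : Measure ℝ) t).integrableOn_comp_preimage
      (measurableEmbedding_addLeft t) (f := fun τ => ‖v τ‖ ^ 2) (s := Ioi t)
    rw [← this]
    have e : (fun x => t + x) ⁻¹' Ioi t = Ioi 0 := by ext x; simp
    rw [e]
    exact ht
  rw [memLp_indicator_iff_restrict measurableSet_Ioi, memLp_two_iff_integrable_sq_norm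
    (hvm.mono_measure (Measure.restrict_mono (Ioi_subset_Ioi hη.le) le_rfl))]
  exact h3.mono_set (Ioi_subset_Ioi htm.2.le)

/-- As s runs over the ball of radius d about a, t + s stays within 2d of 2a. -/
theorem norm_setIntegral_hankel_sub_le {u : ℝ → ℂ} (hu : LocallyIntegrable u) {a d t τ : ℝ}
    (hd : 0 < d) (ht : t ∈ Metric.closedBall a d) (hτ : τ = a + a) (c : ℂ) :
    ‖(∫ s in Metric.closedBall a d, u (t + s)) - (2 * d : ℝ) * c‖ ≤
      ∫ y in Metric.closedBall τ (2 * d), ‖u y - c‖ := by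
  have hmp := measurePreserving_add_left (volume : Measure ℝ) t
  have hpre : (fun x => t + x) ⁻¹' Metric.closedBall (t + a) d = Metric.closedBall a d := by
    ext x; simp [Real.dist_eq]
  have h1 : ∫ s in Metric.closedBall a d, u (t + s) =
      ∫ y in Metric.closedBall (t + a) d, u y := by
    have := hmp.setIntegral_preimage_emb (measurableEmbedding_addLeft t) u
      (Metric.closedBall (t + a) d)
    rw [hpre] at this
    exact this
  have hui : ∀ x r : ℝ, IntegrableOn u (Metric.closedBall x r) := fun x r =>
    hu.integrableOn_isCompact (isCompact_closedBall x r)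
  have hci : ∀ x r : ℝ, IntegrableOn (fun _ => c) (Metric.closedBall x r) := fun x r =>
    integrableOn_const measure_closedBall_lt_top.ne
  have h2 : ∫ _ in Metric.closedBall (t + a) d, c = (2 * d : ℝ) * c := by
    rw [setIntegral_const, Real.volume_real_closedBall hd.le, Complex.real_smul]
  rw [h1, ← h2, ← integral_sub (hui _ _) (hci _ _)]
  refine (norm_integral_le_integral_norm _).trans ?_
  refine setIntegral_mono_set ((hui _ _).sub (hci _ _)).norm
    (Eventually.of_forall fun _ => norm_nonneg _) (LE.le.eventuallyLE ?_)
  refine Metric.closedBall_subset_closedBall' ?_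
  have h3 := Metric.mem_closedBall.1 ht
  rw [Real.dist_eq] at h3 ⊢
  have e : t + a - τ = t - a := by rw [hτ]; ring
  rw [e]
  linarith

open scoped ComplexOrder in
-- Testing V on the indicator of a small ball about τ/2 averages v(t + s) over a square shrinking to
-- (τ/2, τ/2). These averages are nonnegative and tend to v(τ) at every Lebesgue point. Truncation
-- to τ > 1/(n + 1) makes v locally integrable.
theorem ae_nonneg_of_hankel {v : ℝ → ℂ} (hvm : AEStronglyMeasurable v halfLine)
    (hv : IsIntegralOperator (fun t s => v (t + s)) V) (hV : V.IsPositive) :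
    ∀ᵐ τ ∂halfLine, 0 ≤ v τ := by
  have key : ∀ n : ℕ, ∀ᵐ τ : ℝ, 1 / ((n : ℝ) + 1) < τ → 0 ≤ v τ := by
    intro n
    set η : ℝ := 1 / ((n : ℝ) + 1) with hηdef
    have hη : 0 < η := Nat.one_div_pos_of_nat
    set u := (Ioi η).indicator v with hu
    have huL : LocallyIntegrable u :=
      (memLp_indicator_of_hankel hvm hv.1 hη).locallyIntegrable (by norm_num)
    filter_upwards [IsUnifLocDoublingMeasure.ae_tendsto_average_norm_sub volume huL 1] with τ hτ hlt
    have hut : u τ = v τ := indicator_of_mem (mem_Ioi.2 hlt) v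
    have hτ0 : 0 < τ := hη.trans hlt
    set d : ℕ → ℝ := fun m => 1 / ((m : ℝ) + 1) with hd
    have hd0 : ∀ m, 0 < d m := fun m => Nat.one_div_pos_of_nat
    have hdlim : Tendsto d atTop (𝓝 0) := tendsto_one_div_add_atTop_nhds_zero_nat
    have hlim := hτ (l := atTop) (fun _ : ℕ => τ) (fun m => 2 * d m)
      (tendsto_nhdsWithin_iff.2 ⟨by simpa using hdlim.const_mul 2,
        Eventually.of_forall fun m => by have := hd0 m; simp only [mem_Ioi]; positivity⟩)
      (Eventually.of_forall fun m => by
        have := hd0 m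
        exact Metric.mem_closedBall_self (by positivity))
    set B : ℕ → Set ℝ := fun m => Metric.closedBall (τ / 2) (d m) with hB
    have hBm : ∀ m, MeasurableSet (B m) := fun m => measurableSet_closedBall
    have hBf : ∀ m, halfLine (B m) ≠ ⊤ := fun m =>
      ((Measure.restrict_apply_le _ _).trans_lt measure_closedBall_lt_top).ne
    set f : ℕ → L2 := fun m => indicatorConstLp 2 (hBm m) (hBf m) (1 : ℂ) with hf
    set q : ℕ → ℂ := fun m => ⟪f m, V (f m)⟫_ℂ with hq
    have hq0 : ∀ m, 0 ≤ q m := fun m => hV.inner_nonneg_right _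
    -- 4d² is the area of the square. The factor 2 compares I · 2d / (4d²) with the mean I/(4d) over
    -- the ball of radius 2d.
    have hev : ∀ᶠ m in atTop, ‖(((4 * d m ^ 2)⁻¹ : ℝ) : ℂ) * q m - v τ‖ ≤
        2 * ⨍ y in Metric.closedBall τ (2 * d m), ‖u y - u τ‖ := by
      -- This keeps t + s above η on the square, so the truncation is invisible there, and keeps the
      -- ball inside the half-line.
      have h1 : ∀ᶠ m in atTop, d m < (τ - η) / 2 :=
        hdlim.eventually_lt_const (by linarith)
      filter_upwards [h1] with m hm
      have hdm := hd0 m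
      have hBsub : B m ⊆ Ioi 0 := by
        intro x hx
        have := Metric.mem_closedBall.1 hx
        rw [Real.dist_eq, abs_le] at this
        simp only [mem_Ioi]
        linarith
      have hrestr : halfLine.restrict (B m) = volume.restrict (B m) :=
        Measure.restrict_restrict_of_subset hBsub
      have hVf : ∀ᵐ t ∂(volume.restrict (B m)),
          V (f m) t = ∫ s in B m, u (t + s) := by
        rw [← hrestr]
        filter_upwards [ae_restrict_of_ae (hv.2 (f m)), ae_restrict_mem (hBm m)] with t ht htB
        rw [ht]
        have h2 : ∫ s in Ioi (0 : ℝ), v (t + s) * f m s =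
            ∫ s in Ioi (0 : ℝ), (B m).indicator (fun s => v (t + s)) s := by
          apply integral_congr_ae
          filter_upwards [indicatorConstLp_coeFn (p := 2) (hs := hBm m) (hμs := hBf m)
            (c := (1 : ℂ))] with s hs
          rw [hf, hs]
          by_cases hsB : s ∈ B m
          · simp [hsB]
          · simp [hsB]
        rw [h2, integral_indicator (hBm m), hrestr]
        refine setIntegral_congr_fun (hBm m) fun s hs => ?_
        have h3 := Metric.mem_closedBall.1 hs
        have h4 := Metric.mem_closedBall.1 htB
        rw [Real.dist_eq, abs_le] at h3 h4
        exact (indicator_of_mem (mem_Ioi.2 (by linarith)) v).symm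
      set I := ∫ y in Metric.closedBall τ (2 * d m), ‖u y - u τ‖ with hI
      have hq1 : q m = ∫ t in B m, V (f m) t := by
        rw [hq, hf]
        simp only
        rw [L2.inner_indicatorConstLp_one, hrestr]
      have hfin : IsFiniteMeasure (volume.restrict (B m)) :=
        ⟨by
          rw [Measure.restrict_apply_univ]
          exact measure_closedBall_lt_top⟩
      have hVi : Integrable (V (f m)) (volume.restrict (B m)) := by
        have := (Lp.memLp (V (f m))).restrict (B m)
        rw [hrestr] at this
        exact this.integrable (by norm_num)
      have hvol : volume.real (B m) = 2 * d m := Real.volume_real_closedBall hdm.le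
      have hdiff : ‖q m - ((4 * d m ^ 2 : ℝ) : ℂ) * v τ‖ ≤ I * (2 * d m) := by
        have h2 : ∫ _ in B m, ((2 * d m : ℝ) : ℂ) * u τ = ((4 * d m ^ 2 : ℝ) : ℂ) * v τ := by
          rw [setIntegral_const, hvol, Complex.real_smul, hut]
          push_cast
          ring
        rw [hq1, ← h2, ← integral_sub hVi (integrable_const _)]
        have h3 := (ae_restrict_iff' (hBm m)).1 hVf
        refine (norm_setIntegral_le_of_norm_le_const_ae' (C := I)
          measure_closedBall_lt_top ?_).trans_eq (by rw [hvol])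
        filter_upwards [h3] with t ht htB
        rw [ht htB]
        exact norm_setIntegral_hankel_sub_le huL hdm htB (by ring) _
      have havg : ⨍ y in Metric.closedBall τ (2 * d m), ‖u y - u τ‖ = (4 * d m)⁻¹ * I := by
        rw [setAverage_eq, Real.volume_real_closedBall (by positivity), smul_eq_mul]
        congr 2
        ring
      have hsplit : (((4 * d m ^ 2)⁻¹ : ℝ) : ℂ) * q m - v τ =
          (((4 * d m ^ 2)⁻¹ : ℝ) : ℂ) * (q m - ((4 * d m ^ 2 : ℝ) : ℂ) * v τ) := by
        rw [mul_sub, ← mul_assoc, ← Complex.ofReal_mul, inv_mul_cancel₀ (by positivity),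
          Complex.ofReal_one, one_mul]
      rw [hsplit, havg, norm_mul, Complex.norm_real, Real.norm_of_nonneg (by positivity)]
      calc _ ≤ (4 * d m ^ 2)⁻¹ * (I * (2 * d m)) := by gcongr
        _ = _ := by field_simp
    have htend : Tendsto (fun m => (((4 * d m ^ 2)⁻¹ : ℝ) : ℂ) * q m) atTop (𝓝 (v τ)) := by
      rw [tendsto_iff_norm_sub_tendsto_zero]
      refine squeeze_zero' (Eventually.of_forall fun m => norm_nonneg _) hev ?_
      simpa using hlim.const_mul 2
    refine ge_of_tendsto' htend fun m => mul_nonneg ?_ (hq0 m)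
    have := hd0 m
    exact_mod_cast (by positivity : (0 : ℝ) ≤ (4 * d m ^ 2)⁻¹)
  rw [ae_restrict_iff' measurableSet_Ioi]
  filter_upwards [ae_all_iff.2 key] with τ hτ hτ0
  obtain ⟨n, hn⟩ := exists_nat_one_div_lt (mem_Ioi.1 hτ0)
  exact hτ n hn

/-- Addition is the second coordinate of a measure-preserving shear, so it pulls null sets back to
null sets. -/
theorem ae_add_of_ae_halfLine {p : ℝ → Prop} (h : ∀ᵐ τ ∂halfLine, p τ) :
    ∀ᵐ z ∂(halfLine.prod halfLine), p (z.1 + z.2) := by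
  rw [ae_restrict_iff' measurableSet_Ioi] at h
  have hq : Measure.QuasiMeasurePreserving (fun z : ℝ × ℝ => z.1 + z.2)
      (volume.prod volume) volume :=
    Measure.quasiMeasurePreserving_snd.comp
      (measurePreserving_prod_add (volume : Measure ℝ) volume).quasiMeasurePreserving
  have h1 := hq.ae h
  have h2 : ∀ᵐ z ∂(halfLine.prod halfLine), z.1 + z.2 ∈ Ioi (0 : ℝ) → p (z.1 + z.2) := by
    rw [Measure.prod_restrict]
    exact ae_restrict_of_ae h1
  filter_upwards [h2, ae_pos_prod] with z hz hp
  exact hz (add_pos hp.1 hp.2)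

/-- With v ≥ 0 the form increases as b = 1/(n + 1) decreases, so its value at b = 1 is a uniform
lower bound. That value is positive: the trial functions are strictly positive, so a zero integral
would force v(t + s) = 0 almost everywhere and V = 0. -/
theorem exists_trial_lower_bound_of_hankel (hV : V.IsPositive) (hH : IsHankel V) (hV0 : V ≠ 0) :
    ∃ c : ℝ, 0 < c ∧ ∀ n : ℕ, c ≤ (⟪trial (Nat.one_div_pos_of_nat (α := ℝ) (n := n)),
      V (trial (Nat.one_div_pos_of_nat (α := ℝ) (n := n)))⟫_ℂ).re := by
  obtain ⟨v, hvm, hv⟩ := hH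
  have hv0 := ae_add_of_ae_halfLine (ae_nonneg_of_hankel hvm hv hV)
  have hint : ∀ b : ℝ, 0 < b → Integrable (fun z : ℝ × ℝ => (v (z.1 + z.2)).re *
      (trialFun b z.1 * trialFun b z.2)) (halfLine.prod halfLine) := by
    intro b hb
    refine (integrable_integralOperator hv (trial hb) (trial hb)).re.congr ?_
    filter_upwards [trial_prod_apply hb] with z hz
    rw [hz.1, hz.2, Complex.conj_ofReal, mul_left_comm, ← Complex.ofReal_mul]
    simp
  have hre : ∀ (b : ℝ) (hb : 0 < b), (⟪trial hb, V (trial hb)⟫_ℂ).re =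
      ∫ z, (v (z.1 + z.2)).re * (trialFun b z.1 * trialFun b z.2) ∂(halfLine.prod halfLine) := by
    intro b hb
    rw [inner_trial_eq hv]
    have hi : Integrable (fun z : ℝ × ℝ => v (z.1 + z.2) *
        ((trialFun b z.1 * trialFun b z.2 : ℝ) : ℂ)) (halfLine.prod halfLine) := by
      refine (integrable_integralOperator hv (trial hb) (trial hb)).congr ?_
      filter_upwards [trial_prod_apply hb] with z hz
      rw [hz.1, hz.2, Complex.conj_ofReal]
      push_cast
      ring
    refine (integral_re hi).symm.trans ?_
    congr 1
    ext z
    simp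
  have hnn : 0 ≤ᵐ[halfLine.prod halfLine] fun z : ℝ × ℝ => (v (z.1 + z.2)).re *
      (trialFun 1 z.1 * trialFun 1 z.2) := by
    filter_upwards [hv0, ae_pos_prod] with z hz hp
    exact mul_nonneg (Complex.nonneg_iff.1 hz).1
      (mul_pos (trialFun_pos 1 hp.1) (trialFun_pos 1 hp.2)).le
  refine ⟨(⟪trial one_pos, V (trial one_pos)⟫_ℂ).re, ?_, fun n => ?_⟩
  · rw [hre]
    refine lt_of_le_of_ne (integral_nonneg_of_ae hnn) fun h0 => hV0 ?_
    have hz := (integral_eq_zero_iff_of_nonneg_ae hnn (hint 1 one_pos)).1 h0.symm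
    have hzero : ∀ᵐ z ∂(halfLine.prod halfLine), v (z.1 + z.2) = 0 := by
      filter_upwards [hz, hv0, ae_pos_prod] with z h1 h2 hp
      have h3 := mul_pos (trialFun_pos 1 hp.1) (trialFun_pos 1 hp.2)
      have h4 : (v (z.1 + z.2)).re = 0 := by
        rcases mul_eq_zero.1 h1 with h | h
        · exact h
        · exact absurd h h3.ne'
      exact Complex.ext h4 (Complex.nonneg_iff.1 h2).2.symm
    ext1 f
    rw [zero_apply]
    apply Lp.ext
    filter_upwards [hv.2 f, Measure.ae_ae_of_ae_prod hzero, Lp.coeFn_zero ℂ 2 halfLine]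
      with t h1 h2 h3
    rw [h1, h3, Pi.zero_apply]
    apply integral_eq_zero_of_ae
    filter_upwards [h2] with s hs
    rw [hs, zero_mul, Pi.zero_apply]
  · rw [hre, hre]
    refine integral_mono_ae (hint 1 one_pos) (hint _ Nat.one_div_pos_of_nat) ?_
    filter_upwards [hv0, ae_pos_prod] with z hz hp
    have hle : 1 / ((n : ℝ) + 1) ≤ 1 := by
      rw [div_le_one (by positivity)]
      linarith [(Nat.cast_nonneg n : (0 : ℝ) ≤ n)]
    have h0 := (Complex.nonneg_iff.1 hz).1
    have h1 := trialFun_pos 1 hp.1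
    have h2 := trialFun_pos 1 hp.2
    have h3 := trialFun_pos (1 / ((n : ℝ) + 1)) hp.1
    gcongr
    · exact trialFun_anti hle hp.1
    · exact trialFun_anti hle hp.2

end TrialLimits

end

end CarlemanPerturbation

/-! ### The main theorem -/

open CarlemanPerturbation in
theorem theorem6p4 (α : ℝ) (hα : 3 / 2 < α)
    (V K : L2 →L[ℂ] L2)
    (hVpos : V.IsPositive)
    (hVhs : IsHilbertSchmidt V)
    (hK : IsWeightedExtension α V K)
    (hKc : IsCompactOperator K) :
    (MeasureTheory.Integrable (gammaIntegrand α) (halfLine.prod halfLine) ∧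
      eigenvalueCountAbove (carleman + V) Real.pi < ⊤ ∧
      eigenvalueCountAbove (carleman + V) Real.pi ≤
        ENNReal.ofReal ((Real.pi ^ 2)⁻¹ * (hsNorm V + gammaConst α * ‖K‖) ^ 2 + 1)) ∧
    ((psiForm α (by linarith) K ≠ 0 ∨
        (∃ v : ℝ → ℝ → ℂ, IsIntegralOperator v V ∧
          ∫ z, v z.1 z.2 * (((z.1 * z.2) ^ (-(1 / 2 : ℝ)) : ℝ) : ℂ)
            ∂(halfLine.prod halfLine) ≠ 0) ∨
        (IsHankel V ∧ V ≠ 0)) →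
      ∃ μ : ℝ, Real.pi < μ ∧
        Module.End.HasEigenvalue ((carleman + V : L2 →L[ℂ] L2) : L2 →ₗ[ℂ] L2) (μ : ℂ)) := by
  have hcount := eigenvalueCountAbove_carleman_add_le hα hVpos hVhs hK
  refine ⟨⟨integrable_gammaIntegrand hα, hcount.trans_lt ENNReal.ofReal_lt_top, hcount⟩, ?_⟩
  have hVc := isCompactOperator_of_extension (by linarith) hK hKc
  rintro (h | ⟨v, hv, h⟩ | ⟨hH, h⟩)
  · exact exists_hasEigenvalue_of_tendsto hVpos hVc h (tendsto_inner_trial_psiForm hα hK)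
  -- Absolute convergence in (b) is implied by the nonzero value, since the Bochner integral of a
  -- non-integrable function is 0.
  · exact exists_hasEigenvalue_of_tendsto hVpos hVc h
      (tendsto_inner_trial_kernel hv (MeasureTheory.Integrable.of_integral_ne_zero h))
  · obtain ⟨c, hc, hle⟩ := exists_trial_lower_bound_of_hankel hVpos hH h
    exact exists_hasEigenvalue_of_trial hVpos hVc hc (Filter.Eventually.of_forall hle)
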